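/- **Theorem (Convergence rate of DR-SOPO).** *Setting.* Let $(\mathcal S,\mathcal A,\mathcal P,r,\gamma)$ be a Markov decision process with transition kernel $\mathcal P$, cost $r:\mathcal S\times\mathcal A\to\mathbb R$, discount $\gamma\in[0,1)$ and initial law $\rho$. Let $d\ge 2$ and let $\pi_\theta(a\mid s)>0$, $\theta\in\mathbb R^d$, be policy densities with respect to a $\sigma$-finite measure on $\mathcal A$, with $\theta\mapsto\log\pi_\theta(a\mid s)$ twice continuously differentiable. For a horizon $H$ let $p(\cdot;\theta)$ be the law of the trajectory $\tau=(s_0,a_0,\dots,s_{H-1},a_{H-1})$ under $\pi_\theta$, let $J(\theta)=\mathbb E_{\tau\sim p(\cdot;\theta)}\big[\sum_{h=0}^{H-1}\gamma^h r(s_h,a_h)\big]$ and $J^*=\inf_\theta J(\theta)$. With $\Psi_h(\tau)=\sum_{i=h}^{H-1}\gamma^i r(s_i,a_i)$ put $$g(\theta;\tau)=\sum_{h=0}^{H-1}\Psi_h(\tau)\nabla_\theta\log\pi_\theta(a_h\mid s_h),\qquad H(\theta;\tau)=\nabla_\theta g(\theta;\tau)+g(\theta;\tau)\,\nabla_\theta\log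 p(\tau;\theta)^{\mathrm T}.$$ *Basic DR-SOPO.* Given a radius $\Delta>0$, $\theta_0\in\mathbb R^d$ and an initial direction $d_0\in\mathbb R^d$, put $d_t=\theta_t-\theta_{t-1}$ for $t\ge1$. In iteration $t=0,1,2,\dots$ one draws, conditionally on the past, two independent batches $\mathcal M_g,\mathcal M_H$ of i.i.d. trajectories from $p(\cdot;\theta_t)$; $g_t$ is the mean of $g(\theta_t;\tau)$ over $\mathcal M_g$ and $H_t$ is the symmetric part of the mean of $H(\theta_t;\tau)$ over $\mathcal M_H$. One takes a global minimizer $\alpha_t=(\alpha_t^1,\alpha_t^2)\in\mathbb R^2$ of $$m_t(\alpha)=J(\theta_t)+c_t^{\mathrm T}\alpha+\tfrac12\alpha^{\mathrm T}Q_t\alpha\quad\text{subject to}\quad \sqrt{\alpha^{\mathrm T}G_t\alpha}\le\Delta,$$ $$Q_t=\begin{bmatrix} g_t^{\mathrm T}H_tg_t&-d_t^{\mathrm T}H_tg_t\\-d_t^{\mathrm T}H_tg_t&d_t^{\mathrm T}H_td_t\end{bmatrix},\quad c_t=\begin{pmatrix}-\|g_t\|^2\\ g_t^{\mathrm T}d_t\end{pmatrix},\quad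 G_t=\begin{bmatrix} g_t^{\mathrm T}g_t&-g_t^{\mathrm T}d_t\\-g_t^{\mathrm T}d_t&d_t^{\mathrm T}d_t\end{bmatrix},$$ and sets $\theta_{t+1}=\theta_t-\alpha_t^1g_t+\alpha_t^2d_t$. Let $\Pi_t$ be the orthogonal projection onto $\operatorname{span}\{g_t,d_t\}$ and $\tilde\nabla^2J(\theta_t)=\Pi_t\nabla^2J(\theta_t)\Pi_t$. *Assumptions.* There are constants $R,G,L,M,C>0$ such that 1. $|r(s,a)|\le R$ for all $s,a$; 2. $\mathbb E_{\tau\sim p(\cdot;\theta)}\|\nabla\log\pi_\theta(a_h\mid s_h)\|^4\le G^4$ and $\mathbb E_{\tau\sim p(\cdot;\theta)}\|\nabla^2\log\pi_\theta(a_h\mid s_h)\|^2\le L^2$ for all $\theta$ and $0\le h<H$; 3. $J$ is twice differentiable and $\|\nabla^2J(\theta)-\nabla^2J(\theta')\|\le M\|\theta-\theta'\|$ for all $\theta,\theta'$ (operator norm); 4. $\|(\nabla^2J(\theta_t)-\tilde\nabla^2J(\theta_t))d_{t+1}\|\le MC\|d_{t+1}\|^2$ almost surely for $0\le t<T$. *Claim.*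 Let $\epsilon>0$, $\tilde C=C+\frac1{24}$, $G_g^2=\frac{G^2R^2}{(1-\gamma)^3}$, $G_H^2=\frac{H^4G^4R^2}{(1-\gamma)^2}+\frac{L^2R^2}{(1-\gamma)^4}$ and $\Delta_J\ge J(\theta_0)-J^*$. Run the algorithm with $\Delta=\frac{2\sqrt\epsilon}{M}$ and integers $$|\mathcal M_g|\ge\frac{144M^2G_g^2}{\epsilon^2},\qquad |\mathcal M_H|\ge\frac{22\cdot24^2\,G_H^2\log d}{\epsilon},\qquad T\ge\max\Big\{1,\frac{24M^2\Delta_J}{\epsilon^{3/2}}\Big\}$$ (for instance, these bounds rounded up), iteration $T$ included, so that $\tilde\nabla^2J(\theta_T)$ is defined. Let $\bar t$ be uniform on $\{1,\dots,T\}$ and independent of the run. Then $$\mathbb E\big[\|\nabla J(\theta_{\bar t})\|\big]\le\frac{3+4\tilde C}{M}\,\epsilon,\qquad \mathbb E\big[\lambda_{\min}(\tilde\nabla^2J(\theta_{\bar t}))\big]\ge-3\sqrt\epsilon,$$ and, with probability at least $\frac78$, $\ \|\nabla J(\theta_{\bar t})\|\le\frac{12+16\tilde C}{M}\,\epsilon$.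 -/

import Mathlib

open MeasureTheory ProbabilityTheory
open scoped ProbabilityTheory ENNReal RealInnerProductSpace

noncomputable section

namespace DRSOPO

/-- The parameter space `ℝ^d` with its Euclidean norm. -/
abbrev Param (d : ℕ) : Type := EuclideanSpace ℝ (Fin d)

/-- A discounted Markov decision process on measurable spaces of states and actions;
`r` is the regret (cost) that is to be minimized. -/
structure MDP (S A : Type*) [MeasurableSpace S] [MeasurableSpace A] where
  /-- transition kernel `P(ds' | s, a)` -/
  P : Kernel (S × A) S
  markov : IsMarkovKernel P
  /-- regret function -/
  r : S → A → ℝ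
  measurable_r : Measurable fun x : S × A => r x.1 x.2
  /-- discount factor -/
  γ : ℝ
  γ_nonneg : 0 ≤ γ
  γ_lt_one : γ < 1
  /-- law of the initial state -/
  ρ : Measure S
  prob_ρ : IsProbabilityMeasure ρ

/-- A family of policies `π_θ(a | s) = dens θ s a`, `θ ∈ ℝ^d`, given by positive probability
densities on the action space with respect to a reference measure `ν`, such that
`θ ↦ log π_θ(a | s)` is twice continuously differentiable. -/
structure PolicyClass (S A : Type*) [MeasurableSpace S] [MeasurableSpace A]
    (ν : Measure A) (d : ℕ) where
  dens : Param d → S → A → ℝ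
  dens_pos : ∀ θ s a, 0 < dens θ s a
  measurable_dens : ∀ θ, Measurable fun x : S × A => dens θ x.1 x.2
  lintegral_dens : ∀ θ s, ∫⁻ a, ENNReal.ofReal (dens θ s a) ∂ν = 1
  contDiff_log : ∀ s a, ContDiff ℝ 2 fun θ => Real.log (dens θ s a)

/-- Trajectories `(s₀, a₀, …, s_{H-1}, a_{H-1})`. -/
abbrev Traj (S A : Type*) (H : ℕ) : Type _ := Fin H → S × A

/-- The Hessian of `f` at `x`, as an operator. -/
def hess {d : ℕ} (f : Param d → ℝ) (x : Param d) : Param d →L[ℝ] Param d :=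
  fderiv ℝ (gradient f) x

/-- `f` is twice differentiable and its Hessian is `M`-Lipschitz in operator norm. -/
def LipschitzHessian {d : ℕ} (f : Param d → ℝ) (M : ℝ) : Prop :=
  Differentiable ℝ f ∧ Differentiable ℝ (gradient f) ∧
    ∀ x y, ‖hess f x - hess f y‖ ≤ M * ‖x - y‖

section Trajectories

variable {S A : Type*} [MeasurableSpace S] [MeasurableSpace A]

/-- The reference measure `ν(da₀) P(ds₁ | s₀, a₀) ν(da₁) ⋯` on trajectories of length `n`
that start at the state `s₀`. -/
def refKernel (P : Kernel (S × A) S) (ν : Measure A) : (n : ℕ) → Kernel S (Traj S A n)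
  | 0 => Kernel.const S (Measure.dirac fun i => i.elim0)
  | n + 1 =>
    (Kernel.id ×ₖ ((Kernel.const S ν ⊗ₖ P) ⊗ₖ
        (refKernel P ν n).comap (fun x : S × (A × S) => x.2.2) (by fun_prop))).map
      fun x : S × ((A × S) × Traj S A n) =>
        (Fin.cons (x.1, x.2.1.1) x.2.2 : Traj S A (n + 1))

variable {ν : Measure A} {d : ℕ} (mdp : MDP S A) (pol : PolicyClass S A ν d) (H : ℕ)

/-- The law `p(τ; θ) dτ` of a trajectory under the policy `π_θ`: it has density
`∏_h π_θ(a_h | s_h)` with respect to `ρ(ds₀) ν(da₀) P(ds₁ | s₀, a₀) ν(da₁) ⋯`. -/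
def trajLaw (θ : Param d) : Measure (Traj S A H) :=
  (mdp.ρ.bind (refKernel mdp.P ν H)).withDensity
    fun τ => ∏ h : Fin H, ENNReal.ofReal (pol.dens θ (τ h).1 (τ h).2)

/-- The accumulated discounted regret of a trajectory. -/
def regret (τ : Traj S A H) : ℝ := ∑ h : Fin H, mdp.γ ^ (h : ℕ) * mdp.r (τ h).1 (τ h).2

/-- The objective `J(θ)`. -/
def objective (θ : Param d) : ℝ := ∫ τ, regret mdp H τ ∂(trajLaw mdp pol H θ)

/-- `Ψ_h(τ) = ∑_{i ≥ h} γ^i r(s_i, a_i)`. -/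
def regretToGo (τ : Traj S A H) (h : Fin H) : ℝ :=
  ∑ i ∈ Finset.Ici h, mdp.γ ^ (i : ℕ) * mdp.r (τ i).1 (τ i).2

/-- `log π_θ(a | s)`. -/
def logPolicy (s : S) (a : A) (θ : Param d) : ℝ := Real.log (pol.dens θ s a)

/-- `log p(τ; θ)`, up to terms that do not depend on `θ`. -/
def logTraj (τ : Traj S A H) (θ : Param d) : ℝ :=
  Real.log (∏ h, pol.dens θ (τ h).1 (τ h).2)

/-- The stochastic gradient `g(θ; τ) = ∑_h Ψ_h(τ) ∇ log π_θ(a_h | s_h)`. -/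
def stochGrad (τ : Traj S A H) (θ : Param d) : Param d :=
  ∑ h, regretToGo mdp H τ h • gradient (logPolicy pol (τ h).1 (τ h).2) θ

/-- The stochastic Hessian `H(θ; τ) = ∇ g(θ; τ) + g(θ; τ) (∇ log p(τ; θ))ᵀ`. -/
def stochHess (τ : Traj S A H) (θ : Param d) : Param d →L[ℝ] Param d :=
  fderiv ℝ (stochGrad mdp pol H τ) θ +
    InnerProductSpace.rankOne ℝ (stochGrad mdp pol H τ θ) (gradient (logTraj pol H τ) θ)

/-- The mini-batch gradient. -/
def batchGrad {N : ℕ} (B : Fin N → Traj S A H) (θ : Param d) : Param d :=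
  (N : ℝ)⁻¹ • ∑ i, stochGrad mdp pol H (B i) θ

/-- The mini-batch Hessian: the symmetric part of the mean of the stochastic Hessians. -/
def batchHess {N : ℕ} (B : Fin N → Traj S A H) (θ : Param d) : Param d →L[ℝ] Param d :=
  let K := (N : ℝ)⁻¹ • ∑ i, stochHess mdp pol H (B i) θ
  (2 : ℝ)⁻¹ • (K + ContinuousLinearMap.adjoint K)

/-- Bounded rewards. -/
def BoundedRegret (R : ℝ) : Prop := ∀ s a, |mdp.r s a| ≤ R

/-- Expected Lipschitzness and smoothness of the log-policy along trajectories. -/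
def ExpectedLipschitzSmooth (G L : ℝ) : Prop :=
  ∀ (θ : Param d) (h : Fin H),
    ∫⁻ τ, ENNReal.ofReal (‖gradient (logPolicy pol (τ h).1 (τ h).2) θ‖ ^ 4)
        ∂(trajLaw mdp pol H θ) ≤ ENNReal.ofReal (G ^ 4) ∧
    ∫⁻ τ, ENNReal.ofReal (‖hess (logPolicy pol (τ h).1 (τ h).2) θ‖ ^ 2)
        ∂(trajLaw mdp pol H θ) ≤ ENNReal.ofReal (L ^ 2)

/-- `G_g²`. -/
def gradVar (R G : ℝ) : ℝ := G ^ 2 * R ^ 2 / (1 - mdp.γ) ^ 3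

/-- `G_H²`. -/
def hessVar (R G L : ℝ) : ℝ :=
  (H : ℝ) ^ 4 * G ^ 4 * R ^ 2 / (1 - mdp.γ) ^ 2 + L ^ 2 * R ^ 2 / (1 - mdp.γ) ^ 4

end Trajectories

section TrustRegion

variable {d : ℕ}

/-- The matrix `Q_t` of the two-dimensional model. -/
def modelQ (g v : Param d) (K : Param d →L[ℝ] Param d) : Matrix (Fin 2) (Fin 2) ℝ :=
  !![⟪g, K g⟫, -⟪v, K g⟫; -⟪v, K g⟫, ⟪v, K v⟫]

/-- The vector `c_t` of the two-dimensional model. -/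
def modelC (g v : Param d) : Fin 2 → ℝ := ![-‖g‖ ^ 2, ⟪g, v⟫]

/-- The Gram matrix `G_t` of the trust-region constraint. -/
def modelG (g v : Param d) : Matrix (Fin 2) (Fin 2) ℝ :=
  !![⟪g, g⟫, -⟪g, v⟫; -⟪g, v⟫, ⟪v, v⟫]

/-- The two-dimensional quadratic model `m_t(α)` with constant term `J₀`. -/
def model (J₀ : ℝ) (g v : Param d) (K : Param d →L[ℝ] Param d) (α : Fin 2 → ℝ) : ℝ :=
  J₀ + dotProduct (modelC g v) α + 1 / 2 * dotProduct α ((modelQ g v K).mulVec α)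

/-- `‖α‖_{G_t} ≤ Δ`. -/
def InRegion (g v : Param d) (Δ : ℝ) (α : Fin 2 → ℝ) : Prop :=
  Real.sqrt (dotProduct α ((modelG g v).mulVec α)) ≤ Δ

/-- `α` is a global solution of the dimension-reduced trust-region problem. -/
def IsDRTRSolution (J₀ : ℝ) (g v : Param d) (K : Param d →L[ℝ] Param d) (Δ : ℝ)
    (α : Fin 2 → ℝ) : Prop :=
  InRegion g v Δ α ∧ ∀ β, InRegion g v Δ β → model J₀ g v K α ≤ model J₀ g v K β

/-- `V Vᵀ K V Vᵀ`, where `V` is an orthonormal basis of `span {g, v}`. -/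
def projected (g v : Param d) (K : Param d →L[ℝ] Param d) : Param d →L[ℝ] Param d :=
  (Submodule.span ℝ {g, v}).starProjection ∘L K ∘L (Submodule.span ℝ {g, v}).starProjection

/-- The smallest eigenvalue of an operator (meant for symmetric operators). -/
def lambdaMin (K : Param d →L[ℝ] Param d) : ℝ :=
  sInf {x : ℝ | Module.End.HasEigenvalue (K : Param d →ₗ[ℝ] Param d) x}

/-- The directions `d_t = θ_t - θ_{t-1}`, with a given initial direction `d₀`. -/
def direction {Ω : Type*} (d₀ : Param d) (θ : ℕ → Ω → Param d) : ℕ → Ω → Param d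
  | 0 => fun _ => d₀
  | t + 1 => fun ω => θ (t + 1) ω - θ t ω

end TrustRegion

/-- `(θ, Bg, BH, α)` is a run of Basic DR-SOPO on the probability space `(Ω, μ)`, from `θ₀` with
initial direction `d₀` and radius `Δ`, whose iterations `t = 0, …, T` use batches `Bg t`, `BH t`
of `Ng` and `NH` trajectories. The σ-algebra `𝓕 t` represents the randomness before iteration `t`.
(Iterations `0, …, T - 1` produce `θ₁, …, θ_T`; iteration `T` provides `g_T`, hence the search
subspace at `θ_T`.) -/
structure IsRun {S A Ω : Type*} [MeasurableSpace S] [MeasurableSpace A] [mΩ : MeasurableSpace Ω]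
    {ν : Measure A} {d : ℕ} (mdp : MDP S A) (pol : PolicyClass S A ν d) (H : ℕ)
    (Ng NH T : ℕ) (Δ : ℝ) (θ₀ d₀ : Param d) (μ : Measure Ω) (𝓕 : Filtration ℕ mΩ)
    (θ : ℕ → Ω → Param d) (Bg : ℕ → Ω → Fin Ng → Traj S A H)
    (BH : ℕ → Ω → Fin NH → Traj S A H) (α : ℕ → Ω → Fin 2 → ℝ) : Prop where
  init : ∀ ω, θ 0 ω = θ₀
  measurable_iterate : ∀ t ≤ T + 1, Measurable[𝓕 t] (θ t)
  measurable_Bg : ∀ t ≤ T, Measurable[𝓕 (t + 1)] (Bg t)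
  measurable_BH : ∀ t ≤ T, Measurable[𝓕 (t + 1)] (BH t)
  /-- Conditionally on `𝓕 t`, all trajectories of the two batches are i.i.d. from `p(· ; θ_t)`. -/
  sampling : ∀ t ≤ T, ∀ U : Set Ω, MeasurableSet[𝓕 t] U →
    ∀ W : Set ((Fin Ng → Traj S A H) × (Fin NH → Traj S A H)), MeasurableSet W →
      μ (U ∩ {ω | (Bg t ω, BH t ω) ∈ W}) =
        ∫⁻ ω in U, ((Measure.pi fun _ : Fin Ng => trajLaw mdp pol H (θ t ω)).prod
          (Measure.pi fun _ : Fin NH => trajLaw mdp pol H (θ t ω))) W ∂μ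
  solve : ∀ t ≤ T, ∀ᵐ ω ∂μ,
    IsDRTRSolution (objective mdp pol H (θ t ω)) (batchGrad mdp pol H (Bg t ω) (θ t ω))
      (direction d₀ θ t ω) (batchHess mdp pol H (BH t ω) (θ t ω)) Δ (α t ω)
  update : ∀ t ≤ T, ∀ᵐ ω ∂μ,
    θ (t + 1) ω = θ t ω - α t ω 0 • batchGrad mdp pol H (Bg t ω) (θ t ω)
      + α t ω 1 • direction d₀ θ t ω

/-- The projected Hessian `∇̃²J(θ_t)`, onto the subspace `span {g_t, d_t}`. -/
def projHess {S A Ω : Type*} [MeasurableSpace S] [MeasurableSpace A]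
    {ν : Measure A} {d : ℕ} (mdp : MDP S A) (pol : PolicyClass S A ν d) (H : ℕ) {Ng : ℕ}
    (d₀ : Param d) (θ : ℕ → Ω → Param d) (Bg : ℕ → Ω → Fin Ng → Traj S A H)
    (t : ℕ) (ω : Ω) : Param d →L[ℝ] Param d :=
  projected (batchGrad mdp pol H (Bg t ω) (θ t ω)) (direction d₀ θ t ω)
    (hess (objective mdp pol H) (θ t ω))

end DRSOPO

end

/-! Put `f y = c * J (a • y)` with a = √ε/M and c = M²/ε^(3/2). In these units the Hessian is
1-Lipschitz and the radius is 2; gradients are multiplied by M/ε and Hessians by 1/√ε. The targets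
become a mean gradient norm of at most 19/6 + 4C and a mean least eigenvalue of at least -3, while
the decrease available in total is at most T/24.

Deterministic part. A trust-region step s in the plane E has a multiplier l ≥ 0 with g + K s + l s
orthogonal to E, K + l ≥ 0 on E, and l = 0 or ‖s‖ = 2 (`IsStep.exists_multiplier`). Hence the model
drops by at least 2l, and the new gradient is, up to noise and the part of the Hessian leaving E,
the vector `gradRem - l • s`. Bounding the Taylor remainders separately (2 for the gradient, 4/3 for
the function) gives 2 + 2l with 2l ≤ decrease + 4/3, that is 10/3, which is too much. Two
observations repair this.

The remainders compete: both integrate the same Hessian increment, and `gradRem - l • s` is long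
only if `gradRem` points against s, where `f` cannot exceed its model by much
(`LipschitzHessian.remainder_le_of_norm_eq_two`, `NoisyStep.exists_angle`).

Lost ground is recoverable: if `f` rises along a step, the next search plane contains that step, so
the next model can go back half of it and must drop accordingly (`recoverable_le_modelDrop`). The
potential f - (3/5) * `recoverable` therefore loses at least the gradient norm minus 4C + 41/15 per
step, up to noise (`NoisyStep.potential_step`), and telescoping bounds the average. The same
potential bounds the average of the maximum of the gradient norm minus 4C and 2, which upgrades
Markov's inequality from 3/4 to 7/8. For the curvature, l itself is bounded by half the decrease
plus 2/3.

Stochastic part. The gradient and Hessian estimators are unbiased because means over trajectories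
can be differentiated under the integral; uniform second moments suffice, through Scheffé's argument
and truncation (`hasDerivAt_integral_of_score`). The scores of successive actions are uncorrelated,
which yields the variance G_g². The Hessian error matters only on the plane E, and the Hessian batch
is independent of this plane, so four variances replace a matrix concentration inequality
(`lintegral_frameNorm_batchHess_sub_sq_le`). The batch sizes make the mean normalized errors at most
1/12 and 37/2000, and the constants above have just enough room for them. -/

open MeasureTheory ProbabilityTheory
open scoped ProbabilityTheory ENNReal RealInnerProductSpace

noncomputable section

namespace DRSOPO

/-! ### Taylor remainders for a Lipschitz Hessian. -/

section Taylor

variable {d : ℕ}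

/-- The first-order Taylor remainder of the gradient. -/
def gradRem (f : Param d → ℝ) (x s : Param d) : Param d :=
  gradient f (x + s) - gradient f x - hess f x s

/-- The second-order Taylor remainder. -/
def funRem (f : Param d → ℝ) (x s : Param d) : ℝ :=
  f (x + s) - f x - ⟪gradient f x, s⟫ - 1 / 2 * ⟪s, hess f x s⟫

theorem hasDerivAt_comp_line {f : Param d → ℝ} (hf : Differentiable ℝ f) (x s : Param d) (u : ℝ) :
    HasDerivAt (fun u : ℝ => f (x + u • s)) ⟪gradient f (x + u • s), s⟫ u := by
  have h1 : HasDerivAt (fun u : ℝ => x + u • s) s u := by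
    simpa using ((hasDerivAt_id u).smul_const s).const_add x
  exact ((hf (x + u • s)).hasFDerivAt.comp_hasDerivAt u h1).congr_deriv (by simp [gradient])

theorem hasDerivAt_gradient_comp_line {f : Param d → ℝ} (hf : Differentiable ℝ (gradient f))
    (x s : Param d) (u : ℝ) :
    HasDerivAt (fun u : ℝ => gradient f (x + u • s)) (hess f (x + u • s) s) u := by
  have h1 : HasDerivAt (fun u : ℝ => x + u • s) s u := by
    simpa using ((hasDerivAt_id u).smul_const s).const_add x
  exact (hf (x + u • s)).hasFDerivAt.comp_hasDerivAt u h1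

/-- A joint bound for the Taylor remainders of the gradient and of the function. -/
theorem LipschitzHessian.remainder_le {f : Param d → ℝ} {M : ℝ} (hf : LipschitzHessian f M)
    (x s n : Param d) (κ c₀ c₁ c₂ : ℝ)
    (hp : ∀ u ∈ Set.Icc (0 : ℝ) 1, ‖n + (κ * (1 - u)) • s‖ ≤ c₀ + c₁ * u + c₂ * u ^ 2) :
    ⟪gradRem f x s, n⟫ + κ * funRem f x s ≤ M * ‖s‖ ^ 2 * (c₀ / 2 + c₁ / 3 + c₂ / 4) := by
  obtain ⟨h1, h2, h3⟩ := hf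
  set Q : ℝ → Param d := fun u => gradient f (x + u • s) - gradient f x - u • hess f x s with hQ
  set W : ℝ → ℝ := fun u => f (x + u • s) - f x - u * ⟪gradient f x, s⟫
    - u ^ 2 / 2 * ⟪hess f x s, s⟫ with hW
  have dQ : ∀ u, HasDerivAt Q ((hess f (x + u • s) - hess f x) s) u := by
    intro u
    have := ((hasDerivAt_gradient_comp_line h2 x s u).sub_const (gradient f x)).sub
      ((hasDerivAt_id u).smul_const (hess f x s))
    exact this.congr_deriv (by simp)
  have dW : ∀ u, HasDerivAt W ⟪Q u, s⟫ u := by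
    intro u
    have := (((hasDerivAt_comp_line h1 x s u).sub_const (f x)).sub
      ((hasDerivAt_id u).mul_const ⟪gradient f x, s⟫)).sub
      ((((hasDerivAt_id u).pow 2).div_const 2).mul_const ⟪hess f x s, s⟫)
    refine this.congr_deriv ?_
    simp [hQ, inner_sub_left, inner_smul_left]
  -- The two remainders are the integrals over [0, 1] of (hess f (x + u s) - hess f x) s and of (1 -
  -- u) times its product with s. Their combination integrates the Hessian increment against n + κ
  -- (1 - u) s; `Z` is a primitive of this integrand, the terms ⟪Q, s⟫ cancelling in the derivative.
  set Z : ℝ → ℝ := fun u => ⟪Q u, n⟫ + κ * ((1 - u) * ⟪Q u, s⟫ + W u) with hZ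
  have dZ : ∀ u, HasDerivAt Z
      ⟪(hess f (x + u • s) - hess f x) s, n + (κ * (1 - u)) • s⟫ u := by
    intro u
    have e1 : ∀ w : Param d, HasDerivAt (fun u => ⟪Q u, w⟫)
        ⟪(hess f (x + u • s) - hess f x) s, w⟫ u := by
      intro w
      simpa using (dQ u).inner ℝ (hasDerivAt_const u w)
    have e2 := (e1 n).add
      ((((((hasDerivAt_id u).const_sub 1).mul (e1 s)).add (dW u))).const_mul κ)
    refine e2.congr_deriv ?_
    simp only [inner_add_right, inner_smul_right, id]
    ring
  -- Integration is replaced by monotonicity: `V` is the primitive of the upper bound minus `Z`, and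
  -- V 0 = 0.
  set V : ℝ → ℝ := fun u => M * ‖s‖ ^ 2 * (c₀ * u ^ 2 / 2 + c₁ * u ^ 3 / 3 + c₂ * u ^ 4 / 4) - Z u
    with hV
  have dV : ∀ u, HasDerivAt V (M * ‖s‖ ^ 2 * (u * (c₀ + c₁ * u + c₂ * u ^ 2))
      - ⟪(hess f (x + u • s) - hess f x) s, n + (κ * (1 - u)) • s⟫) u := by
    intro u
    have e : ∀ k : ℕ, HasDerivAt (fun u : ℝ => u ^ k) (k * u ^ (k - 1)) u := fun k =>
      hasDerivAt_pow k u
    have := ((((((e 2).const_mul c₀).div_const 2).add (((e 3).const_mul c₁).div_const 3)).add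
      (((e 4).const_mul c₂).div_const 4)).const_mul (M * ‖s‖ ^ 2)).sub (dZ u)
    refine this.congr_deriv ?_
    push_cast
    ring
  have mono : MonotoneOn V (Set.Icc 0 1) := by
    apply monotoneOn_of_deriv_nonneg (convex_Icc 0 1)
    · exact fun u _ => (dV u).continuousAt.continuousWithinAt
    · exact fun u _ => (dV u).differentiableAt.differentiableWithinAt
    · intro u hu
      rw [interior_Icc] at hu
      rw [(dV u).deriv, sub_nonneg]
      have b1 : ‖(hess f (x + u • s) - hess f x) s‖ ≤ M * ‖s‖ ^ 2 * u := by
        refine (ContinuousLinearMap.le_opNorm _ _).trans ?_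
        have := h3 (x + u • s) x
        rw [add_sub_cancel_left, norm_smul, Real.norm_of_nonneg hu.1.le] at this
        calc _ ≤ M * (u * ‖s‖) * ‖s‖ := by gcongr
          _ = _ := by ring
      have b2 := hp u ⟨hu.1.le, hu.2.le⟩
      calc _ ≤ ‖(hess f (x + u • s) - hess f x) s‖ * ‖n + (κ * (1 - u)) • s‖ :=
            real_inner_le_norm _ _
        _ ≤ (M * ‖s‖ ^ 2 * u) * (c₀ + c₁ * u + c₂ * u ^ 2) := by
            gcongr
            exact (norm_nonneg _).trans b1
        _ = _ := by ring
  have key := mono (Set.left_mem_Icc.2 zero_le_one) (Set.right_mem_Icc.2 zero_le_one) zero_le_one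
  have z0 : V 0 = 0 := by simp [hV, hZ, hQ, hW]
  have z1 : Z 1 = ⟪gradRem f x s, n⟫ + κ * funRem f x s := by
    simp only [hZ, hQ, hW, gradRem, funRem, real_inner_comm s]
    simp
  have : V 1 = M * ‖s‖ ^ 2 * (c₀ / 2 + c₁ / 3 + c₂ / 4) - Z 1 := by simp [hV]
  rw [z0, this, z1] at key
  linarith

theorem LipschitzHessian.abs_funRem_le {f : Param d → ℝ} {M : ℝ} (hf : LipschitzHessian f M)
    (x s : Param d) : |funRem f x s| ≤ M / 6 * ‖s‖ ^ 3 := by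
  have h : ∀ κ : ℝ, |κ| = 1 → κ * funRem f x s ≤ M / 6 * ‖s‖ ^ 3 := by
    intro κ hκ
    -- With n = 0 the test vector has norm exactly (1 - u) ‖s‖, whose integral against u is ‖s‖ / 6.
    have := hf.remainder_le x s 0 κ ‖s‖ (-‖s‖) 0 (by
      intro u hu
      rw [zero_add, norm_smul, norm_mul, Real.norm_eq_abs κ, hκ,
        Real.norm_of_nonneg (by linarith [hu.2])]
      apply le_of_eq
      ring)
    rw [inner_zero_right, zero_add] at this
    refine this.trans (le_of_eq ?_)
    ring
  have h1 := h 1 (by simp)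
  have h2 := h (-1) (by simp)
  rw [abs_le]
  constructor <;> linarith

/-- The joint remainder bound for a step of length two, in terms of the angle between the step
and the direction in which the gradient remainder is tested. -/
theorem LipschitzHessian.remainder_le_of_norm_eq_two {f : Param d → ℝ} (hf : LipschitzHessian f 1)
    (x s n : Param d) (hs : ‖s‖ = 2) (hn : ‖n‖ = 1) {κ : ℝ} (hκ : 0 ≤ κ) :
    ⟪gradRem f x s, n⟫ + κ * funRem f x s ≤
      2 + 4 * κ / 3 - (1 - ⟪n, s⟫ / 2) * (4 * κ / (3 * (1 + κ))) := by
  set η := ⟪n, s⟫ / 2 with hη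
  have hη1 : η ≤ 1 := by
    have := real_inner_le_norm n s
    rw [hs, hn] at this
    rw [hη]; linarith
  have hη2 : -1 ≤ η := by
    have := neg_le_of_abs_le (abs_real_inner_le_norm n s)
    rw [hs, hn] at this
    rw [hη]; linarith
  set τ := (1 - η) * (2 * κ / (1 + κ) ^ 2) with hτ
  have hk : 0 < (1 + κ) ^ 2 := by positivity
  have := hf.remainder_le x s n κ (1 + 2 * κ - τ)
    (-(2 * κ) + τ * (1 - 2 * κ)) (τ * (2 * κ)) (by
      intro u hu
      obtain ⟨v, rfl⟩ : ∃ v, u = 1 - v := ⟨1 - u, by ring⟩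
      have hv0 : 0 ≤ v := by linarith [hu.2]
      have hv1 : v ≤ 1 := by linarith [hu.1]
      -- With v = 1 - u, the squared norm of the test vector is A² - 2y for y = 2κv(1 - η), so the
      -- norm is at most A - y/A. To keep a polynomial, 1/A is replaced by its tangent line `ℓ` at v
      -- = 1/2, a lower bound by convexity. The weight u(1 - u) is symmetric about 1/2, so the
      -- integrated saving is the same as with 1/(1 + κ) in place of `ℓ`.
      set ℓ := (1 + 2 * κ - 2 * κ * v) / (1 + κ) ^ 2 with hℓ
      set A := 1 + 2 * κ * v with hA
      have hA0 : 1 ≤ A := by rw [hA]; nlinarith [mul_nonneg hκ hv0]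
      have hAℓ : A * ℓ ≤ 1 := by
        rw [hℓ, mul_div_assoc', div_le_one hk, hA]
        nlinarith [mul_nonneg (mul_nonneg hκ hκ) (sq_nonneg (2 * v - 1))]
      have hℓ0 : 0 ≤ ℓ := by
        rw [hℓ]; apply div_nonneg _ hk.le; nlinarith
      have hkv : 0 ≤ 2 * κ * v := by positivity
      have e1 : 1 + 2 * κ - τ + (-(2 * κ) + τ * (1 - 2 * κ)) * (1 - v) + τ * (2 * κ) * (1 - v) ^ 2
          = A - (1 - η) * (2 * κ * v) * ℓ := by
        rw [hτ, hA, hℓ]; field_simp; ring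
      have e2 : ‖n + (κ * (1 - (1 - v))) • s‖ ^ 2 = A ^ 2 - 2 * (2 * κ * v) * (1 - η) := by
        rw [norm_add_sq_real, norm_smul, mul_pow, hs, hn, inner_smul_right, Real.norm_eq_abs,
          sq_abs, hA, hη]
        ring
      rw [e1]
      have hbb : (1 - η) * (2 * κ * v) * ℓ ≤ A := by
        have h1 : A * ((1 - η) * (2 * κ * v) * ℓ) ≤ A * A := by
          calc A * ((1 - η) * (2 * κ * v) * ℓ) = (1 - η) * (2 * κ * v) * (A * ℓ) := by ring
            _ ≤ (1 - η) * (2 * κ * v) * 1 := by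
                apply mul_le_mul_of_nonneg_left hAℓ
                exact mul_nonneg (by linarith) hkv
            _ ≤ 2 * (2 * κ * v) * 1 := by
                apply mul_le_mul_of_nonneg_right _ zero_le_one
                apply mul_le_mul_of_nonneg_right _ hkv
                linarith
            _ ≤ A * A := by rw [hA]; nlinarith
        exact le_of_mul_le_mul_left h1 (by linarith)
      apply abs_le_of_sq_le_sq' _ (by linarith) |>.2
      rw [e2]
      have h2 : (1 - η) * (2 * κ * v) * (A * ℓ) ≤ (1 - η) * (2 * κ * v) * 1 :=
        mul_le_mul_of_nonneg_left hAℓ (mul_nonneg (by linarith) hkv)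
      nlinarith [sq_nonneg ((1 - η) * (2 * κ * v) * ℓ)])
  refine this.trans (le_of_eq ?_)
  rw [hs, hτ]
  field_simp
  ring

end Taylor

/-! ### The trust-region subproblem on a subspace and its multiplier. -/

section TrustRegionTheory

variable {d : ℕ}

/-- `s` minimizes the quadratic `⟪g, ·⟫ + ½ ⟪·, K ·⟫` over the vectors of `E` of norm at most
`Δ`. -/
structure IsStep (E : Submodule ℝ (Param d)) (g : Param d) (K : Param d →L[ℝ] Param d) (Δ : ℝ)
    (s : Param d) : Prop where
  mem : s ∈ E
  norm_le : ‖s‖ ≤ Δ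
  le : ∀ z ∈ E, ‖z‖ ≤ Δ → ⟪g, s⟫ + 1 / 2 * ⟪s, K s⟫ ≤ ⟪g, z⟫ + 1 / 2 * ⟪z, K z⟫

/-- The map α ↦ -α₀ g + α₁ v carries the Gram norm to the Euclidean norm and the two-dimensional
model to the quadratic on the span. It need not be injective: g and v may be dependent. Symmetry of
`K` enters because the model uses one number for both off-diagonal entries. -/
theorem IsDRTRSolution.isStep {J₀ : ℝ} {g v : Param d} {K : Param d →L[ℝ] Param d} {Δ : ℝ}
    {α : Fin 2 → ℝ} (hK : ∀ x y, ⟪K x, y⟫ = ⟪x, K y⟫) (h : IsDRTRSolution J₀ g v K Δ α) :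
    IsStep (Submodule.span ℝ {g, v}) g K Δ (-α 0 • g + α 1 • v) := by
  have key : ∀ β : Fin 2 → ℝ, model J₀ g v K β = J₀ + (⟪g, -β 0 • g + β 1 • v⟫
      + 1 / 2 * ⟪-β 0 • g + β 1 • v, K (-β 0 • g + β 1 • v)⟫) := by
    intro β
    have h1 : ⟪g, K v⟫ = ⟪v, K g⟫ := by rw [← hK, real_inner_comm]
    simp only [model, modelC, modelQ, dotProduct, Matrix.mulVec, Fin.sum_univ_two, map_add,
      map_smul, inner_add_left, inner_add_right, inner_smul_left, inner_smul_right,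
      real_inner_self_eq_norm_sq, h1]
    simp
    ring
  have hreg : ∀ β : Fin 2 → ℝ, InRegion g v Δ β ↔ ‖-β 0 • g + β 1 • v‖ ≤ Δ := by
    intro β
    have : dotProduct β ((modelG g v).mulVec β) = ‖-β 0 • g + β 1 • v‖ ^ 2 := by
      rw [← real_inner_self_eq_norm_sq]
      simp only [modelG, dotProduct, Matrix.mulVec, Fin.sum_univ_two, inner_add_left,
        inner_add_right, inner_smul_left, inner_smul_right, real_inner_comm g v]
      simp
      ring
    rw [InRegion, this, Real.sqrt_sq (norm_nonneg _)]
  refine ⟨Submodule.mem_span_pair.2 ⟨_, _, rfl⟩, (hreg α).1 h.1, fun z hz hzn => ?_⟩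
  obtain ⟨a, b, rfl⟩ := Submodule.mem_span_pair.1 hz
  have h2 := h.2 ![-a, b] ((hreg _).2 (by simpa using hzn))
  rw [key, key] at h2
  simpa using h2

/-- The optimality conditions of the trust-region problem. -/
theorem IsStep.exists_multiplier {E : Submodule ℝ (Param d)} {g s : Param d}
    {K : Param d →L[ℝ] Param d} {Δ : ℝ} (hΔ : 0 < Δ) (hK : ∀ x y, ⟪K x, y⟫ = ⟪x, K y⟫)
    (h : IsStep E g K Δ s) :
    ∃ l : ℝ, 0 ≤ l ∧ (∀ z ∈ E, ⟪g + K s + l • s, z⟫ = 0) ∧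
      (∀ z ∈ E, 0 ≤ ⟪z, K z⟫ + l * ‖z‖ ^ 2) ∧ (l = 0 ∨ ‖s‖ = Δ) := by
  have hsymm : ∀ x y, ⟪x, K y⟫ = ⟪y, K x⟫ := fun x y => by rw [← hK, real_inner_comm]
  have hexp : ∀ z : Param d, ∀ τ : ℝ, ⟪g, s + τ • z⟫ + 1 / 2 * ⟪s + τ • z, K (s + τ • z)⟫ =
      ⟪g, s⟫ + 1 / 2 * ⟪s, K s⟫ + τ * ⟪g + K s, z⟫ + τ ^ 2 / 2 * ⟪z, K z⟫ := by
    intro z τ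
    simp only [map_add, map_smul, inner_add_left, inner_add_right, inner_smul_left,
      inner_smul_right, hsymm s z, real_inner_comm z (K s)]
    simp
    ring
  -- Within E only the projection of the model gradient at s is visible.
  set w := E.starProjection (g + K s) with hw
  have hwE : w ∈ E := Submodule.starProjection_apply_mem _ _
  have hwz : ∀ z ∈ E, ⟪g + K s, z⟫ = ⟪w, z⟫ := by
    intro z hz
    rw [hw, Submodule.inner_starProjection_left_eq_right, Submodule.starProjection_eq_self_iff.2 hz]
  -- The ball is convex, so a short move from s towards any feasible z cannot lower the model: this
  -- is the variational inequality.
  have first : ∀ z ∈ E, ‖z‖ ≤ Δ → 0 ≤ ⟪w, z - s⟫ := by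
    intro z hz hzn
    have hzs := E.sub_mem hz h.mem
    by_contra hneg
    push Not at hneg
    set c := ⟪z - s, K (z - s)⟫
    set τ := min 1 (-⟪w, z - s⟫ / (|c| + 1)) with hτ
    have hc : 0 < |c| + 1 := by positivity
    have hτ0 : 0 < τ := lt_min one_pos (div_pos (by linarith) hc)
    have hτ1 : τ ≤ 1 := min_le_left _ _
    have hτ2 : τ * (|c| + 1) ≤ -⟪w, z - s⟫ := (le_div_iff₀ hc).1 (min_le_right _ _)
    have hfeas : ‖s + τ • (z - s)‖ ≤ Δ := by
      have : s + τ • (z - s) = (1 - τ) • s + τ • z := by module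
      rw [this]
      calc _ ≤ ‖(1 - τ) • s‖ + ‖τ • z‖ := norm_add_le _ _
        _ = (1 - τ) * ‖s‖ + τ * ‖z‖ := by
          rw [norm_smul, norm_smul, Real.norm_of_nonneg (by linarith : 0 ≤ 1 - τ),
            Real.norm_of_nonneg hτ0.le]
        _ ≤ (1 - τ) * Δ + τ * Δ := by
          gcongr
          exact h.norm_le
        _ = Δ := by ring
    have h1 := h.le _ (E.add_mem h.mem (E.smul_mem τ hzs)) hfeas
    rw [hexp, hwz _ hzs] at h1
    have h2 : 0 ≤ τ * (⟪w, z - s⟫ + τ / 2 * c) := by nlinarith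
    have h3 := nonneg_of_mul_nonneg_right h2 hτ0
    nlinarith [le_abs_self c, abs_nonneg c]
  -- The most demanding test point is the boundary point opposite to w.
  have hws : Δ * ‖w‖ ≤ -⟪w, s⟫ := by
    by_cases hw0 : w = 0
    · simp [hw0]
    have hwn : 0 < ‖w‖ := norm_pos_iff.2 hw0
    have h1 := first ((-(Δ / ‖w‖)) • w) (E.smul_mem _ hwE) (by
      rw [norm_smul, norm_neg, Real.norm_of_nonneg (by positivity)]
      exact le_of_eq (by field_simp))
    rw [inner_sub_right, inner_smul_right, real_inner_self_eq_norm_sq] at h1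
    have : -(Δ / ‖w‖) * ‖w‖ ^ 2 = -(Δ * ‖w‖) := by field_simp
    linarith
  set l := ‖w‖ / Δ with hl
  have hlw : l * Δ = ‖w‖ := by rw [hl]; field_simp
  have hl0 : 0 ≤ l := by positivity
  -- Together with ‖s‖ ≤ Δ, `hws` is the equality case of Cauchy–Schwarz, so w is a nonpositive
  -- multiple of s.
  have hwl : w = -(l • s) := by
    have h1 : ‖Δ • w + ‖w‖ • s‖ ^ 2 ≤ 0 := by
      rw [norm_add_sq_real, norm_smul, norm_smul, inner_smul_left, inner_smul_right,
        Real.norm_of_nonneg hΔ.le, Real.norm_of_nonneg (norm_nonneg w)]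
      simp only [conj_trivial]
      have := pow_le_pow_left₀ (norm_nonneg s) h.norm_le 2
      nlinarith [mul_le_mul_of_nonneg_left hws (mul_nonneg hΔ.le (norm_nonneg w)),
        mul_le_mul_of_nonneg_left this (sq_nonneg ‖w‖)]
    have h2 : Δ • w + ‖w‖ • s = 0 := by
      rw [← norm_eq_zero]
      exact pow_eq_zero_iff (two_ne_zero) |>.1 (le_antisymm h1 (sq_nonneg _))
    have h3 : w = Δ⁻¹ • (Δ • w) := by rw [smul_smul, inv_mul_cancel₀ hΔ.ne', one_smul]
    rw [h3, eq_neg_of_add_eq_zero_left h2, smul_neg, smul_smul, hl]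
    congr 2
    ring
  have hcompl : l = 0 ∨ ‖s‖ = Δ := by
    by_cases hs : ‖s‖ = Δ
    · exact Or.inr hs
    · left
      have hlt : ‖s‖ < Δ := lt_of_le_of_ne h.norm_le hs
      have : ‖w‖ = l * ‖s‖ := by rw [hwl, norm_neg, norm_smul, Real.norm_of_nonneg hl0]
      by_contra hne
      have hlp : 0 < l := lt_of_le_of_ne hl0 (Ne.symm hne)
      have := mul_lt_mul_of_pos_left hlt hlp
      linarith
  have hstat : ∀ z ∈ E, ⟪g + K s, z⟫ = -(l * ⟪s, z⟫) := by
    intro z hz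
    rw [hwz z hz, hwl, inner_neg_left, inner_smul_left]
    simp
  refine ⟨l, hl0, fun z hz => ?_, ?_, hcompl⟩
  · rw [inner_add_left, hstat z hz, inner_smul_left]
    simp
  · rcases lt_or_eq_of_le h.norm_le with hlt | heq
    · have hl' : l = 0 := hcompl.resolve_right hlt.ne
      intro z hz
      set τ := (Δ - ‖s‖) / (‖z‖ + 1) with hτ
      have hτ0 : 0 < τ := div_pos (by linarith) (by positivity)
      have hτ1 : τ * (‖z‖ + 1) = Δ - ‖s‖ := by rw [hτ]; field_simp
      have h1 := h.le (s + τ • z) (E.add_mem h.mem (E.smul_mem _ hz)) (by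
        refine (norm_add_le _ _).trans ?_
        rw [norm_smul, Real.norm_of_nonneg hτ0.le]
        nlinarith)
      rw [hexp, hstat z hz, hl'] at h1
      rw [hl']
      have h2 : 0 ≤ τ ^ 2 / 2 * ⟪z, K z⟫ := by linarith
      have := nonneg_of_mul_nonneg_right h2 (by positivity)
      linarith
    -- On the boundary, moving along z to the second intersection with the sphere keeps the norm.
    -- There the linear term of the model equals τ²/2 * l ‖z‖² by stationarity, so comparison with s
    -- leaves exactly the shifted curvature.
    · have refl : ∀ z ∈ E, ⟪s, z⟫ ≠ 0 → 0 ≤ ⟪z, K z⟫ + l * ‖z‖ ^ 2 := by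
        intro z hz hne
        have hz0 : z ≠ 0 := by rintro rfl; simp at hne
        have hzn : 0 < ‖z‖ := norm_pos_iff.2 hz0
        set τ := -2 * ⟪s, z⟫ / ‖z‖ ^ 2 with hτ
        have hτz : τ * ‖z‖ ^ 2 = -2 * ⟪s, z⟫ := by rw [hτ]; field_simp
        have hτ0 : τ ≠ 0 := by
          intro h0
          rw [h0] at hτz
          apply hne
          linarith
        have hn : ‖s + τ • z‖ ^ 2 = ‖s‖ ^ 2 := by
          rw [norm_add_sq_real, norm_smul, mul_pow, inner_smul_right, Real.norm_eq_abs, sq_abs]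
          linear_combination τ * hτz
        have hn' : ‖s + τ • z‖ = ‖s‖ :=
          (pow_left_inj₀ (norm_nonneg _) (norm_nonneg _) two_ne_zero).1 hn
        have h1 := h.le (s + τ • z) (E.add_mem h.mem (E.smul_mem _ hz)) (by rw [hn', heq])
        rw [hexp, hstat z hz] at h1
        have h2 : 0 ≤ τ ^ 2 / 2 * (⟪z, K z⟫ + l * ‖z‖ ^ 2) := by
          have : τ ^ 2 / 2 * (l * ‖z‖ ^ 2) = τ * -(l * ⟪s, z⟫) := by
            calc _ = τ / 2 * l * (τ * ‖z‖ ^ 2) := by ring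
              _ = _ := by rw [hτz]; ring
          rw [mul_add, this]
          linarith
        exact nonneg_of_mul_nonneg_right h2 (by positivity)
      intro z hz
      by_cases hne : ⟪s, z⟫ = 0
      -- Directions tangent to the sphere give no second intersection. They are limits of z ± δ s,
      -- to which `refl` applies; averaging the two signs removes the cross term, and δ is then
      -- small enough.
      · set F := ⟪s, K s⟫ + l * ‖s‖ ^ 2
        have hδ : ∀ δ : ℝ, 0 < δ → 0 ≤ (⟪z, K z⟫ + l * ‖z‖ ^ 2) + δ ^ 2 * F := by
          intro δ hδ
          have hh : ∀ σ : ℝ, σ ≠ 0 → 0 ≤ ⟪z, K z⟫ + l * ‖z‖ ^ 2 + 2 * σ * ⟪z, K s⟫ + σ ^ 2 * F := by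
            intro σ hσ
            have := refl (z + σ • s) (E.add_mem hz (E.smul_mem _ h.mem)) (by
              rw [inner_add_right, inner_smul_right, hne, real_inner_self_eq_norm_sq, heq]
              have : σ * Δ ^ 2 ≠ 0 := by positivity
              simpa using this)
            have e1 : ⟪z + σ • s, K (z + σ • s)⟫ = ⟪z, K z⟫ + 2 * σ * ⟪z, K s⟫
                + σ ^ 2 * ⟪s, K s⟫ := by
              simp only [map_add, map_smul, inner_add_left, inner_add_right, inner_smul_left,
                inner_smul_right, hsymm s z]
              simp
              ring
            have e2 : ‖z + σ • s‖ ^ 2 = ‖z‖ ^ 2 + σ ^ 2 * ‖s‖ ^ 2 := by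
              rw [norm_add_sq_real, norm_smul, mul_pow, inner_smul_right, Real.norm_eq_abs, sq_abs,
                real_inner_comm, hne]
              ring
            rw [e1, e2] at this
            simp only [F]
            nlinarith
          have p1 := hh δ hδ.ne'
          have p2 := hh (-δ) (neg_ne_zero.2 hδ.ne')
          nlinarith
        by_contra hlt
        push Not at hlt
        set m := ⟪z, K z⟫ + l * ‖z‖ ^ 2
        have hF : 0 < |F| + 1 := by positivity
        have hpos : 0 < min 1 (-m / (2 * (|F| + 1))) :=
          lt_min one_pos (div_pos (by linarith) (by positivity))
        have h1 := hδ _ hpos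
        set δ := min 1 (-m / (2 * (|F| + 1)))
        have hδ1 : δ ≤ 1 := min_le_left _ _
        have hδ2 : δ * (2 * (|F| + 1)) ≤ -m := (le_div_iff₀ (by positivity)).1 (min_le_right _ _)
        nlinarith [le_abs_self F, abs_nonneg F, mul_nonneg hpos.le (abs_nonneg F),
          mul_le_mul_of_nonneg_right hδ1 hpos.le, mul_nonneg (sq_nonneg δ) (sub_nonneg.2 (le_abs_self F)),
          mul_nonneg (mul_nonneg hpos.le (sub_nonneg.2 hδ1)) (abs_nonneg F)]
      · exact refl z hz hne

end TrustRegionTheory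

/-! ### One noisy step: remainders, multiplier and potential. -/

section Descent

variable {d : ℕ}

/-- A trust-region step `s` of radius two at `x`, for a model with gradient `g` and curvature `K`,
with multiplier `l`: the gradient error is at most `a`, the curvature error on the search space `E`
is at most `b`, and `4 * C` bounds the part of the Hessian that leaves `E`. -/
structure NoisyStep (f : Param d → ℝ) (E : Submodule ℝ (Param d)) (g : Param d)
    (K : Param d →L[ℝ] Param d) (x s : Param d) (l a b C : ℝ) : Prop where
  grad_mem : g ∈ E
  mem : s ∈ E
  norm_le : ‖s‖ ≤ 2
  nonneg : 0 ≤ l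
  stationary : ∀ z ∈ E, ⟪g + K s + l • s, z⟫ = 0
  curvature : 0 ≤ ⟪s, K s⟫ + l * ‖s‖ ^ 2
  compl : l = 0 ∨ ‖s‖ = 2
  grad_noise : ‖gradient f x - g‖ ≤ a
  hess_noise : ∀ y ∈ E, ∀ z ∈ E, |⟪y, (hess f x - K) z⟫| ≤ b * ‖y‖ * ‖z‖
  noise_nonneg : 0 ≤ b
  leak : ‖hess f x s - E.starProjection (hess f x s)‖ ≤ 4 * C

/-- The decrease of the model along a step. -/
def modelDrop (g : Param d) (K : Param d →L[ℝ] Param d) (s : Param d) : ℝ :=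
  -⟪g, s⟫ - 1 / 2 * ⟪s, K s⟫

/-- The part of the increase of `f` along the last step that the next model can undo. -/
def recoverable (f : Param d → ℝ) (x s : Param d) : ℝ :=
  max 0 (min 1 (f (x + s) - f (x + (1 / 2 : ℝ) • s) - 1 / 6))

theorem recoverable_nonneg (f : Param d → ℝ) (x s : Param d) : 0 ≤ recoverable f x s :=
  le_max_left _ _

theorem recoverable_le_one (f : Param d → ℝ) (x s : Param d) : recoverable f x s ≤ 1 :=
  max_le zero_le_one (min_le_left _ _)

namespace NoisyStep

variable {f : Param d → ℝ} {E : Submodule ℝ (Param d)} {g : Param d}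
  {K : Param d →L[ℝ] Param d} {x s : Param d} {l a b C : ℝ}

theorem inner_grad (h : NoisyStep f E g K x s l a b C) :
    ⟪g, s⟫ = -(⟪s, K s⟫ + l * ‖s‖ ^ 2) := by
  have := h.stationary s h.mem
  rw [inner_add_left, inner_add_left, inner_smul_left, real_inner_self_eq_norm_sq,
    real_inner_comm s (K s), conj_trivial] at this
  linarith

theorem modelDrop_eq (h : NoisyStep f E g K x s l a b C) :
    modelDrop g K s = 1 / 2 * (⟪s, K s⟫ + l * ‖s‖ ^ 2) + 1 / 2 * (l * ‖s‖ ^ 2) := by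
  rw [modelDrop, h.inner_grad]
  ring

theorem modelDrop_nonneg (h : NoisyStep f E g K x s l a b C) : 0 ≤ modelDrop g K s := by
  rw [h.modelDrop_eq]
  have := h.curvature
  have := mul_nonneg h.nonneg (sq_nonneg ‖s‖)
  linarith

theorem grad_error_le (h : NoisyStep f E g K x s l a b C) :
    |⟪gradient f x - g, s⟫| ≤ 2 * a := by
  calc _ ≤ ‖gradient f x - g‖ * ‖s‖ := abs_real_inner_le_norm _ _
    _ ≤ a * 2 := mul_le_mul h.grad_noise h.norm_le (norm_nonneg _)
        ((norm_nonneg _).trans h.grad_noise)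
    _ = 2 * a := by ring

theorem hess_error_le (h : NoisyStep f E g K x s l a b C) :
    |⟪s, (hess f x - K) s⟫| ≤ 4 * b := by
  refine (h.hess_noise s h.mem s h.mem).trans ?_
  have := h.norm_le
  have := h.noise_nonneg
  have : ‖s‖ * ‖s‖ ≤ 2 * 2 := by gcongr
  nlinarith

theorem decrease (_h : NoisyStep f E g K x s l a b C) :
    f (x + s) - f x = -modelDrop g K s + ⟪gradient f x - g, s⟫
      + 1 / 2 * ⟪s, (hess f x - K) s⟫ + funRem f x s := by
  simp only [modelDrop, funRem, inner_sub_left, inner_sub_right, sub_apply]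
  ring

/-- The midpoint is where the next model arrives by stepping half way back, so the value of `f`
there measures how much of an increase can be undone. -/
theorem half_decrease (h : NoisyStep f E g K x s l a b C) :
    f (x + (1 / 2 : ℝ) • s) - f x = -(3 / 8) * (⟪s, K s⟫ + l * ‖s‖ ^ 2)
      - 1 / 8 * (l * ‖s‖ ^ 2) + 1 / 2 * ⟪gradient f x - g, s⟫
      + 1 / 8 * ⟪s, (hess f x - K) s⟫ + funRem f x ((1 / 2 : ℝ) • s) := by
  simp only [funRem, inner_sub_left, inner_sub_right, sub_apply, map_smul,
    inner_smul_left, inner_smul_right, conj_trivial]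
  linear_combination (1 / 2) * h.inner_grad

/-- Taylor's formula reads ∇f(x + s) = gradRem + ∇f(x) + (hess f) s. Projected stationarity replaces
g plus the part of K s in E by -l s; what remains is the gradient error, the Hessian error inside E,
and the component of the true Hessian outside E. -/
theorem norm_gradient_le (h : NoisyStep f E g K x s l a b C) :
    ‖gradient f (x + s)‖ ≤ ‖gradRem f x s - l • s‖ + a + 2 * b + 4 * C := by
  set y := E.starProjection ((hess f x - K) s) with hy
  have hyE : y ∈ E := Submodule.starProjection_apply_mem _ _
  have hyn : ‖y‖ ≤ 2 * b := by
    by_cases h0 : ‖y‖ = 0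
    · rw [h0]; linarith [h.noise_nonneg]
    have h1 : ‖y‖ ^ 2 ≤ b * ‖y‖ * ‖s‖ := by
      rw [← real_inner_self_eq_norm_sq]
      nth_rw 2 [hy]
      rw [← Submodule.inner_starProjection_left_eq_right,
        Submodule.starProjection_eq_self_iff.2 hyE]
      exact (le_abs_self _).trans (h.hess_noise y hyE s h.mem)
    have h2 : 0 < ‖y‖ := lt_of_le_of_ne (norm_nonneg _) (Ne.symm h0)
    have h3 : ‖y‖ ≤ b * ‖s‖ := by
      apply le_of_mul_le_mul_left _ h2
      nlinarith
    nlinarith [h.norm_le, h.noise_nonneg]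
  have hstat : E.starProjection (K s) = -(g + l • s) := by
    have h0 : E.starProjection (g + K s + l • s) = 0 := by
      rw [Submodule.starProjection_apply_eq_zero_iff, Submodule.mem_orthogonal']
      exact h.stationary
    rw [map_add, map_add, map_smul, Submodule.starProjection_eq_self_iff.2 h.grad_mem,
      Submodule.starProjection_eq_self_iff.2 h.mem] at h0
    rw [eq_neg_iff_add_eq_zero, ← h0]
    abel
  have hu : gradient f (x + s) = (gradRem f x s - l • s) + (gradient f x - g) + y
      + (hess f x s - E.starProjection (hess f x s)) := by
    rw [hy, sub_apply, map_sub, hstat, gradRem]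
    abel
  rw [hu]
  refine (norm_add_le _ _).trans (add_le_add ?_ h.leak)
  refine (norm_add_le _ _).trans (add_le_add ?_ hyn)
  exact (norm_add_le _ _).trans (add_le_add le_rfl h.grad_noise)

theorem funRem_le (hf : LipschitzHessian f 1) (h : NoisyStep f E g K x s l a b C) :
    |funRem f x s| ≤ 4 / 3 := by
  refine (hf.abs_funRem_le x s).trans ?_
  have := pow_le_pow_left₀ (norm_nonneg s) h.norm_le 3
  linarith

/-- What remains of an increase of `f` can be undone, up to noise, by the next model. -/
theorem recoverable_ge (hf : LipschitzHessian f 1) (h : NoisyStep f E g K x s l a b C) :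
    funRem f x s - 1 / 3 - 1 / 8 * (⟪s, K s⟫ + l * ‖s‖ ^ 2) - 3 / 8 * (l * ‖s‖ ^ 2)
      + min 0 (1 / 2 * ⟪gradient f x - g, s⟫ + 3 / 8 * ⟪s, (hess f x - K) s⟫)
      ≤ recoverable f x s := by
  have h1 := h.decrease
  have h2 := h.half_decrease
  rw [h.modelDrop_eq] at h1
  have h3 := abs_le.1 (h.funRem_le hf)
  have h4 := abs_le.1 (hf.abs_funRem_le x ((1 / 2 : ℝ) • s))
  have h5 : ‖(1 / 2 : ℝ) • s‖ ^ 3 ≤ 1 := by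
    apply pow_le_one₀ (norm_nonneg _)
    rw [norm_smul]
    norm_num
    linarith [h.norm_le]
  have h6 := h.curvature
  have h7 := mul_nonneg h.nonneg (sq_nonneg ‖s‖)
  -- The upper clip at 1 does no harm: the left side is at most 4/3 - 1/3, since favourable noise is
  -- discarded by the minimum with 0. Otherwise `f (x + s) - f (x + s / 2)` is computed from `h1`
  -- and `h2`; the midpoint remainder costs 1/6, and another 1/6 is in the definition.
  refine le_trans (le_min ?_ ?_) (le_max_right _ _)
  · linarith [min_le_left 0 (1 / 2 * ⟪gradient f x - g, s⟫ + 3 / 8 * ⟪s, (hess f x - K) s⟫)]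
  · linarith [min_le_right 0 (1 / 2 * ⟪gradient f x - g, s⟫ + 3 / 8 * ⟪s, (hess f x - K) s⟫)]

theorem exists_direction (hd : 0 < d) (y : Param d) :
    ∃ n : Param d, ‖n‖ = 1 ∧ ⟪y, n⟫ = ‖y‖ := by
  by_cases hy : y = 0
  · refine ⟨EuclideanSpace.single ⟨0, hd⟩ 1, by simp, by simp [hy]⟩
  · refine ⟨‖y‖⁻¹ • y, ?_, ?_⟩
    · rw [norm_smul, norm_inv, norm_norm, inv_mul_cancel₀ (norm_ne_zero_iff.2 hy)]
    · rw [inner_smul_right, real_inner_self_eq_norm_sq]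
      have := norm_ne_zero_iff.2 hy
      field_simp

/-- The gradient and the function remainders compete: a multiplier pulls against the direction
in which `f` can exceed its model. -/
theorem exists_angle (hd : 0 < d) (hf : LipschitzHessian f 1)
    (h : NoisyStep f E g K x s l a b C) :
    ∃ η : ℝ, -1 ≤ η ∧ η ≤ 1 ∧ ∀ κ : ℝ, 0 ≤ κ → ‖gradRem f x s - l • s‖ + κ * funRem f x s ≤
      2 + 4 * κ / 3 - (1 - η) * (4 * κ / (3 * (1 + κ))) * (if l = 0 then 0 else 1)
        - 2 * l * η := by
  -- Testing against the direction of `gradRem - l • s` itself turns its norm into ⟪gradRem, n⟫ - l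
  -- ⟪s, n⟫, to which the joint remainder bound applies.
  obtain ⟨n, hn1, hn2⟩ := exists_direction hd (gradRem f x s - l • s)
  rw [inner_sub_left, inner_smul_left, conj_trivial, real_inner_comm n s] at hn2
  by_cases hl : l = 0
  -- For l = 0 the step may be shorter than 2 and no saving is claimed; the triangle inequality
  -- suffices and η = 1 is a dummy value, all of its terms being multiplied by zero.
  · refine ⟨1, by norm_num, le_rfl, fun κ hκ => ?_⟩
    have := hf.remainder_le x s n κ (1 + 2 * κ) (-2 * κ) 0 (by
      intro u hu
      refine (norm_add_le _ _).trans ?_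
      rw [norm_smul, hn1, Real.norm_of_nonneg (mul_nonneg hκ (by linarith [hu.2]))]
      nlinarith [mul_le_mul_of_nonneg_left h.norm_le
        (mul_nonneg hκ (by linarith [hu.2] : 0 ≤ 1 - u))])
    have hs2 := pow_le_pow_left₀ (norm_nonneg s) h.norm_le 2
    rw [← hn2, hl, if_pos rfl]
    nlinarith
  · have hs := h.compl.resolve_left hl
    refine ⟨⟪n, s⟫ / 2, ?_, ?_, fun κ hκ => ?_⟩
    · have := neg_le_of_abs_le (abs_real_inner_le_norm n s)
      rw [hs, hn1] at this
      linarith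
    · have := real_inner_le_norm n s
      rw [hs, hn1] at this
      linarith
    · have := hf.remainder_le_of_norm_eq_two x s n hs hn1 hκ
      rw [← hn2, if_neg hl]
      linarith

theorem mul_norm_sq (h : NoisyStep f E g K x s l a b C) : l * ‖s‖ ^ 2 = 4 * l := by
  rcases h.compl with h0 | h0 <;> rw [h0] <;> ring

/-- The values κ = 2/5 and κ = 3/5 are the coefficients of the function remainder left over by the
potential in an ordinary step and in the last one; l/10 is the multiplier term left over in the
former. The bound is affine in η, so the endpoints decide: η = 1 is immediate, and η = -1 needs 2l ≤
320/441 in the first estimate, hence the threshold 7/10. -/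
theorem gradient_le_of_small (hd : 0 < d) (hf : LipschitzHessian f 1)
    (h : NoisyStep f E g K x s l a b C) (hl : 2 * l ≤ 7 / 10) :
    ‖gradRem f x s - l • s‖ + 2 / 5 * funRem f x s + l / 10 ≤ 2 + 8 / 15 ∧
    ‖gradRem f x s - l • s‖ + 3 / 5 * funRem f x s ≤ 2 + 4 / 5 := by
  obtain ⟨η, h1, h2, h3⟩ := h.exists_angle hd hf
  have e1 := h3 (2 / 5) (by norm_num)
  have e2 := h3 (3 / 5) (by norm_num)
  have h4 := h.nonneg
  by_cases hl0 : l = 0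
  · rw [if_pos hl0, hl0] at e1 e2
    rw [hl0]
    constructor <;> linarith
  · rw [if_neg hl0] at e1 e2
    constructor <;> nlinarith [mul_nonneg h4 (sub_nonneg.2 h2)]

/-- With κ = 1 the bound of `exists_angle` minus 2l is 2 + (1 + η)(2/3 - 2l), so any 2l ≥ 2/3 would
do; 7/10 matches the other regime. -/
theorem gradient_le_of_large (hd : 0 < d) (hf : LipschitzHessian f 1)
    (h : NoisyStep f E g K x s l a b C) (hl : 7 / 10 ≤ 2 * l) :
    ‖gradRem f x s - l • s‖ + funRem f x s - 2 * l ≤ 2 := by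
  obtain ⟨η, h1, h2, h3⟩ := h.exists_angle hd hf
  have e1 := h3 1 (by norm_num)
  have hl0 : l ≠ 0 := by rintro rfl; norm_num at hl
  rw [if_neg hl0] at e1
  nlinarith [mul_nonneg (sub_nonneg.2 hl) (by linarith : 0 ≤ 1 + η)]

/-- One step of the potential argument. -/
theorem potential_step (hd : 0 < d) (hf : LipschitzHessian f 1)
    (h : NoisyStep f E g K x s l a b C) {q : ℝ} (hq1 : q ≤ 1)
    (hq : q ≤ modelDrop g K s + a + b / 2) :
    ‖gradient f (x + s)‖ - 4 * C ≤ (f x - 3 / 5 * q) - (f (x + s) - 3 / 5 * recoverable f x s)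
      + 41 / 15 + 18 / 5 * a + 43 / 10 * b ∧
    2 ≤ (f x - 3 / 5 * q) - (f (x + s) - 3 / 5 * recoverable f x s)
      + 14 / 5 + 18 / 5 * a + 43 / 10 * b := by
  have h1 := h.decrease
  have h2 := h.norm_gradient_le
  have h3 := h.recoverable_ge hf
  have h4 := h.modelDrop_eq
  have h5 := abs_le.1 (h.funRem_le hf)
  have h6 := abs_le.1 h.grad_error_le
  have h7 := abs_le.1 h.hess_error_le
  have h8 := h.curvature
  have h9 := h.nonneg
  have h10 := recoverable_nonneg f x s
  have hb := h.noise_nonneg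
  have ha : 0 ≤ a := (norm_nonneg _).trans h.grad_noise
  rw [h.mul_norm_sq] at h3 h4 h8
  have h11 : ⟪gradient f x - g, s⟫ + 1 / 2 * ⟪s, (hess f x - K) s⟫ - 3 / 5 * min 0
      (1 / 2 * ⟪gradient f x - g, s⟫ + 3 / 8 * ⟪s, (hess f x - K) s⟫) ≤ 2 * a + 2 * b := by
    rcases min_cases 0 (1 / 2 * ⟪gradient f x - g, s⟫ + 3 / 8 * ⟪s, (hess f x - K) s⟫)
      with ⟨e, _⟩ | ⟨e, _⟩ <;> rw [e] <;> linarith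
  constructor
  · rcases le_total (2 * l) (7 / 10) with hl | hl
    · have := (h.gradient_le_of_small hd hf hl).1
      linarith
    · have := h.gradient_le_of_large hd hf hl
      linarith
  · rcases le_total (2 * l) (6 / 5) with hl | hl
    · linarith
    · linarith

/-- The last step of the potential argument. -/
theorem potential_last (hd : 0 < d) (hf : LipschitzHessian f 1)
    (h : NoisyStep f E g K x s l a b C) {q m : ℝ} (hq1 : q ≤ 1)
    (hq : q ≤ modelDrop g K s + a + b / 2) (hm : ∀ y, m ≤ f y) :
    ‖gradient f (x + s)‖ - 4 * C ≤ (f x - 3 / 5 * q) - m + 14 / 5 + 3 * a + 4 * b ∧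
    2 ≤ (f x - 3 / 5 * q) - m + 14 / 5 + 3 * a + 4 * b := by
  have h1 := h.decrease
  have h2 := h.norm_gradient_le
  have h4 := h.modelDrop_eq
  have h5 := abs_le.1 (h.funRem_le hf)
  have h6 := abs_le.1 h.grad_error_le
  have h7 := abs_le.1 h.hess_error_le
  have h8 := h.curvature
  have h9 := h.nonneg
  have hb := h.noise_nonneg
  have ha : 0 ≤ a := (norm_nonneg _).trans h.grad_noise
  rw [h.mul_norm_sq] at h4 h8
  have m1 := hm x
  have m2 := hm (x + s)
  -- No later step can undo an increase here. For small l, only 3/5 of f x - m is compared with the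
  -- decrease, the rest being nonnegative; then 3/5 of the model drop pays for q and -(3/5) funRem
  -- remains. This is the case κ = 3/5, with 14/5 = 2 + 4/5.
  constructor
  · rcases le_total (2 * l) (7 / 10) with hl | hl
    · have := (h.gradient_le_of_small hd hf hl).2
      linarith
    · have := h.gradient_le_of_large hd hf hl
      linarith
  · linarith

/-- The multiplier is controlled by the decrease of `f`. -/
theorem multiplier_le (hf : LipschitzHessian f 1) (h : NoisyStep f E g K x s l a b C) :
    2 * l ≤ f x - f (x + s) + 4 / 3 + 2 * a + 2 * b := by
  have h1 := h.decrease
  have h4 := h.modelDrop_eq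
  have h5 := abs_le.1 (h.funRem_le hf)
  have h6 := abs_le.1 h.grad_error_le
  have h7 := abs_le.1 h.hess_error_le
  have h8 := h.curvature
  rw [h.mul_norm_sq] at h4 h8
  linarith

end NoisyStep

/-- The model at `x + p` drops at least by what is recoverable along the previous step `p`. -/
theorem recoverable_le_modelDrop {f : Param d → ℝ} {E : Submodule ℝ (Param d)} {g : Param d}
    {K : Param d →L[ℝ] Param d} {x p s : Param d} {a b : ℝ} (hf : LipschitzHessian f 1)
    (hpE : p ∈ E) (hp : ‖p‖ ≤ 2)
    (hmin : ∀ z ∈ E, ‖z‖ ≤ 2 → ⟪g, s⟫ + 1 / 2 * ⟪s, K s⟫ ≤ ⟪g, z⟫ + 1 / 2 * ⟪z, K z⟫)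
    (ha : ‖gradient f (x + p) - g‖ ≤ a) (hb : 0 ≤ b)
    (hH : ∀ y ∈ E, ∀ z ∈ E, |⟪y, (hess f (x + p) - K) z⟫| ≤ b * ‖y‖ * ‖z‖) :
    recoverable f x p ≤ modelDrop g K s + a + b / 2 := by
  have ha0 : 0 ≤ a := (norm_nonneg _).trans ha
  have h0 := hmin 0 E.zero_mem (by simp)
  -- The competitor is half a step back, which is feasible because p lies in E. At x + p the true
  -- quadratic differs from f by at most 1/6 there, as ‖p / 2‖ ≤ 1; this is the 1/6 subtracted in
  -- `recoverable`. Half the gradient error and an eighth of the Hessian form give the a and the b /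
  -- 2.
  have h1 := hmin ((-(1 / 2) : ℝ) • p) (E.smul_mem _ hpE) (by
    rw [norm_smul]; norm_num; linarith)
  have h2 := abs_le.1 (hf.abs_funRem_le (x + p) ((-(1 / 2) : ℝ) • p))
  have h3 : ‖(-(1 / 2) : ℝ) • p‖ ^ 3 ≤ 1 := by
    apply pow_le_one₀ (norm_nonneg _)
    rw [norm_smul]
    norm_num
    linarith
  have h4 : |⟪gradient f (x + p) - g, p⟫| ≤ 2 * a := by
    calc _ ≤ ‖gradient f (x + p) - g‖ * ‖p‖ := abs_real_inner_le_norm _ _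
      _ ≤ a * 2 := mul_le_mul ha hp (norm_nonneg _) ha0
      _ = 2 * a := by ring
  have h5 : |⟪p, (hess f (x + p) - K) p⟫| ≤ 4 * b := by
    refine (hH p hpE p hpE).trans ?_
    have : ‖p‖ * ‖p‖ ≤ 2 * 2 := by gcongr
    nlinarith
  have h4' := abs_le.1 h4
  have h5' := abs_le.1 h5
  have hmid : x + p + (-(1 / 2) : ℝ) • p = x + (1 / 2 : ℝ) • p := by module
  rw [recoverable, modelDrop]
  refine max_le ?_ ((min_le_right _ _).trans ?_)
  · simp at h0
    linarith
  · simp only [funRem, hmid, map_smul, inner_smul_left, inner_smul_right, conj_trivial] at h1 h2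
    simp only [inner_sub_left, inner_sub_right, sub_apply] at h4' h5'
    linarith

end Descent

/-! ### Differentiating means from second moments of the score. -/

section ScoreDerivative

variable {T : Type*} [MeasurableSpace T] {m : Measure T} {p k : ℝ → T → ℝ} {B : ℝ}

theorem integrable_of_lintegral_eq_one {q : T → ℝ} (hq0 : ∀ τ, 0 ≤ q τ) (hqm : Measurable q)
    (hq1 : ∫⁻ τ, ENNReal.ofReal (q τ) ∂m = 1) : Integrable q m ∧ ∫ τ, q τ ∂m = 1 := by
  refine ⟨⟨hqm.aestronglyMeasurable, ?_⟩, ?_⟩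
  · rw [hasFiniteIntegral_iff_ofReal (Filter.Eventually.of_forall hq0), hq1]
    exact ENNReal.one_lt_top
  · rw [integral_eq_lintegral_of_nonneg_ae (Filter.Eventually.of_forall hq0)
      hqm.aestronglyMeasurable, hq1]
    simp

theorem abs_sub_clamp_le (y : ℝ) {N : ℝ} (hN : 0 < N) :
    |y - max (-N) (min N y)| ≤ y ^ 2 / N := by
  rw [le_div_iff₀ hN]
  rcases le_total N y with h | h
  · rw [min_eq_left h, max_eq_right (by linarith), abs_of_nonneg (by linarith)]
    nlinarith
  · rw [min_eq_right h]
    rcases le_total (-N) y with h' | h'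
    · rw [max_eq_right h']
      simp only [sub_self, abs_zero, zero_mul]
      positivity
    · rw [max_eq_left h', abs_of_nonpos (by linarith)]
      nlinarith

theorem abs_clamp_le (y : ℝ) {N : ℝ} (hN : 0 ≤ N) : |max (-N) (min N y)| ≤ N :=
  abs_le.2 ⟨le_max_left _ _, max_le (by linarith) (min_le_left _ _)⟩

/-- Probability densities that converge pointwise converge in mean. -/
theorem tendsto_integral_abs_sub_density (hp0 : ∀ t τ, 0 ≤ p t τ) (hpm : ∀ t, Measurable (p t))
    (hp1 : ∀ t, ∫⁻ τ, ENNReal.ofReal (p t τ) ∂m = 1) (hpc : ∀ τ, Continuous fun t => p t τ)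
    (t₀ : ℝ) :
    Filter.Tendsto (fun t => ∫ τ, |p t τ - p t₀ τ| ∂m) (nhds t₀) (nhds 0) := by
  have hi := fun t => (integrable_of_lintegral_eq_one (hp0 t) (hpm t) (hp1 t)).1
  have h1 := fun t => (integrable_of_lintegral_eq_one (hp0 t) (hpm t) (hp1 t)).2
  have hmax : ∀ t, Integrable (fun τ => max (p t₀ τ - p t τ) 0) m := fun t =>
    ((hi t₀).sub (hi t)).pos_part
  -- Scheffé's argument: both densities have mass one, so their distance is twice the integral of
  -- the positive part of p t₀ - p t, which is dominated by p t₀.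
  have heq : ∀ t, ∫ τ, |p t τ - p t₀ τ| ∂m = 2 * ∫ τ, max (p t₀ τ - p t τ) 0 ∂m := by
    intro t
    have : ∀ τ, |p t τ - p t₀ τ| = (p t τ - p t₀ τ) + 2 * max (p t₀ τ - p t τ) 0 := by
      intro τ
      rcases le_total (p t τ) (p t₀ τ) with h | h
      · rw [abs_of_nonpos (by linarith), max_eq_left (by linarith)]; ring
      · rw [abs_of_nonneg (by linarith), max_eq_right (by linarith)]; ring
    simp_rw [this]
    have e := integral_add ((hi t).sub (hi t₀)) ((hmax t).const_mul 2)
    simp only [Pi.sub_apply] at e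
    rw [e, integral_sub (hi t) (hi t₀), h1, h1, integral_const_mul]
    ring
  simp_rw [heq]
  have : Filter.Tendsto (fun t => ∫ τ, max (p t₀ τ - p t τ) 0 ∂m) (nhds t₀)
      (nhds (∫ _τ, (0 : ℝ) ∂m)) := by
    apply tendsto_integral_filter_of_dominated_convergence (p t₀)
    · exact Filter.Eventually.of_forall fun t => (hmax t).aestronglyMeasurable
    · refine Filter.Eventually.of_forall fun t => Filter.Eventually.of_forall fun τ => ?_
      rw [Real.norm_of_nonneg (le_max_right _ _)]
      exact max_le (by linarith [hp0 t τ]) (hp0 t₀ τ)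
    · exact hi t₀
    · refine Filter.Eventually.of_forall fun τ => ?_
      have hc : Continuous fun t => max (p t₀ τ - p t τ) 0 := by
        have := hpc τ
        fun_prop
      simpa using hc.tendsto t₀
  simpa using this.const_mul 2

theorem integrable_mul_density (hp0 : ∀ t τ, 0 ≤ p t τ) (hpm : ∀ t, Measurable (p t))
    (hp1 : ∀ t, ∫⁻ τ, ENNReal.ofReal (p t τ) ∂m = 1) (hkm : ∀ t, Measurable (k t))
    (hB : ∀ t, ∫⁻ τ, ENNReal.ofReal (k t τ ^ 2 * p t τ) ∂m ≤ ENNReal.ofReal B) (t : ℝ) :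
    Integrable (fun τ => k t τ ^ 2 * p t τ) m ∧ Integrable (fun τ => k t τ * p t τ) m := by
  have hi := (integrable_of_lintegral_eq_one (hp0 t) (hpm t) (hp1 t)).1
  have h2 : Integrable (fun τ => k t τ ^ 2 * p t τ) m := by
    refine ⟨(((hkm t).pow_const 2).mul (hpm t)).aestronglyMeasurable, ?_⟩
    rw [hasFiniteIntegral_iff_ofReal (Filter.Eventually.of_forall fun τ =>
      mul_nonneg (sq_nonneg _) (hp0 t τ))]
    exact (hB t).trans_lt ENNReal.ofReal_lt_top
  refine ⟨h2, (h2.add hi).mono' ((hkm t).mul (hpm t)).aestronglyMeasurable ?_⟩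
  refine Filter.Eventually.of_forall fun τ => ?_
  rw [norm_mul, Real.norm_of_nonneg (hp0 t τ), Real.norm_eq_abs, Pi.add_apply]
  have : |k t τ| ≤ k t τ ^ 2 + 1 := by
    nlinarith [sq_abs (k t τ), sq_nonneg (|k t τ| - 1)]
  nlinarith [hp0 t τ]

theorem integral_sq_mul_density_le (hB0 : 0 ≤ B) (hp0 : ∀ t τ, 0 ≤ p t τ)
    (hpm : ∀ t, Measurable (p t)) (hkm : ∀ t, Measurable (k t))
    (hB : ∀ t, ∫⁻ τ, ENNReal.ofReal (k t τ ^ 2 * p t τ) ∂m ≤ ENNReal.ofReal B) (t : ℝ) :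
    ∫ τ, k t τ ^ 2 * p t τ ∂m ≤ B := by
  rw [integral_eq_lintegral_of_nonneg_ae (Filter.Eventually.of_forall fun τ =>
      mul_nonneg (sq_nonneg _) (hp0 t τ)) (((hkm t).pow_const 2).mul (hpm t)).aestronglyMeasurable]
  exact ENNReal.toReal_le_of_le_ofReal hB0 (hB t)

/-- Bounded second moments make the mean of a continuous family continuous. -/
theorem continuous_integral_mul_density (hB0 : 0 ≤ B) (hp0 : ∀ t τ, 0 ≤ p t τ)
    (hpm : ∀ t, Measurable (p t)) (hp1 : ∀ t, ∫⁻ τ, ENNReal.ofReal (p t τ) ∂m = 1)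
    (hpc : ∀ τ, Continuous fun t => p t τ) (hkm : ∀ t, Measurable (k t))
    (hkc : ∀ τ, Continuous fun t => k t τ)
    (hB : ∀ t, ∫⁻ τ, ENNReal.ofReal (k t τ ^ 2 * p t τ) ∂m ≤ ENNReal.ofReal B) :
    Continuous fun t => ∫ τ, k t τ * p t τ ∂m := by
  have hi := fun t => (integrable_of_lintegral_eq_one (hp0 t) (hpm t) (hp1 t)).1
  -- The means of the truncated family are continuous, and the second moment bounds the truncation
  -- error by B / (N + 1) uniformly in t.
  set c : ℕ → ℝ → T → ℝ := fun N t τ => max (-((N : ℝ) + 1)) (min ((N : ℝ) + 1) (k t τ)) with hc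
  have hcm : ∀ N t, Measurable (c N t) := fun N t =>
    (measurable_const.max (measurable_const.min (hkm t)))
  have hcb : ∀ N t τ, |c N t τ| ≤ (N : ℝ) + 1 := fun N t τ => abs_clamp_le _ (by positivity)
  have hci : ∀ N t t', Integrable (fun τ => c N t τ * p t' τ) m := fun N t t' =>
    (hi t').bdd_mul (hcm N t).aestronglyMeasurable
      (Filter.Eventually.of_forall fun τ => by rw [Real.norm_eq_abs]; exact hcb N t τ)
  have hcont : ∀ N, Continuous fun t => ∫ τ, c N t τ * p t τ ∂m := by
    intro N
    rw [continuous_iff_continuousAt]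
    intro t₀
    -- The dependence on t of the density and that of the integrand are separated: convergence in
    -- mean handles the first, dominated convergence the second.
    have e : (fun t => ∫ τ, c N t τ * p t τ ∂m) =
        fun t => (∫ τ, c N t τ * (p t τ - p t₀ τ) ∂m) + ∫ τ, c N t τ * p t₀ τ ∂m := by
      funext t
      rw [← integral_add _ (hci N t t₀)]
      · congr 1; funext τ; ring
      · simp_rw [mul_sub]
        exact (hci N t t).sub (hci N t t₀)
    have l1 : Filter.Tendsto (fun t => ∫ τ, c N t τ * (p t τ - p t₀ τ) ∂m) (nhds t₀) (nhds 0) := by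
      apply squeeze_zero_norm (a := fun t => ((N : ℝ) + 1) * ∫ τ, |p t τ - p t₀ τ| ∂m)
      · intro t
        rw [← integral_const_mul]
        refine (norm_integral_le_integral_norm _).trans ?_
        apply integral_mono_of_nonneg (Filter.Eventually.of_forall fun τ => norm_nonneg _)
          (((hi t).sub (hi t₀)).abs.const_mul _)
        refine Filter.Eventually.of_forall fun τ => ?_
        simp only [norm_mul, Real.norm_eq_abs]
        exact mul_le_mul_of_nonneg_right (hcb N t τ) (abs_nonneg _)
      · simpa using (tendsto_integral_abs_sub_density hp0 hpm hp1 hpc t₀).const_mul ((N : ℝ) + 1)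
    have l2 : Filter.Tendsto (fun t => ∫ τ, c N t τ * p t₀ τ ∂m) (nhds t₀)
        (nhds (∫ τ, c N t₀ τ * p t₀ τ ∂m)) := by
      apply tendsto_integral_filter_of_dominated_convergence (fun τ => ((N : ℝ) + 1) * p t₀ τ)
      · exact Filter.Eventually.of_forall fun t => (hci N t t₀).aestronglyMeasurable
      · refine Filter.Eventually.of_forall fun t => Filter.Eventually.of_forall fun τ => ?_
        rw [norm_mul, Real.norm_of_nonneg (hp0 t₀ τ), Real.norm_eq_abs]
        exact mul_le_mul_of_nonneg_right (hcb N t τ) (hp0 _ _)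
      · exact (hi t₀).const_mul _
      · refine Filter.Eventually.of_forall fun τ => ?_
        have : Continuous fun t => c N t τ * p t₀ τ := by
          have := hkc τ
          simp only [hc]
          fun_prop
        exact this.tendsto t₀
    rw [ContinuousAt, e]
    simpa using l1.add l2
  apply TendstoUniformly.continuous (F := fun N t => ∫ τ, c N t τ * p t τ ∂m) (p := Filter.atTop) _
    (Filter.Frequently.of_forall hcont)
  rw [Metric.tendstoUniformly_iff]
  intro ε hε
  obtain ⟨N₀, hN₀⟩ := exists_nat_gt (B / ε)
  filter_upwards [Filter.eventually_ge_atTop N₀] with N hN t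
  have hN1 : (0 : ℝ) < (N : ℝ) + 1 := by positivity
  obtain ⟨i2, i1⟩ := integrable_mul_density hp0 hpm hp1 hkm hB t
  rw [Real.dist_eq, ← integral_sub i1 (hci N t t)]
  calc |∫ τ, (k t τ * p t τ - c N t τ * p t τ) ∂m|
      ≤ ∫ τ, k t τ ^ 2 * p t τ / ((N : ℝ) + 1) ∂m := by
        rw [← Real.norm_eq_abs]
        refine (norm_integral_le_integral_norm _).trans ?_
        apply integral_mono_of_nonneg (Filter.Eventually.of_forall fun τ => norm_nonneg _)
          (i2.div_const _)
        refine Filter.Eventually.of_forall fun τ => ?_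
        simp only [← sub_mul, norm_mul, Real.norm_of_nonneg (hp0 t τ), Real.norm_eq_abs]
        rw [mul_div_right_comm]
        exact mul_le_mul_of_nonneg_right (abs_sub_clamp_le _ hN1) (hp0 _ _)
    _ = (∫ τ, k t τ ^ 2 * p t τ ∂m) / ((N : ℝ) + 1) := integral_div _ _
    _ ≤ B / ((N : ℝ) + 1) := by
        gcongr
        exact integral_sq_mul_density_le hB0 hp0 hpm hkm hB t
    _ < ε := by
        rw [div_lt_iff₀ hN1]
        rw [div_lt_iff₀ hε] at hN₀
        have : (N₀ : ℝ) ≤ N := by exact_mod_cast hN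
        nlinarith

/-- Differentiation of a mean under the integral sign, from uniform second moments of the
score-weighted derivative alone. -/
theorem hasDerivAt_integral_of_score [SFinite m] {f : ℝ → T → ℝ} (hB0 : 0 ≤ B)
    (hp0 : ∀ t τ, 0 ≤ p t τ)
    (hpm : ∀ t, Measurable (p t)) (hp1 : ∀ t, ∫⁻ τ, ENNReal.ofReal (p t τ) ∂m = 1)
    (hpc : ∀ τ, Continuous fun t => p t τ) (hkm : ∀ t, Measurable (k t))
    (hkc : ∀ τ, Continuous fun t => k t τ)
    (hB : ∀ t, ∫⁻ τ, ENNReal.ofReal (k t τ ^ 2 * p t τ) ∂m ≤ ENNReal.ofReal B)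
    (hf : ∀ t τ, HasDerivAt (fun t => f t τ) (k t τ * p t τ) t) (hfi : ∀ t, Integrable (f t) m)
    (t₀ : ℝ) :
    HasDerivAt (fun t => ∫ τ, f t τ ∂m) (∫ τ, k t₀ τ * p t₀ τ ∂m) t₀ := by
  have hcont := continuous_integral_mul_density hB0 hp0 hpm hp1 hpc hkm hkc hB
  have hkpm : Measurable (Function.uncurry fun t τ => k t τ * p t τ) := by
    apply measurable_uncurry_of_continuous_of_measurable
    · exact fun τ => (hkc τ).mul (hpc τ)
    · exact fun t => (hkm t).mul (hpm t)
  have hnorm : ∀ t, ∫ τ, ‖k t τ * p t τ‖ ∂m ≤ B + 1 := by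
    intro t
    obtain ⟨i2, i1⟩ := integrable_mul_density hp0 hpm hp1 hkm hB t
    obtain ⟨j1, j2⟩ := integrable_of_lintegral_eq_one (hp0 t) (hpm t) (hp1 t)
    calc _ ≤ ∫ τ, (k t τ ^ 2 * p t τ + p t τ) ∂m := by
          apply integral_mono i1.norm (i2.add j1)
          intro τ
          simp only [norm_mul, Real.norm_of_nonneg (hp0 t τ), Real.norm_eq_abs, Pi.add_apply]
          have : |k t τ| ≤ k t τ ^ 2 + 1 := by
            nlinarith [sq_abs (k t τ), sq_nonneg (|k t τ| - 1)]
          nlinarith [hp0 t τ]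
      _ ≤ B + 1 := by
          rw [integral_add i2 j1, j2]
          gcongr
          exact integral_sq_mul_density_le hB0 hp0 hpm hkm hB t
  -- No integrable majorant uniform in t is available, so the derivative is not taken inside the
  -- integral directly. The fundamental theorem of calculus for each τ and Fubini write the mean as
  -- a primitive of a function already known to be continuous.
  have key : ∀ t, ∫ τ, f t τ ∂m = ∫ τ, f t₀ τ ∂m + ∫ u in t₀..t, ∫ τ, k u τ * p u τ ∂m := by
    intro t
    have hkp : Integrable (Function.uncurry fun u τ => k u τ * p u τ)
        ((volume.restrict (Set.uIoc t₀ t)).prod m) := by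
      rw [integrable_prod_iff hkpm.aestronglyMeasurable]
      refine ⟨Filter.Eventually.of_forall fun u =>
        (integrable_mul_density hp0 hpm hp1 hkm hB u).2, ?_⟩
      have : IsFiniteMeasure ((volume : Measure ℝ).restrict (Set.uIoc t₀ t)) :=
        ⟨by simp [Set.uIoc]⟩
      apply Integrable.of_bound (C := B + 1)
      · exact (hkpm.norm.stronglyMeasurable.integral_prod_right (ν := m)).aestronglyMeasurable
      · refine Filter.Eventually.of_forall fun u => ?_
        rw [Real.norm_of_nonneg (integral_nonneg fun τ => norm_nonneg _)]
        exact hnorm u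
    have hFTC : ∀ τ, f t τ - f t₀ τ = ∫ u in t₀..t, k u τ * p u τ := by
      intro τ
      rw [intervalIntegral.integral_eq_sub_of_hasDerivAt (fun u _ => hf u τ)]
      exact ((hkc τ).mul (hpc τ)).intervalIntegrable _ _
    rw [intervalIntegral.intervalIntegral_eq_integral_uIoc, integral_integral_swap hkp,
      ← integral_smul, ← sub_eq_iff_eq_add', ← integral_sub (hfi t) (hfi t₀)]
    congr 1
    funext τ
    rw [hFTC τ, intervalIntegral.intervalIntegral_eq_integral_uIoc]
  have : (fun t => ∫ τ, f t τ ∂m) = fun t => ∫ τ, f t₀ τ ∂m +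
      ∫ u in t₀..t, ∫ τ, k u τ * p u τ ∂m := funext key
  rw [this]
  apply HasDerivAt.const_add
  exact intervalIntegral.integral_hasDerivAt_right (hcont.intervalIntegrable _ _)
    (hcont.stronglyMeasurableAtFilter _ _) hcont.continuousAt

end ScoreDerivative

/-! ### Trajectory laws and their prefixes. -/

section Trajectory

variable {S A : Type*} [MeasurableSpace S] [MeasurableSpace A]

instance isSFiniteKernel_refKernel (P : Kernel (S × A) S) [IsSFiniteKernel P] (ν : Measure A)
    [SFinite ν] (n : ℕ) : IsSFiniteKernel (refKernel P ν n) := by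
  induction n with
  | zero => unfold refKernel; infer_instance
  | succ n ih => unfold refKernel; infer_instance

theorem measurable_cons (n : ℕ) :
    Measurable fun x : (S × A) × Traj S A n => (Fin.cons x.1 x.2 : Traj S A (n + 1)) := by
  rw [measurable_pi_iff]
  intro i
  refine Fin.cases ?_ (fun j => ?_) i
  · simpa using measurable_fst
  · simp only [Fin.cons_succ]
    exact (measurable_pi_apply j).comp measurable_snd

theorem lintegral_refKernel_succ (P : Kernel (S × A) S) [IsSFiniteKernel P] (ν : Measure A)
    [SFinite ν] (n : ℕ) (s : S) {F : Traj S A (n + 1) → ℝ≥0∞} (hF : Measurable F) :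
    ∫⁻ τ, F τ ∂(refKernel P ν (n + 1) s) =
      ∫⁻ a, ∫⁻ s', ∫⁻ τ, F (Fin.cons (s, a) τ) ∂(refKernel P ν n s') ∂(P (s, a)) ∂ν := by
  have hm : Measurable fun x : S × ((A × S) × Traj S A n) =>
      (Fin.cons (x.1, x.2.1.1) x.2.2 : Traj S A (n + 1)) :=
    (measurable_cons n).comp (by fun_prop :
      Measurable fun x : S × ((A × S) × Traj S A n) => ((x.1, x.2.1.1), x.2.2))
  have h1 : Measurable fun y : (A × S) × Traj S A n =>
      F (Fin.cons (s, y.1.1) y.2) := hF.comp (hm.comp measurable_prodMk_left)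
  have h2 : Measurable fun x : S × ((A × S) × Traj S A n) =>
      F (Fin.cons (x.1, x.2.1.1) x.2.2) := hF.comp hm
  rw [refKernel, Kernel.lintegral_map _ hm _ hF, Kernel.lintegral_id_prod h2,
    Kernel.lintegral_compProd _ _ _ h1, Kernel.lintegral_compProd]
  · simp [Kernel.const_apply, Kernel.comap_apply]
  · exact Measurable.lintegral_kernel_prod_right' (κ := ((refKernel P ν n).comap
      (fun x : S × (A × S) => x.2.2) (by fun_prop)).comap (fun y : A × S => (s, y)) (by fun_prop)) h1

variable {ν : Measure A} {d : ℕ} (mdp : MDP S A) (pol : PolicyClass S A ν d)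

/-- The density of a trajectory under `π_θ`. -/
def trajDens (n : ℕ) (θ : Param d) (τ : Traj S A n) : ℝ := ∏ h, pol.dens θ (τ h).1 (τ h).2

theorem trajDens_pos (n : ℕ) (θ : Param d) (τ : Traj S A n) : 0 < trajDens pol n θ τ :=
  Finset.prod_pos fun _ _ => pol.dens_pos _ _ _

theorem measurable_dens_apply {n : ℕ} (θ : Param d) (h : Fin n) :
    Measurable fun τ : Traj S A n => pol.dens θ (τ h).1 (τ h).2 :=
  (pol.measurable_dens θ).comp (measurable_pi_apply h)

theorem measurable_trajDens (n : ℕ) (θ : Param d) : Measurable (trajDens pol n θ) :=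
  Finset.measurable_prod _ fun h _ => measurable_dens_apply pol θ h

theorem prod_ofReal_dens (n : ℕ) (θ : Param d) (τ : Traj S A n) :
    ∏ h : Fin n, ENNReal.ofReal (pol.dens θ (τ h).1 (τ h).2) =
      ENNReal.ofReal (trajDens pol n θ τ) := by
  rw [trajDens, ENNReal.ofReal_prod_of_nonneg fun _ _ => (pol.dens_pos _ _ _).le]

theorem trajDens_cons (n : ℕ) (θ : Param d) (x : S × A) (τ : Traj S A n) :
    trajDens pol (n + 1) θ (Fin.cons x τ) = pol.dens θ x.1 x.2 * trajDens pol n θ τ := by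
  simp [trajDens, Fin.prod_univ_succ]

/-- The reference measure on trajectories. -/
def refMeasure (n : ℕ) : Measure (Traj S A n) := mdp.ρ.bind (refKernel mdp.P ν n)

theorem trajLaw_eq (n : ℕ) (θ : Param d) : trajLaw mdp pol n θ =
    (refMeasure (ν := ν) mdp n).withDensity fun τ => ENNReal.ofReal (trajDens pol n θ τ) := by
  simp_rw [trajLaw, prod_ofReal_dens, refMeasure]

theorem lintegral_trajLaw (n : ℕ) (θ : Param d) {F : Traj S A n → ℝ≥0∞} (hF : Measurable F) :
    ∫⁻ τ, F τ ∂(trajLaw mdp pol n θ) =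
      ∫⁻ s, ∫⁻ τ, ENNReal.ofReal (trajDens pol n θ τ) * F τ ∂(refKernel mdp.P ν n s) ∂mdp.ρ := by
  have h := (measurable_trajDens pol n θ).ennreal_ofReal
  rw [trajLaw_eq, lintegral_withDensity_eq_lintegral_mul _ h hF, refMeasure,
    Measure.lintegral_bind (Kernel.measurable _).aemeasurable (h.mul hF).aemeasurable]
  rfl

variable [SFinite ν]

instance sFinite_refMeasure (n : ℕ) : SFinite (refMeasure (ν := ν) mdp n) := by
  have := mdp.markov
  have := mdp.prob_ρ
  unfold refMeasure
  infer_instance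

theorem measurable_init (n : ℕ) :
    Measurable fun τ : Traj S A (n + 1) => (fun j => τ j.castSucc : Traj S A n) :=
  measurable_pi_iff.2 fun j => measurable_pi_apply j.castSucc

/-- The induction removes the first step, because the kernel is built from the front, until only the
last action is left; its density integrates to one. The density of the removed step is absorbed in
the test function, which is why `F` is arbitrary. -/
theorem lintegral_init_refKernel (θ : Param d) (n : ℕ) (s : S) {F : Traj S A n → ℝ≥0∞}
    (hF : Measurable F) :
    ∫⁻ τ, ENNReal.ofReal (trajDens pol (n + 1) θ τ) * F (fun j => τ j.castSucc)
        ∂(refKernel mdp.P ν (n + 1) s) =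
      ∫⁻ τ, ENNReal.ofReal (trajDens pol n θ τ) * F τ ∂(refKernel mdp.P ν n s) := by
  have := mdp.markov
  have hm' : ∀ {n} {F : Traj S A n → ℝ≥0∞}, Measurable F → Measurable fun τ : Traj S A (n + 1) =>
      ENNReal.ofReal (trajDens pol (n + 1) θ τ) * F (fun j => τ j.castSucc) := fun hF =>
    (measurable_trajDens pol _ θ).ennreal_ofReal.mul (hF.comp (measurable_init _))
  have hm'' : ∀ {n} {F : Traj S A n → ℝ≥0∞}, Measurable F → Measurable fun τ : Traj S A n =>
      ENNReal.ofReal (trajDens pol n θ τ) * F τ := fun hF =>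
    (measurable_trajDens pol _ θ).ennreal_ofReal.mul hF
  induction n generalizing s with
  | zero =>
    rw [lintegral_refKernel_succ _ _ _ _ (hm' hF)]
    have hd : Measurable fun a => ENNReal.ofReal (pol.dens θ s a) :=
      ((pol.measurable_dens θ).comp measurable_prodMk_left).ennreal_ofReal
    simp only [trajDens_cons, refKernel, Kernel.const_apply, lintegral_dirac]
    have hz : ∀ τ : Traj S A 0, trajDens pol 0 θ τ = 1 := fun τ => by simp [trajDens]
    simp only [hz, mul_one, ENNReal.ofReal_one, one_mul, lintegral_const, measure_univ]
    rw [← one_mul (F fun i => i.elim0), ← pol.lintegral_dens θ s, ← lintegral_mul_const _ hd]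
    refine lintegral_congr fun a => ?_
    congr 2
    exact Subsingleton.elim _ _
  | succ n ih =>
    rw [lintegral_refKernel_succ _ _ _ _ (hm' hF), lintegral_refKernel_succ _ _ _ _ (hm'' hF)]
    refine lintegral_congr fun a => lintegral_congr fun s' => ?_
    have hm : Measurable fun τ : Traj S A n =>
        ENNReal.ofReal (pol.dens θ s a) * F (Fin.cons (s, a) τ) :=
      (hF.comp ((measurable_cons n).comp measurable_prodMk_left)).const_mul _
    have := ih s' hm
    simp only [trajDens_cons, ENNReal.ofReal_mul (pol.dens_pos θ s a).le]
    calc _ = ∫⁻ τ, ENNReal.ofReal (trajDens pol (n + 1) θ τ) * (ENNReal.ofReal (pol.dens θ s a) *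
          F (Fin.cons (s, a) fun j => τ j.castSucc)) ∂(refKernel mdp.P ν (n + 1) s') := by
          refine lintegral_congr fun τ => ?_
          have : (fun j : Fin (n + 1) => (Fin.cons (s, a) τ : Traj S A (n + 1 + 1)) j.castSucc) =
              Fin.cons (s, a) fun j : Fin n => τ j.castSucc := by
            funext j
            refine Fin.cases ?_ (fun i => ?_) j
            · simp
            · simp
          rw [this]
          ring
      _ = _ := by
          rw [this]
          refine lintegral_congr fun τ => ?_
          ring

theorem lintegral_trajLaw_init (θ : Param d) (n : ℕ) {F : Traj S A n → ℝ≥0∞} (hF : Measurable F) :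
    ∫⁻ τ, F (fun j => τ j.castSucc) ∂(trajLaw mdp pol (n + 1) θ) =
      ∫⁻ τ, F τ ∂(trajLaw mdp pol n θ) := by
  have hF' : Measurable fun τ : Traj S A (n + 1) => F (fun j => τ j.castSucc) :=
    hF.comp (measurable_init n)
  rw [lintegral_trajLaw mdp pol n θ hF, lintegral_trajLaw mdp pol (n + 1) θ hF']
  exact lintegral_congr fun s => lintegral_init_refKernel mdp pol θ n s hF

instance isProbabilityMeasure_trajLaw (n : ℕ) (θ : Param d) :
    IsProbabilityMeasure (trajLaw mdp pol n θ) := by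
  constructor
  rw [← lintegral_one]
  induction n with
  | zero =>
    have := mdp.prob_ρ
    rw [lintegral_trajLaw mdp pol 0 θ measurable_const]
    simp [refKernel, trajDens]
  | succ n ih =>
    exact (lintegral_trajLaw_init mdp pol θ n (F := fun _ => 1) measurable_const).trans ih

/-- The law of the first `n` steps of a trajectory. -/
theorem map_trajLaw_init (θ : Param d) (n : ℕ) :
    (trajLaw mdp pol (n + 1) θ).map (fun τ j => τ j.castSucc) = trajLaw mdp pol n θ := by
  ext s hs
  have := lintegral_trajLaw_init mdp pol θ n (measurable_one.indicator hs)
  rw [lintegral_indicator_one hs] at this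
  rw [← this, ← lintegral_indicator_one hs, lintegral_map (measurable_one.indicator hs)
    (measurable_init n)]

theorem measurable_castLE {n N : ℕ} (h : n ≤ N) :
    Measurable fun τ : Traj S A N => (fun j => τ (Fin.castLE h j) : Traj S A n) :=
  measurable_pi_iff.2 fun j => measurable_pi_apply (Fin.castLE h j)

theorem map_trajLaw_castLE (θ : Param d) {n N : ℕ} (h : n ≤ N) :
    (trajLaw mdp pol N θ).map (fun τ j => τ (Fin.castLE h j)) = trajLaw mdp pol n θ := by
  induction N, h using Nat.le_induction with
  | base => simp
  | succ N hN ih =>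
    rw [← ih, ← map_trajLaw_init mdp pol θ N, Measure.map_map (measurable_castLE hN)
      (measurable_init N)]
    rfl

theorem measurePreserving_castLE (θ : Param d) {n N : ℕ} (h : n ≤ N) :
    MeasurePreserving (fun (τ : Traj S A N) j => τ (Fin.castLE h j)) (trajLaw mdp pol N θ)
      (trajLaw mdp pol n θ) :=
  ⟨measurable_castLE h, map_trajLaw_castLE mdp pol θ h⟩

end Trajectory

/-! ### Smoothness, measurability and size of scores. -/

section Regularity

variable {d : ℕ}

theorem inner_gradient_left {f : Param d → ℝ} (x v : Param d) :
    ⟪gradient f x, v⟫ = fderiv ℝ f x v := by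
  simp [gradient]

theorem contDiff_gradient {f : Param d → ℝ} (hf : ContDiff ℝ 2 f) : ContDiff ℝ 1 (gradient f) := by
  rw [contDiff_euclidean]
  intro i
  have : (fun x => gradient f x i) = fun x => fderiv ℝ f x (EuclideanSpace.single i 1) := by
    funext x
    rw [← inner_gradient_left, EuclideanSpace.inner_single_right]
    simp
  rw [this]
  exact (hf.fderiv_right (m := 1) (by norm_num)).clm_apply contDiff_const

/-- An operator is a finite sum of fixed continuous linear functions of its values on the basis. -/
theorem measurable_clm {X : Type*} {mX : MeasurableSpace X} {K : X → Param d →L[ℝ] Param d}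
    (h : ∀ v, Measurable fun x => K x v) : Measurable K := by
  have e : K = fun x => ∑ j, ContinuousLinearMap.smulRightL ℝ (Param d) (Param d)
      (innerSL ℝ (EuclideanSpace.basisFun (Fin d) ℝ j)) (K x (EuclideanSpace.basisFun (Fin d) ℝ j)) := by
    funext x
    ext1 v
    conv_lhs => rw [← (EuclideanSpace.basisFun (Fin d) ℝ).sum_repr v]
    simp [map_sum, EuclideanSpace.inner_single_left]
  rw [e]
  exact Finset.measurable_sum _ fun j _ =>
    (ContinuousLinearMap.continuous _).measurable.comp (h _)

/-- The derivative is a pointwise limit of difference quotients along 1/N, each measurable in x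
because the parameters are frozen. -/
theorem measurable_fderiv_apply_of_family {X V : Type*} [MeasurableSpace X] [NormedAddCommGroup V]
    [NormedSpace ℝ V] [MeasurableSpace V] [BorelSpace V] [SecondCountableTopology V]
    {F : X → Param d → V} (hm : ∀ θ, Measurable fun x => F x θ) (hd : ∀ x, Differentiable ℝ (F x))
    (θ v : Param d) : Measurable fun x => fderiv ℝ (F x) θ v := by
  have hlim : ∀ x, Filter.Tendsto (fun N : ℕ => (N : ℝ) • (F x (θ + (N : ℝ)⁻¹ • v) - F x θ))
      Filter.atTop (nhds (fderiv ℝ (F x) θ v)) := fun x =>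
    ((hd x θ).hasFDerivAt.lim_real v).comp tendsto_natCast_atTop_atTop
  refine measurable_of_tendsto_metrizable (fun N => ?_) (tendsto_pi_nhds.2 hlim)
  exact ((hm _).sub (hm _)).const_smul _

variable {S A : Type*} [MeasurableSpace S] [MeasurableSpace A] {ν : Measure A}
  (pol : PolicyClass S A ν d)

/-- The score `∇ log π_θ(a | s)`. -/
def score (x : S × A) (θ : Param d) : Param d := gradient (logPolicy pol x.1 x.2) θ

/-- The derivative `∇² log π_θ(a | s)` of the score. -/
def scoreDeriv (x : S × A) (θ : Param d) : Param d →L[ℝ] Param d :=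
  hess (logPolicy pol x.1 x.2) θ

theorem contDiff_score (x : S × A) : ContDiff ℝ 1 (score pol x) :=
  contDiff_gradient (pol.contDiff_log x.1 x.2)

theorem continuous_score (x : S × A) : Continuous (score pol x) := (contDiff_score pol x).continuous

theorem continuous_scoreDeriv (x : S × A) : Continuous (scoreDeriv pol x) :=
  (contDiff_score pol x).continuous_fderiv (by norm_num)

theorem hasFDerivAt_score (x : S × A) (θ : Param d) :
    HasFDerivAt (score pol x) (scoreDeriv pol x θ) θ :=
  ((contDiff_score pol x).differentiable (by norm_num) θ).hasFDerivAt

theorem measurable_score (θ : Param d) : Measurable fun x => score pol x θ := by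
  have h1 : ∀ θ, Measurable fun x : S × A => logPolicy pol x.1 x.2 θ := fun θ =>
    (pol.measurable_dens θ).log
  have h2 : ∀ x : S × A, Differentiable ℝ (logPolicy pol x.1 x.2) := fun x =>
    (pol.contDiff_log x.1 x.2).differentiable (by norm_num)
  have h3 : ∀ i, Measurable fun x => score pol x θ i := by
    intro i
    have : (fun x => score pol x θ i) = fun x : S × A =>
        fderiv ℝ (logPolicy pol x.1 x.2) θ (EuclideanSpace.single i 1) := by
      funext x
      rw [← inner_gradient_left, EuclideanSpace.inner_single_right]
      simp [score]
    rw [this]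
    exact measurable_fderiv_apply_of_family h1 h2 θ _
  exact (WithLp.measurable_toLp 2 (Fin d → ℝ)).comp (measurable_pi_iff.2 h3)

theorem measurable_scoreDeriv (θ : Param d) : Measurable fun x => scoreDeriv pol x θ :=
  measurable_clm fun v => measurable_fderiv_apply_of_family (fun θ => measurable_score pol θ)
    (fun x => (contDiff_score pol x).differentiable (by norm_num)) θ v

variable {n : ℕ}

/-- A weighted sum of the scores along a trajectory. -/
def weightedScore (c : Fin n → ℝ) (τ : Traj S A n) (θ : Param d) : Param d :=
  ∑ h, c h • score pol (τ h) θ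

/-- The derivative of a weighted sum of the scores along a trajectory. -/
def weightedScoreDeriv (c : Fin n → ℝ) (τ : Traj S A n) (θ : Param d) : Param d →L[ℝ] Param d :=
  ∑ h, c h • scoreDeriv pol (τ h) θ

/-- The score of a trajectory. -/
def totalScore (τ : Traj S A n) (θ : Param d) : Param d := ∑ h, score pol (τ h) θ

theorem totalScore_eq_weightedScore (τ : Traj S A n) (θ : Param d) :
    totalScore pol τ θ = weightedScore pol (fun _ => 1) τ θ := by
  simp [totalScore, weightedScore]

theorem hasFDerivAt_weightedScore (c : Fin n → ℝ) (τ : Traj S A n) (θ : Param d) :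
    HasFDerivAt (weightedScore pol c τ) (weightedScoreDeriv pol c τ θ) θ := by
  unfold weightedScore weightedScoreDeriv
  exact HasFDerivAt.fun_sum fun h _ => (hasFDerivAt_score pol (τ h) θ).const_smul (c h)

theorem continuous_weightedScore (c : Fin n → ℝ) (τ : Traj S A n) :
    Continuous (weightedScore pol c τ) :=
  continuous_finsetSum _ fun h _ => (continuous_score pol (τ h)).const_smul (c h)

theorem continuous_weightedScoreDeriv (c : Fin n → ℝ) (τ : Traj S A n) :
    Continuous (weightedScoreDeriv pol c τ) :=
  continuous_finsetSum _ fun h _ => (continuous_scoreDeriv pol (τ h)).const_smul (c h)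

theorem continuous_totalScore (τ : Traj S A n) : Continuous (totalScore pol τ) :=
  continuous_finsetSum _ fun h _ => continuous_score pol (τ h)

theorem measurable_score_apply (h : Fin n) (θ : Param d) :
    Measurable fun τ : Traj S A n => score pol (τ h) θ :=
  (measurable_score pol θ).comp (measurable_pi_apply h)

theorem measurable_scoreDeriv_apply (h : Fin n) (θ : Param d) :
    Measurable fun τ : Traj S A n => scoreDeriv pol (τ h) θ :=
  (measurable_scoreDeriv pol θ).comp (measurable_pi_apply h)

theorem measurable_totalScore (θ : Param d) :
    Measurable fun τ : Traj S A n => totalScore pol τ θ :=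
  Finset.measurable_sum _ fun h _ => measurable_score_apply pol h θ

theorem measurable_weightedScore {c : Traj S A n → Fin n → ℝ} (hc : ∀ h, Measurable fun τ => c τ h)
    (θ : Param d) : Measurable fun τ => weightedScore pol (c τ) τ θ :=
  Finset.measurable_sum _ fun h _ => (hc h).smul (measurable_score_apply pol h θ)

theorem measurable_weightedScoreDeriv {c : Traj S A n → Fin n → ℝ}
    (hc : ∀ h, Measurable fun τ => c τ h) (θ : Param d) :
    Measurable fun τ => weightedScoreDeriv pol (c τ) τ θ :=
  Finset.measurable_sum _ fun h _ => (hc h).smul (measurable_scoreDeriv_apply pol h θ)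

theorem trajDens_eq_exp (τ : Traj S A n) (θ : Param d) :
    trajDens pol n θ τ = Real.exp (∑ h, logPolicy pol (τ h).1 (τ h).2 θ) := by
  rw [Real.exp_sum, trajDens]
  exact Finset.prod_congr rfl fun h _ => (Real.exp_log (pol.dens_pos _ _ _)).symm

theorem hasDerivAt_trajDens (τ : Traj S A n) (θ v : Param d) (t : ℝ) :
    HasDerivAt (fun t : ℝ => trajDens pol n (θ + t • v) τ)
      (⟪totalScore pol τ (θ + t • v), v⟫ * trajDens pol n (θ + t • v) τ) t := by
  simp only [trajDens_eq_exp]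
  have h1 : HasDerivAt (fun t : ℝ => ∑ h, logPolicy pol (τ h).1 (τ h).2 (θ + t • v))
      (∑ h, ⟪score pol (τ h) (θ + t • v), v⟫) t :=
    HasDerivAt.fun_sum fun h _ => hasDerivAt_comp_line
      ((pol.contDiff_log (τ h).1 (τ h).2).differentiable (by norm_num)) θ v t
  rw [totalScore, sum_inner, mul_comm]
  exact h1.exp

theorem continuous_trajDens (τ : Traj S A n) : Continuous fun θ => trajDens pol n θ τ := by
  simp only [trajDens_eq_exp]
  exact Real.continuous_exp.comp (continuous_finsetSum _ fun h _ =>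
    (pol.contDiff_log (τ h).1 (τ h).2).continuous)

theorem gradient_logTraj (τ : Traj S A n) (θ : Param d) :
    gradient (logTraj pol n τ) θ = totalScore pol τ θ := by
  have h0 : logTraj pol n τ = fun θ => ∑ h, logPolicy pol (τ h).1 (τ h).2 θ := by
    funext θ
    rw [logTraj, Real.log_prod fun h _ => (pol.dens_pos _ _ _).ne']
    rfl
  refine ext_inner_right ℝ fun v => ?_
  have h1 : ∀ h : Fin n, DifferentiableAt ℝ (logPolicy pol (τ h).1 (τ h).2) θ := fun h =>
    (pol.contDiff_log (τ h).1 (τ h).2).differentiable (by norm_num) θ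
  rw [inner_gradient_left, h0, fderiv_fun_sum fun h _ => h1 h]
  simp only [FunLike.coe_sum, Finset.sum_apply, totalScore, sum_inner, score,
    inner_gradient_left]

variable (mdp : MDP S A)

theorem stochGrad_eq (τ : Traj S A n) (θ : Param d) :
    stochGrad mdp pol n τ θ = weightedScore pol (regretToGo mdp n τ) τ θ := rfl

theorem stochHess_eq (τ : Traj S A n) (θ : Param d) :
    stochHess mdp pol n τ θ = weightedScoreDeriv pol (regretToGo mdp n τ) τ θ +
      InnerProductSpace.rankOne ℝ (weightedScore pol (regretToGo mdp n τ) τ θ)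
        (totalScore pol τ θ) := by
  rw [stochHess, gradient_logTraj]
  congr 1
  exact (hasFDerivAt_weightedScore pol _ τ θ).fderiv

theorem measurable_regretToGo (h : Fin n) :
    Measurable fun τ : Traj S A n => regretToGo mdp n τ h :=
  Finset.measurable_sum _ fun i _ =>
    (mdp.measurable_r.comp (measurable_pi_apply i)).const_mul _

theorem sum_Ici_pow_le {γ : ℝ} (h0 : 0 ≤ γ) (h1 : γ < 1) (h : Fin n) :
    ∑ i ∈ Finset.Ici h, γ ^ (i : ℕ) ≤ γ ^ (h : ℕ) / (1 - γ) := by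
  have e : ∑ i ∈ Finset.Ici h, γ ^ (i : ℕ) = ∑ i ∈ (Finset.Ici h).map Fin.valEmbedding, γ ^ i := by
    rw [Finset.sum_map]
    rfl
  rw [e, Fin.map_valEmbedding_Ici, Finset.sum_Ico_eq_sum_range]
  simp_rw [pow_add]
  rw [← Finset.mul_sum, div_eq_mul_inv]
  gcongr
  have := geom_sum_eq h1.ne (n - h)
  rw [this, ← neg_div_neg_eq, inv_eq_one_div]
  rw [neg_sub, neg_sub]
  have : 0 < 1 - γ := by linarith
  gcongr
  linarith [pow_nonneg h0 (n - h)]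

theorem abs_regretToGo_le {R : ℝ} (hR : 0 ≤ R) (hbdd : BoundedRegret mdp R) (τ : Traj S A n)
    (h : Fin n) : |regretToGo mdp n τ h| ≤ R / (1 - mdp.γ) * mdp.γ ^ (h : ℕ) := by
  calc |regretToGo mdp n τ h| ≤ ∑ i ∈ Finset.Ici h, |mdp.γ ^ (i : ℕ) * mdp.r (τ i).1 (τ i).2| :=
        Finset.abs_sum_le_sum_abs _ _
    _ ≤ ∑ i ∈ Finset.Ici h, mdp.γ ^ (i : ℕ) * R := by
        refine Finset.sum_le_sum fun i _ => ?_
        rw [abs_mul, abs_of_nonneg (pow_nonneg mdp.γ_nonneg _)]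
        exact mul_le_mul_of_nonneg_left (hbdd _ _) (pow_nonneg mdp.γ_nonneg _)
    _ ≤ mdp.γ ^ (h : ℕ) / (1 - mdp.γ) * R := by
        rw [← Finset.sum_mul]
        exact mul_le_mul_of_nonneg_right (sum_Ici_pow_le mdp.γ_nonneg mdp.γ_lt_one h) hR
    _ = _ := by ring

end Regularity

/-! ### Moment bounds and derivatives of means under the trajectory law. -/

section Moments

variable {S A : Type*} [MeasurableSpace S] [MeasurableSpace A] {ν : Measure A} {d : ℕ}
  (mdp : MDP S A) (pol : PolicyClass S A ν d)

theorem integrable_of_lintegral_le {T : Type*} [MeasurableSpace T] {m : Measure T} {F : T → ℝ}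
    {c : ℝ} (hF : Measurable F) (h0 : ∀ τ, 0 ≤ F τ) (hc : 0 ≤ c)
    (h : ∫⁻ τ, ENNReal.ofReal (F τ) ∂m ≤ ENNReal.ofReal c) :
    Integrable F m ∧ ∫ τ, F τ ∂m ≤ c := by
  refine ⟨⟨hF.aestronglyMeasurable, ?_⟩, ?_⟩
  · rw [hasFiniteIntegral_iff_ofReal (Filter.Eventually.of_forall h0)]
    exact h.trans_lt ENNReal.ofReal_lt_top
  · rw [integral_eq_lintegral_of_nonneg_ae (Filter.Eventually.of_forall h0)
      hF.aestronglyMeasurable]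
    exact ENNReal.toReal_le_of_le_ofReal hc h

theorem lintegral_le_of_integral_le {T : Type*} [MeasurableSpace T] {m : Measure T} {F : T → ℝ}
    {c : ℝ} (h0 : ∀ τ, 0 ≤ F τ) (hi : Integrable F m) (h : ∫ τ, F τ ∂m ≤ c) :
    ∫⁻ τ, ENNReal.ofReal (F τ) ∂m ≤ ENNReal.ofReal c := by
  rw [← ofReal_integral_eq_lintegral_ofReal hi (Filter.Eventually.of_forall h0)]
  exact ENNReal.ofReal_le_ofReal h

theorem integral_trajLaw (n : ℕ) (θ : Param d) (F : Traj S A n → ℝ) :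
    ∫ τ, F τ ∂(trajLaw mdp pol n θ) =
      ∫ τ, F τ * trajDens pol n θ τ ∂(refMeasure (ν := ν) mdp n) := by
  rw [trajLaw_eq, integral_withDensity_eq_integral_toReal_smul
    (measurable_trajDens pol n θ).ennreal_ofReal (Filter.Eventually.of_forall fun _ =>
      ENNReal.ofReal_lt_top)]
  refine integral_congr_ae (Filter.Eventually.of_forall fun τ => ?_)
  simp only [ENNReal.toReal_ofReal (trajDens_pos pol n θ τ).le, smul_eq_mul]
  ring

theorem integrable_trajLaw_iff (n : ℕ) (θ : Param d) (F : Traj S A n → ℝ) :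
    Integrable F (trajLaw mdp pol n θ) ↔
      Integrable (fun τ => F τ * trajDens pol n θ τ) (refMeasure (ν := ν) mdp n) := by
  rw [trajLaw_eq, integrable_withDensity_iff
    (measurable_trajDens pol n θ).ennreal_ofReal (Filter.Eventually.of_forall fun _ =>
      ENNReal.ofReal_lt_top)]
  simp only [ENNReal.toReal_ofReal (trajDens_pos pol n θ _).le]

theorem lintegral_ofReal_trajLaw (n : ℕ) (θ : Param d) {F : Traj S A n → ℝ} (hF : Measurable F) :
    ∫⁻ τ, ENNReal.ofReal (F τ) ∂(trajLaw mdp pol n θ) =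
      ∫⁻ τ, ENNReal.ofReal (F τ * trajDens pol n θ τ) ∂(refMeasure (ν := ν) mdp n) := by
  rw [trajLaw_eq, lintegral_withDensity_eq_lintegral_mul _
    (measurable_trajDens pol n θ).ennreal_ofReal hF.ennreal_ofReal]
  refine lintegral_congr fun τ => ?_
  rw [Pi.mul_apply, mul_comm, ← ENNReal.ofReal_mul' (trajDens_pos pol n θ τ).le]

variable {G L : ℝ} {n : ℕ}

variable {mdp pol}

theorem ExpectedLipschitzSmooth.score_four (hreg : ExpectedLipschitzSmooth mdp pol n G L)
    (θ : Param d) (h : Fin n) :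
    Integrable (fun τ : Traj S A n => ‖score pol (τ h) θ‖ ^ 4) (trajLaw mdp pol n θ) ∧
      ∫ τ, ‖score pol (τ h) θ‖ ^ 4 ∂(trajLaw mdp pol n θ) ≤ G ^ 4 :=
  integrable_of_lintegral_le ((measurable_score_apply pol h θ).norm.pow_const 4)
    (fun _ => by positivity) (by positivity) (hreg θ h).1

theorem ExpectedLipschitzSmooth.scoreDeriv_two (hreg : ExpectedLipschitzSmooth mdp pol n G L)
    (θ : Param d) (h : Fin n) :
    Integrable (fun τ : Traj S A n => ‖scoreDeriv pol (τ h) θ‖ ^ 2) (trajLaw mdp pol n θ) ∧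
      ∫ τ, ‖scoreDeriv pol (τ h) θ‖ ^ 2 ∂(trajLaw mdp pol n θ) ≤ L ^ 2 :=
  integrable_of_lintegral_le ((measurable_scoreDeriv_apply pol h θ).norm.pow_const 2)
    (fun _ => by positivity) (by positivity) (hreg θ h).2

theorem sq_sum_add_sq_le (a b : Fin n → ℝ) :
    (∑ h, a h + (∑ h, b h) ^ 2) ^ 2 ≤ 2 * n * ∑ h, a h ^ 2 + 2 * n ^ 3 * ∑ h, b h ^ 4 := by
  have h1 : (∑ h, a h) ^ 2 ≤ n * ∑ h, a h ^ 2 := by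
    simpa using sq_sum_le_card_mul_sum_sq (s := Finset.univ) (f := a)
  have h2 : (∑ h, b h) ^ 2 ≤ n * ∑ h, b h ^ 2 := by
    simpa using sq_sum_le_card_mul_sum_sq (s := Finset.univ) (f := b)
  have h3 : (∑ h, b h ^ 2) ^ 2 ≤ n * ∑ h, b h ^ 4 := by
    have := sq_sum_le_card_mul_sum_sq (s := Finset.univ) (f := fun h => b h ^ 2)
    simpa [← pow_mul] using this
  have h4 : ((∑ h, b h) ^ 2) ^ 2 ≤ n ^ 2 * (n * ∑ h, b h ^ 4) := by
    calc _ ≤ (n * ∑ h, b h ^ 2) ^ 2 := by gcongr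
      _ = (n : ℝ) ^ 2 * (∑ h, b h ^ 2) ^ 2 := by ring
      _ ≤ _ := by gcongr
  nlinarith [sq_nonneg (∑ h, a h - (∑ h, b h) ^ 2)]

theorem abs_inner_weightedScoreDeriv_add_le {c : Fin n → ℝ} {D : ℝ} (hc : ∀ h, |c h| ≤ D)
    (τ : Traj S A n) (θ v w : Param d) :
    |⟪weightedScoreDeriv pol c τ θ v, w⟫ + ⟪weightedScore pol c τ θ, w⟫ * ⟪totalScore pol τ θ, v⟫|
      ≤ D * ‖v‖ * ‖w‖ * (∑ h, ‖scoreDeriv pol (τ h) θ‖ + (∑ h, ‖score pol (τ h) θ‖) ^ 2) := by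
  have h1 : ‖weightedScoreDeriv pol c τ θ‖ ≤ D * ∑ h, ‖scoreDeriv pol (τ h) θ‖ := by
    rw [Finset.mul_sum]
    refine (norm_sum_le _ _).trans (Finset.sum_le_sum fun h _ => ?_)
    rw [norm_smul]
    exact mul_le_mul_of_nonneg_right (hc h) (norm_nonneg _)
  have h2 : ‖weightedScore pol c τ θ‖ ≤ D * ∑ h, ‖score pol (τ h) θ‖ := by
    rw [Finset.mul_sum]
    refine (norm_sum_le _ _).trans (Finset.sum_le_sum fun h _ => ?_)
    rw [norm_smul]
    exact mul_le_mul_of_nonneg_right (hc h) (norm_nonneg _)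
  have h3 : ‖totalScore pol τ θ‖ ≤ ∑ h, ‖score pol (τ h) θ‖ := norm_sum_le _ _
  have hs : 0 ≤ ∑ h, ‖score pol (τ h) θ‖ := Finset.sum_nonneg fun _ _ => norm_nonneg _
  calc _ ≤ |⟪weightedScoreDeriv pol c τ θ v, w⟫| +
        |⟪weightedScore pol c τ θ, w⟫| * |⟪totalScore pol τ θ, v⟫| := by
        rw [← abs_mul]; exact abs_add_le _ _
    _ ≤ ‖weightedScoreDeriv pol c τ θ‖ * ‖v‖ * ‖w‖ +
        (‖weightedScore pol c τ θ‖ * ‖w‖) * (‖totalScore pol τ θ‖ * ‖v‖) := by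
        gcongr
        · refine (abs_real_inner_le_norm _ _).trans ?_
          gcongr
          exact ContinuousLinearMap.le_opNorm _ _
        · exact abs_real_inner_le_norm _ _
        · exact abs_real_inner_le_norm _ _
    _ ≤ D * (∑ h, ‖scoreDeriv pol (τ h) θ‖) * ‖v‖ * ‖w‖ +
        (D * (∑ h, ‖score pol (τ h) θ‖) * ‖w‖) * ((∑ h, ‖score pol (τ h) θ‖) * ‖v‖) := by
        gcongr
        exact mul_nonneg ((norm_nonneg _).trans h2) (norm_nonneg _)
    _ = _ := by ring

/-- This is the bound required to differentiate the mean of a weighted score. Its constant is crude;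
only its independence of θ matters. -/
theorem lintegral_weightedScore_sq_le (hreg : ExpectedLipschitzSmooth mdp pol n G L)
    {c : Traj S A n → Fin n → ℝ} {D : ℝ} (hcb : ∀ τ h, |c τ h| ≤ D) (θ v w : Param d) :
    ∫⁻ τ, ENNReal.ofReal ((⟪weightedScoreDeriv pol (c τ) τ θ v, w⟫ +
      ⟪weightedScore pol (c τ) τ θ, w⟫ * ⟪totalScore pol τ θ, v⟫) ^ 2) ∂(trajLaw mdp pol n θ) ≤
      ENNReal.ofReal ((D * ‖v‖ * ‖w‖) ^ 2 * (2 * n * (n * L ^ 2) + 2 * n ^ 3 * (n * G ^ 4))) := by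
  set U : Traj S A n → ℝ := fun τ => (D * ‖v‖ * ‖w‖) ^ 2 *
    (2 * n * ∑ h, ‖scoreDeriv pol (τ h) θ‖ ^ 2 + 2 * n ^ 3 * ∑ h, ‖score pol (τ h) θ‖ ^ 4) with hU
  have hi2 : Integrable (fun τ : Traj S A n => ∑ h, ‖scoreDeriv pol (τ h) θ‖ ^ 2)
      (trajLaw mdp pol n θ) := integrable_finsetSum _ fun h _ => (hreg.scoreDeriv_two θ h).1
  have hi4 : Integrable (fun τ : Traj S A n => ∑ h, ‖score pol (τ h) θ‖ ^ 4)
      (trajLaw mdp pol n θ) := integrable_finsetSum _ fun h _ => (hreg.score_four θ h).1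
  have hUi : Integrable U (trajLaw mdp pol n θ) :=
    ((hi2.const_mul _).add (hi4.const_mul _)).const_mul _
  calc _ ≤ ∫⁻ τ, ENNReal.ofReal (U τ) ∂(trajLaw mdp pol n θ) := by
        refine lintegral_mono fun τ => ENNReal.ofReal_le_ofReal ?_
        have h1 := abs_inner_weightedScoreDeriv_add_le (pol := pol) (hcb τ) τ θ v w
        calc _ ≤ (D * ‖v‖ * ‖w‖ * (∑ h, ‖scoreDeriv pol (τ h) θ‖ +
              (∑ h, ‖score pol (τ h) θ‖) ^ 2)) ^ 2 := by
              rw [← sq_abs]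
              exact pow_le_pow_left₀ (abs_nonneg _) h1 2
          _ ≤ U τ := by
              rw [mul_pow, hU]
              exact mul_le_mul_of_nonneg_left (sq_sum_add_sq_le _ _) (sq_nonneg _)
    _ ≤ _ := by
        refine lintegral_le_of_integral_le (fun τ => by positivity) hUi ?_
        rw [hU, integral_const_mul, integral_add (hi2.const_mul _) (hi4.const_mul _),
          integral_const_mul, integral_const_mul,
          integral_finsetSum _ fun h _ => (hreg.scoreDeriv_two θ h).1,
          integral_finsetSum _ fun h _ => (hreg.score_four θ h).1]
        have e1 : ∑ h : Fin n, ∫ τ, ‖scoreDeriv pol (τ h) θ‖ ^ 2 ∂(trajLaw mdp pol n θ)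
            ≤ n * L ^ 2 := by
          refine (Finset.sum_le_sum fun h _ => (hreg.scoreDeriv_two θ h).2).trans ?_
          simp
        have e2 : ∑ h : Fin n, ∫ τ, ‖score pol (τ h) θ‖ ^ 4 ∂(trajLaw mdp pol n θ)
            ≤ n * G ^ 4 := by
          refine (Finset.sum_le_sum fun h _ => (hreg.score_four θ h).2).trans ?_
          simp
        gcongr

variable [SFinite ν]


/-- The law of a prefix is the trajectory law of the shorter horizon, so arguments by induction on
the horizon inherit the assumption. -/
theorem ExpectedLipschitzSmooth.mono {N : ℕ} (hreg : ExpectedLipschitzSmooth mdp pol N G L)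
    (h : n ≤ N) : ExpectedLipschitzSmooth mdp pol n G L := by
  intro θ i
  rw [← map_trajLaw_castLE mdp pol θ h, lintegral_map _ (measurable_castLE h),
    lintegral_map _ (measurable_castLE h)]
  · exact hreg θ (Fin.castLE h i)
  · exact ((measurable_scoreDeriv_apply pol i θ).norm.pow_const 2).ennreal_ofReal
  · exact ((measurable_score_apply pol i θ).norm.pow_const 4).ennreal_ofReal

theorem ExpectedLipschitzSmooth.score_two (hreg : ExpectedLipschitzSmooth mdp pol n G L)
    (θ : Param d) (h : Fin n) :
    Integrable (fun τ : Traj S A n => ‖score pol (τ h) θ‖ ^ 2) (trajLaw mdp pol n θ) ∧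
      ∫ τ, ‖score pol (τ h) θ‖ ^ 2 ∂(trajLaw mdp pol n θ) ≤ G ^ 2 := by
  obtain ⟨h1, h2⟩ := hreg.score_four θ h
  have hi : Integrable (fun τ : Traj S A n => ‖score pol (τ h) θ‖ ^ 2) (trajLaw mdp pol n θ) := by
    refine (h1.add (integrable_const 1)).mono'
      ((measurable_score_apply pol h θ).norm.pow_const 2).aestronglyMeasurable
      (Filter.Eventually.of_forall fun τ => ?_)
    rw [Real.norm_of_nonneg (by positivity), Pi.add_apply]
    nlinarith [sq_nonneg (‖score pol (τ h) θ‖ ^ 2 - 1)]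
  refine ⟨hi, ?_⟩
  -- The variance of the squared norm is nonnegative, so the square of its mean is at most G⁴.
  have h3 : 0 ≤ ∫ τ, (‖score pol (τ h) θ‖ ^ 2 - ∫ τ, ‖score pol (τ h) θ‖ ^ 2
      ∂(trajLaw mdp pol n θ)) ^ 2 ∂(trajLaw mdp pol n θ) := integral_nonneg fun _ => sq_nonneg _
  set c := ∫ τ, ‖score pol (τ h) θ‖ ^ 2 ∂(trajLaw mdp pol n θ) with hc
  have e : ∀ τ : Traj S A n, (‖score pol (τ h) θ‖ ^ 2 - c) ^ 2 =
      ‖score pol (τ h) θ‖ ^ 4 - (2 * c * ‖score pol (τ h) θ‖ ^ 2 - c ^ 2) := fun τ => by ring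
  simp_rw [e] at h3
  have hi' : Integrable (fun τ : Traj S A n => 2 * c * ‖score pol (τ h) θ‖ ^ 2 - c ^ 2)
      (trajLaw mdp pol n θ) := (hi.const_mul _).sub (integrable_const _)
  rw [integral_sub h1 hi', integral_sub (hi.const_mul _) (integrable_const _), integral_const_mul, ← hc] at h3
  simp only [integral_const, probReal_univ, one_smul] at h3
  exact abs_le_of_sq_le_sq' (by nlinarith : c ^ 2 ≤ (G ^ 2) ^ 2) (sq_nonneg G) |>.2

/-- Differentiation of a mean along a line of parameters. -/
theorem hasDerivAt_mean (θ v : Param d) {f f' : ℝ → Traj S A n → ℝ} {B : ℝ} (hB0 : 0 ≤ B)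
    (hfm : ∀ t, Measurable (f t)) (hfm' : ∀ t, Measurable (f' t))
    (hfc' : ∀ τ, Continuous fun t => f' t τ)
    (hf : ∀ t τ, HasDerivAt (fun t => f t τ) (f' t τ) t)
    (hfi : ∀ t, Integrable (f t) (trajLaw mdp pol n (θ + t • v)))
    (hB : ∀ t, ∫⁻ τ, ENNReal.ofReal ((f' t τ + f t τ * ⟪totalScore pol τ (θ + t • v), v⟫) ^ 2)
      ∂(trajLaw mdp pol n (θ + t • v)) ≤ ENNReal.ofReal B) :
    HasDerivAt (fun t : ℝ => ∫ τ, f t τ ∂(trajLaw mdp pol n (θ + t • v)))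
      (∫ τ, (f' 0 τ + f 0 τ * ⟪totalScore pol τ θ, v⟫) ∂(trajLaw mdp pol n θ)) 0 := by
  have hline : Continuous fun t : ℝ => θ + t • v := by fun_prop
  -- By the product rule and the formula for the derivative of the density, f * p has derivative k *
  -- p.
  set k : ℝ → Traj S A n → ℝ := fun t τ => f' t τ + f t τ * ⟪totalScore pol τ (θ + t • v), v⟫
    with hk
  have hkm : ∀ t, Measurable (k t) := fun t =>
    (hfm' t).add ((hfm t).mul ((measurable_totalScore pol (θ + t • v)).inner measurable_const))
  have := hasDerivAt_integral_of_score (m := refMeasure (ν := ν) mdp n)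
    (p := fun t => trajDens pol n (θ + t • v)) (k := k)
    (f := fun t τ => f t τ * trajDens pol n (θ + t • v) τ) hB0
    (fun t τ => (trajDens_pos pol n _ τ).le) (fun t => measurable_trajDens pol n _)
    (fun t => by
      have := lintegral_ofReal_trajLaw mdp pol n (θ + t • v) (F := fun _ => 1) measurable_const
      simp only [ENNReal.ofReal_one, lintegral_const, measure_univ, one_mul] at this
      exact this.symm)
    (fun τ => (continuous_trajDens pol τ).comp hline) hkm
    (fun τ => (hfc' τ).add ((continuous_iff_continuousAt.2 fun t => (hf t τ).continuousAt).mul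
      (((continuous_totalScore pol τ).comp hline).inner continuous_const)))
    (fun t => by
      rw [← lintegral_ofReal_trajLaw mdp pol n (θ + t • v) ((hkm t).pow_const 2)]
      exact hB t)
    (fun t τ => ((hf t τ).mul (hasDerivAt_trajDens pol τ θ v t)).congr_deriv (by
      simp only [hk]; ring))
    (fun t => (integrable_trajLaw_iff mdp pol n (θ + t • v) (f t)).1 (hfi t)) 0
  simp_rw [integral_trajLaw mdp pol n (θ + _ • v)]
  rw [integral_trajLaw]
  simpa [hk] using this

theorem memLp_score (hreg : ExpectedLipschitzSmooth mdp pol n G L) (θ : Param d) (h : Fin n) :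
    MemLp (fun τ : Traj S A n => score pol (τ h) θ) 2 (trajLaw mdp pol n θ) :=
  (memLp_two_iff_integrable_sq_norm (measurable_score_apply pol h θ).aestronglyMeasurable).2
    (hreg.score_two θ h).1

theorem memLp_weightedScore (hreg : ExpectedLipschitzSmooth mdp pol n G L)
    {c : Traj S A n → Fin n → ℝ} (hc : ∀ h, Measurable fun τ => c τ h) {D : ℝ}
    (hcb : ∀ τ h, |c τ h| ≤ D) (θ : Param d) :
    MemLp (fun τ : Traj S A n => weightedScore pol (c τ) τ θ) 2 (trajLaw mdp pol n θ) := by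
  refine memLp_finsetSum _ fun h _ => ?_
  refine (memLp_score hreg θ h).of_le_mul (c := D)
    ((hc h).smul (measurable_score_apply pol h θ)).aestronglyMeasurable
    (Filter.Eventually.of_forall fun τ => ?_)
  rw [norm_smul]
  exact mul_le_mul_of_nonneg_right (hcb τ h) (norm_nonneg _)

theorem memLp_totalScore (hreg : ExpectedLipschitzSmooth mdp pol n G L) (θ : Param d) :
    MemLp (fun τ : Traj S A n => totalScore pol τ θ) 2 (trajLaw mdp pol n θ) :=
  memLp_finsetSum _ fun h _ => memLp_score hreg θ h

theorem hasDerivAt_mean_weightedScore (hreg : ExpectedLipschitzSmooth mdp pol n G L)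
    {c : Traj S A n → Fin n → ℝ} (hc : ∀ h, Measurable fun τ => c τ h) {D : ℝ}
    (hcb : ∀ τ h, |c τ h| ≤ D) (θ v w : Param d) :
    HasDerivAt (fun t : ℝ => ∫ τ, ⟪weightedScore pol (c τ) τ (θ + t • v), w⟫
        ∂(trajLaw mdp pol n (θ + t • v)))
      (∫ τ, (⟪weightedScoreDeriv pol (c τ) τ θ v, w⟫ +
        ⟪weightedScore pol (c τ) τ θ, w⟫ * ⟪totalScore pol τ θ, v⟫) ∂(trajLaw mdp pol n θ)) 0 := by
  have hline : Continuous fun t : ℝ => θ + t • v := by fun_prop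
  have := hasDerivAt_mean (mdp := mdp) (pol := pol) (n := n) θ v
    (f := fun t τ => ⟪weightedScore pol (c τ) τ (θ + t • v), w⟫)
    (f' := fun t τ => ⟪weightedScoreDeriv pol (c τ) τ (θ + t • v) v, w⟫)
    (B := (D * ‖v‖ * ‖w‖) ^ 2 * (2 * n * (n * L ^ 2) + 2 * n ^ 3 * (n * G ^ 4))) (by positivity)
    (fun t => (measurable_weightedScore pol hc _).inner measurable_const)
    (fun t => ((ContinuousLinearMap.measurable_apply v).comp
      (measurable_weightedScoreDeriv pol hc (θ + t • v))).inner measurable_const)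
    (fun τ => (((continuous_weightedScoreDeriv pol (c τ) τ).comp hline).clm_apply
      continuous_const).inner continuous_const)
    (fun t τ => by
      have h1 : HasDerivAt (fun t : ℝ => θ + t • v) v t := by
        simpa using ((hasDerivAt_id t).smul_const v).const_add θ
      have h2 := (hasFDerivAt_weightedScore pol (c τ) τ (θ + t • v)).comp_hasDerivAt t h1
      simpa using h2.inner ℝ (hasDerivAt_const t w))
    (fun t => ((memLp_weightedScore hreg hc hcb _).inner_const w).integrable (by norm_num))
    (fun t => lintegral_weightedScore_sq_le hreg hcb (θ + t • v) v w)
  simpa using this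

theorem hasDerivAt_mean_const (hreg : ExpectedLipschitzSmooth mdp pol n G L)
    {c : Traj S A n → ℝ} (hc : Measurable c) {D : ℝ} (hcb : ∀ τ, |c τ| ≤ D) (θ v : Param d) :
    HasDerivAt (fun t : ℝ => ∫ τ, c τ ∂(trajLaw mdp pol n (θ + t • v)))
      (∫ τ, c τ * ⟪totalScore pol τ θ, v⟫ ∂(trajLaw mdp pol n θ)) 0 := by
  have hs : ∀ θ : Param d, Integrable (fun τ : Traj S A n => ∑ h, ‖score pol (τ h) θ‖ ^ 2)
      (trajLaw mdp pol n θ) := fun θ => integrable_finsetSum _ fun h _ => (hreg.score_two θ h).1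
  have := hasDerivAt_mean (mdp := mdp) (pol := pol) (n := n) θ v (f := fun _ => c)
    (f' := fun _ _ => 0) (B := (D * ‖v‖) ^ 2 * (n * (n * G ^ 2))) (by positivity)
    (fun _ => hc) (fun _ => measurable_const) (fun _ => continuous_const)
    (fun t τ => hasDerivAt_const t (c τ))
    (fun t => Integrable.of_bound hc.aestronglyMeasurable D (Filter.Eventually.of_forall hcb))
    (fun t => by
      set θ' := θ + t • v
      calc _ ≤ ∫⁻ τ : Traj S A n, ENNReal.ofReal ((D * ‖v‖) ^ 2 *
            (n * ∑ h, ‖score pol (τ h) θ'‖ ^ 2)) ∂(trajLaw mdp pol n θ') := by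
            refine lintegral_mono fun τ => ENNReal.ofReal_le_ofReal ?_
            have h1 : |0 + c τ * ⟪totalScore pol τ θ', v⟫| ≤
                D * ‖v‖ * ∑ h, ‖score pol (τ h) θ'‖ := by
              rw [zero_add, abs_mul]
              calc _ ≤ D * ((∑ h, ‖score pol (τ h) θ'‖) * ‖v‖) := by
                    have hD := (abs_nonneg _).trans (hcb τ)
                    refine mul_le_mul (hcb τ) ((abs_real_inner_le_norm _ _).trans ?_)
                      (abs_nonneg _) hD
                    gcongr
                    exact norm_sum_le _ _
                _ = _ := by ring
            have h2 : (∑ h, ‖score pol (τ h) θ'‖) ^ 2 ≤ n * ∑ h, ‖score pol (τ h) θ'‖ ^ 2 := by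
              simpa using sq_sum_le_card_mul_sum_sq (s := Finset.univ)
                (f := fun h => ‖score pol (τ h) θ'‖)
            calc _ ≤ (D * ‖v‖ * ∑ h, ‖score pol (τ h) θ'‖) ^ 2 := by
                  rw [← sq_abs]
                  exact pow_le_pow_left₀ (abs_nonneg _) h1 2
              _ ≤ _ := by
                  rw [mul_pow]
                  exact mul_le_mul_of_nonneg_left h2 (sq_nonneg _)
        _ ≤ _ := by
            refine lintegral_le_of_integral_le (fun τ => by positivity)
              (((hs θ').const_mul _).const_mul _) ?_
            rw [integral_const_mul, integral_const_mul,
              integral_finsetSum _ fun h _ => (hreg.score_two θ' h).1]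
            gcongr
            refine (Finset.sum_le_sum fun h _ => (hreg.score_two θ' h).2).trans ?_
            simp)
  simpa using this

end Moments

/-! ### Unbiased estimators and the variance of the stochastic gradient. -/

section Unbiased

variable {S A : Type*} [MeasurableSpace S] [MeasurableSpace A] {ν : Measure A} {d : ℕ}
  {mdp : MDP S A} {pol : PolicyClass S A ν d} {n H : ℕ} {G L R : ℝ}

theorem measurable_scoreKernel {c : Traj S A n → Fin n → ℝ} (hc : ∀ h, Measurable fun τ => c τ h)
    (θ v w : Param d) : Measurable fun τ : Traj S A n => ⟪weightedScoreDeriv pol (c τ) τ θ v, w⟫ +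
      ⟪weightedScore pol (c τ) τ θ, w⟫ * ⟪totalScore pol τ θ, v⟫ :=
  (((ContinuousLinearMap.measurable_apply v).comp
      (measurable_weightedScoreDeriv pol hc θ)).inner measurable_const).add
    (((measurable_weightedScore pol hc θ).inner measurable_const).mul
      ((measurable_totalScore pol θ).inner measurable_const))

theorem memLp_scoreKernel (hreg : ExpectedLipschitzSmooth mdp pol n G L)
    {c : Traj S A n → Fin n → ℝ} (hc : ∀ h, Measurable fun τ => c τ h) {D : ℝ}
    (hcb : ∀ τ h, |c τ h| ≤ D) (θ v w : Param d) :
    MemLp (fun τ : Traj S A n => ⟪weightedScoreDeriv pol (c τ) τ θ v, w⟫ +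
      ⟪weightedScore pol (c τ) τ θ, w⟫ * ⟪totalScore pol τ θ, v⟫) 2 (trajLaw mdp pol n θ) := by
  have hm := measurable_scoreKernel (pol := pol) hc θ v w
  exact (memLp_two_iff_integrable_sq hm.aestronglyMeasurable).2
    (integrable_of_lintegral_le (hm.pow_const 2) (fun _ => sq_nonneg _) (by positivity)
      (lintegral_weightedScore_sq_le hreg hcb θ v w)).1

theorem inner_stochHess (τ : Traj S A H) (θ v w : Param d) :
    ⟪stochHess mdp pol H τ θ v, w⟫ = ⟪weightedScoreDeriv pol (regretToGo mdp H τ) τ θ v, w⟫ +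
      ⟪weightedScore pol (regretToGo mdp H τ) τ θ, w⟫ * ⟪totalScore pol τ θ, v⟫ := by
  rw [stochHess_eq, add_apply, inner_add_left, InnerProductSpace.rankOne_apply, inner_smul_left,
    conj_trivial, mul_comm]

/-- The score of the steps up to `i`. -/
def partialScore (pol : PolicyClass S A ν d) (τ : Traj S A H) (i : Fin H) (θ : Param d) : Param d :=
  ∑ h ∈ Finset.Iic i, score pol (τ h) θ

theorem partialScore_eq (τ : Traj S A H) (i : Fin H) (θ : Param d) :
    partialScore pol τ i θ =
      totalScore pol (fun j => τ (Fin.castLE i.isLt j) : Traj S A (i + 1)) θ := by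
  rw [partialScore, totalScore]
  symm
  refine Finset.sum_nbij (Fin.castLE i.isLt) ?_ ?_ ?_ ?_
  · intro j _
    rw [Finset.mem_Iic, Fin.le_def]
    exact Nat.lt_succ_iff.1 j.isLt
  · exact fun a _ b _ h => Fin.castLE_injective _ h
  · intro h hh
    have : (h : ℕ) ≤ i := Fin.le_def.1 (Finset.mem_Iic.1 (Finset.mem_coe.1 hh))
    exact ⟨⟨h, Nat.lt_succ_iff.2 this⟩, by simp, rfl⟩
  · exact fun _ _ => rfl

/-- Exchanging the two summations attaches to each cost only the scores of the actions up to its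
time. This form suits both differentiation cost by cost and the use of uncorrelated scores. -/
theorem stochGrad_eq_sum_partialScore (τ : Traj S A H) (θ : Param d) :
    stochGrad mdp pol H τ θ =
      ∑ i : Fin H, (mdp.γ ^ (i : ℕ) * mdp.r (τ i).1 (τ i).2) • partialScore pol τ i θ := by
  simp only [stochGrad_eq, weightedScore, regretToGo, partialScore, Finset.sum_smul,
    Finset.smul_sum]
  exact Finset.sum_comm' (by simp)

theorem abs_regretToGo_le' (hR : 0 ≤ R) (hbdd : BoundedRegret mdp R) (τ : Traj S A H)
    (h : Fin H) : |regretToGo mdp H τ h| ≤ R / (1 - mdp.γ) := by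
  have hγ : 0 < 1 - mdp.γ := by linarith [mdp.γ_lt_one]
  exact (abs_regretToGo_le mdp hR hbdd τ h).trans
    (mul_le_of_le_one_right (by positivity) (pow_le_one₀ mdp.γ_nonneg mdp.γ_lt_one.le))

theorem memLp_inner_stochHess (hR : 0 ≤ R) (hbdd : BoundedRegret mdp R)
    (hreg : ExpectedLipschitzSmooth mdp pol H G L) (θ v w : Param d) :
    MemLp (fun τ : Traj S A H => ⟪stochHess mdp pol H τ θ v, w⟫) 2 (trajLaw mdp pol H θ) := by
  simp_rw [inner_stochHess]
  exact memLp_scoreKernel hreg (c := regretToGo mdp H) (measurable_regretToGo mdp)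
    (abs_regretToGo_le' hR hbdd) θ v w

variable [SFinite ν]

/-- The score of the last step is orthogonal to the scores of the earlier steps. -/
theorem integral_inner_totalScore_mul_last (hreg : ExpectedLipschitzSmooth mdp pol (n + 1) G L)
    (θ v w : Param d) :
    ∫ τ : Traj S A (n + 1), ⟪totalScore pol (fun j => τ j.castSucc : Traj S A n) θ, w⟫ *
      ⟪score pol (τ (Fin.last n)) θ, v⟫ ∂(trajLaw mdp pol (n + 1) θ) = 0 := by
  have hreg' := hreg.mono n.le_succ
  have hmp : ∀ θ, MeasurePreserving (fun (τ : Traj S A (n + 1)) j => τ j.castSucc)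
      (trajLaw mdp pol (n + 1) θ) (trajLaw mdp pol n θ) := fun θ =>
    ⟨measurable_init n, map_trajLaw_init mdp pol θ n⟩
  -- The weights vanish on the last step only, so this weighted score is a function of the prefix.
  set c : Fin (n + 1) → ℝ := Fin.lastCases 0 fun _ => 1 with hc
  have hcb : ∀ h, |c h| ≤ 1 := by
    intro h
    refine Fin.lastCases ?_ (fun j => ?_) h <;> simp [hc]
  have e1 : ∀ (τ : Traj S A (n + 1)) (θ : Param d), weightedScore pol c τ θ =
      totalScore pol (fun j => τ j.castSucc : Traj S A n) θ := by
    intro τ θ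
    simp [weightedScore, totalScore, Fin.sum_univ_castSucc, hc]
  have e2 : ∀ (τ : Traj S A (n + 1)) (θ : Param d), weightedScoreDeriv pol c τ θ =
      weightedScoreDeriv pol (fun _ => 1) (fun j => τ j.castSucc : Traj S A n) θ := by
    intro τ θ
    simp only [weightedScoreDeriv, Fin.sum_univ_castSucc, hc, Fin.lastCases_castSucc,
      Fin.lastCases_last]
    refine add_eq_left.2 ?_
    ext1 x
    exact zero_smul ℝ _
  have e3 : ∀ (τ : Traj S A (n + 1)) (θ : Param d), totalScore pol τ θ =
      totalScore pol (fun j => τ j.castSucc : Traj S A n) θ + score pol (τ (Fin.last n)) θ := by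
    intro τ θ
    simp [totalScore, Fin.sum_univ_castSucc]
  have h1 := hasDerivAt_mean_weightedScore hreg (c := fun _ => c) (fun _ => measurable_const)
    (fun _ => hcb) θ v w
  have h2 := hasDerivAt_mean_weightedScore hreg' (c := fun _ _ => 1) (fun _ => measurable_const)
    (D := 1) (fun _ _ => by simp) θ v w
  -- Its mean is the same under the laws with n + 1 and with n steps, so the two derivatives at θ
  -- agree. The derivative formulas differ exactly by the covariance with the last score, which is
  -- therefore zero.
  have hfun : ∀ θ : Param d, ∫ τ : Traj S A (n + 1), ⟪weightedScore pol c τ θ, w⟫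
      ∂(trajLaw mdp pol (n + 1) θ) =
      ∫ τ : Traj S A n, ⟪weightedScore pol (fun _ => 1) τ θ, w⟫ ∂(trajLaw mdp pol n θ) := by
    intro θ
    rw [← (hmp θ).map_eq, integral_map (hmp θ).measurable.aemeasurable
      ((measurable_weightedScore pol (fun _ => measurable_const) θ).inner
        measurable_const).aestronglyMeasurable]
    simp only [e1, totalScore_eq_weightedScore]
  simp_rw [hfun] at h1
  have heq := h1.unique h2
  rw [← (hmp θ).map_eq, integral_map (hmp θ).measurable.aemeasurable
    (measurable_scoreKernel (fun _ => measurable_const) θ v w).aestronglyMeasurable,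
    ← sub_eq_zero, ← integral_sub] at heq
  · rw [← heq]
    congr 1
    funext τ
    simp only [e1, e2, ← totalScore_eq_weightedScore]
    rw [e3 τ θ, inner_add_left]
    ring
  · exact (memLp_scoreKernel hreg (c := fun _ => c) (fun _ => measurable_const)
      (fun _ => hcb) θ v w).integrable (by norm_num)
  · exact ((memLp_scoreKernel hreg' (c := fun _ _ => 1) (fun _ => measurable_const)
      (D := 1) (fun _ _ => by simp) θ v w).comp_measurePreserving (hmp θ)).integrable (by norm_num)

theorem inner_eq_sum_basisFun (x y : Param d) : ⟪x, y⟫ =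
    ∑ i, ⟪x, EuclideanSpace.basisFun (Fin d) ℝ i⟫ * ⟪y, EuclideanSpace.basisFun (Fin d) ℝ i⟫ := by
  rw [← (EuclideanSpace.basisFun (Fin d) ℝ).sum_inner_mul_inner x y]
  exact Finset.sum_congr rfl fun i _ => by rw [real_inner_comm _ y]

theorem MemLp.integrable_norm_sq {T : Type*} [MeasurableSpace T] {m : Measure T} {F : T → Param d}
    (h : MemLp F 2 m) : Integrable (fun τ => ‖F τ‖ ^ 2) m :=
  (memLp_two_iff_integrable_sq_norm h.aestronglyMeasurable).1 h

/-- The scores along a trajectory are uncorrelated. -/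
theorem integral_norm_totalScore_sq_le (hreg : ExpectedLipschitzSmooth mdp pol n G L)
    (θ : Param d) :
    ∫ τ : Traj S A n, ‖totalScore pol τ θ‖ ^ 2 ∂(trajLaw mdp pol n θ) ≤ n * G ^ 2 := by
  induction n with
  | zero => simp [totalScore]
  | succ n ih =>
    have hreg' := hreg.mono n.le_succ
    have hmp : MeasurePreserving (fun (τ : Traj S A (n + 1)) j => τ j.castSucc)
        (trajLaw mdp pol (n + 1) θ) (trajLaw mdp pol n θ) :=
      ⟨measurable_init n, map_trajLaw_init mdp pol θ n⟩
    have m1 := (memLp_totalScore hreg' θ).comp_measurePreserving hmp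
    have m2 := memLp_score hreg θ (Fin.last n)
    have hcross : ∀ i, Integrable (fun τ : Traj S A (n + 1) =>
        ⟪totalScore pol (fun j => τ j.castSucc : Traj S A n) θ,
          EuclideanSpace.basisFun (Fin d) ℝ i⟫ *
        ⟪score pol (τ (Fin.last n)) θ, EuclideanSpace.basisFun (Fin d) ℝ i⟫)
        (trajLaw mdp pol (n + 1) θ) := fun i =>
      MemLp.integrable_mul (m1.inner_const _) (m2.inner_const _)
    have hsum : Integrable (fun τ : Traj S A (n + 1) =>
        2 * ∑ i, ⟪totalScore pol (fun j => τ j.castSucc : Traj S A n) θ,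
          EuclideanSpace.basisFun (Fin d) ℝ i⟫ *
        ⟪score pol (τ (Fin.last n)) θ, EuclideanSpace.basisFun (Fin d) ℝ i⟫)
        (trajLaw mdp pol (n + 1) θ) := (integrable_finsetSum _ fun i _ => hcross i).const_mul 2
    have e : ∀ τ : Traj S A (n + 1), ‖totalScore pol τ θ‖ ^ 2 =
        (‖totalScore pol (fun j => τ j.castSucc : Traj S A n) θ‖ ^ 2 +
          ‖score pol (τ (Fin.last n)) θ‖ ^ 2) +
        2 * ∑ i, ⟪totalScore pol (fun j => τ j.castSucc : Traj S A n) θ,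
          EuclideanSpace.basisFun (Fin d) ℝ i⟫ *
        ⟪score pol (τ (Fin.last n)) θ, EuclideanSpace.basisFun (Fin d) ℝ i⟫ := by
      intro τ
      rw [← inner_eq_sum_basisFun]
      have : totalScore pol τ θ = totalScore pol (fun j => τ j.castSucc : Traj S A n) θ +
          score pol (τ (Fin.last n)) θ := by simp [totalScore, Fin.sum_univ_castSucc]
      rw [this, norm_add_sq_real]
      ring
    simp_rw [e]
    have i1 : Integrable (fun τ : Traj S A (n + 1) =>
      ‖totalScore pol (fun j => τ j.castSucc : Traj S A n) θ‖ ^ 2) (trajLaw mdp pol (n + 1) θ) :=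
      MemLp.integrable_norm_sq m1
    have i2 : Integrable (fun τ : Traj S A (n + 1) =>
        ‖totalScore pol (fun j => τ j.castSucc : Traj S A n) θ‖ ^ 2 +
          ‖score pol (τ (Fin.last n)) θ‖ ^ 2) (trajLaw mdp pol (n + 1) θ) :=
      i1.add (hreg.score_two θ (Fin.last n)).1
    -- Pythagoras in mean: the cross term, expanded in coordinates, vanishes.
    rw [integral_add i2 hsum,
      integral_add i1 (hreg.score_two θ (Fin.last n)).1,
      integral_const_mul, integral_finsetSum _ fun i _ => hcross i,
      Finset.sum_eq_zero fun i _ => integral_inner_totalScore_mul_last hreg θ _ _]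
    have h1 := ih hreg'
    rw [← hmp.map_eq, integral_map hmp.measurable.aemeasurable
      ((measurable_totalScore pol θ).norm.pow_const 2).aestronglyMeasurable] at h1
    have h2 := (hreg.score_two θ (Fin.last n)).2
    push_cast
    linarith

theorem integral_norm_partialScore_sq_le (hreg : ExpectedLipschitzSmooth mdp pol H G L)
    (θ : Param d) (i : Fin H) :
    MemLp (fun τ : Traj S A H => partialScore pol τ i θ) 2 (trajLaw mdp pol H θ) ∧
    ∫ τ : Traj S A H, ‖partialScore pol τ i θ‖ ^ 2 ∂(trajLaw mdp pol H θ) ≤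
      ((i : ℕ) + 1 : ℝ) * G ^ 2 := by
  have hreg' := hreg.mono (n := i + 1) i.isLt
  have hmp := measurePreserving_castLE mdp pol θ (n := i + 1) i.isLt
  simp only [partialScore_eq]
  refine ⟨(memLp_totalScore hreg' θ).comp_measurePreserving hmp, ?_⟩
  have h1 := integral_norm_totalScore_sq_le hreg' θ
  rw [← hmp.map_eq, integral_map hmp.measurable.aemeasurable
    ((measurable_totalScore pol θ).norm.pow_const 2).aestronglyMeasurable] at h1
  exact_mod_cast h1

theorem sum_succ_mul_pow_le {γ : ℝ} (h0 : 0 ≤ γ) (h1 : γ < 1) (N : ℕ) :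
    ∑ i ∈ Finset.range N, γ ^ i * ((i : ℝ) + 1) ≤ 1 / (1 - γ) ^ 2 := by
  have h2 : 0 < (1 - γ) ^ 2 := by have : 0 < 1 - γ := by linarith
                                  positivity
  rw [le_div_iff₀ h2]
  have : ∀ N : ℕ, (∑ i ∈ Finset.range N, γ ^ i * ((i : ℝ) + 1)) * (1 - γ) ^ 2 =
      1 - γ ^ N * ((N : ℝ) * (1 - γ) + 1) := by
    intro N
    induction N with
    | zero => simp
    | succ N ih => rw [Finset.sum_range_succ, add_mul, ih]; push_cast; ring
  rw [this]
  have : 0 ≤ γ ^ N * ((N : ℝ) * (1 - γ) + 1) :=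
    mul_nonneg (pow_nonneg h0 _) (by nlinarith [(Nat.cast_nonneg N : (0 : ℝ) ≤ N)])
  linarith

theorem sum_pow_fin_le {γ : ℝ} (h0 : 0 ≤ γ) (h1 : γ < 1) (N : ℕ) :
    ∑ i : Fin N, γ ^ (i : ℕ) ≤ 1 / (1 - γ) := by
  rw [Fin.sum_univ_eq_sum_range fun i => γ ^ i, geom_sum_eq h1.ne, ← neg_div_neg_eq, neg_sub,
    neg_sub]
  have : 0 < 1 - γ := by linarith
  gcongr
  linarith [pow_nonneg h0 N]

theorem sq_sum_pow_mul_le {γ : ℝ} (h0 : 0 ≤ γ) (h1 : γ < 1) (N : ℕ) (x : Fin N → ℝ) :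
    (∑ i : Fin N, γ ^ (i : ℕ) * x i) ^ 2 ≤ 1 / (1 - γ) * ∑ i : Fin N, γ ^ (i : ℕ) * x i ^ 2 := by
  calc _ ≤ (∑ i : Fin N, γ ^ (i : ℕ)) * ∑ i : Fin N, γ ^ (i : ℕ) * x i ^ 2 :=
        Finset.sum_sq_le_sum_mul_sum_of_sq_le_mul _ (fun i _ => pow_nonneg h0 _)
          (fun i _ => mul_nonneg (pow_nonneg h0 _) (sq_nonneg _)) (fun i _ => le_of_eq (by ring))
    _ ≤ _ := mul_le_mul_of_nonneg_right (sum_pow_fin_le h0 h1 N)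
        (Finset.sum_nonneg fun i _ => mul_nonneg (pow_nonneg h0 _) (sq_nonneg _))

theorem memLp_stochGrad (hR : 0 ≤ R) (hbdd : BoundedRegret mdp R)
    (hreg : ExpectedLipschitzSmooth mdp pol H G L) (θ : Param d) :
    MemLp (fun τ : Traj S A H => stochGrad mdp pol H τ θ) 2 (trajLaw mdp pol H θ) := by
  have hγ : 0 < 1 - mdp.γ := by linarith [mdp.γ_lt_one]
  refine memLp_weightedScore hreg (c := regretToGo mdp H) (measurable_regretToGo mdp)
    (D := R / (1 - mdp.γ)) (fun τ h => (abs_regretToGo_le mdp hR hbdd τ h).trans ?_) θ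
  exact mul_le_of_le_one_right (by positivity) (pow_le_one₀ mdp.γ_nonneg mdp.γ_lt_one.le)

/-- The second moment of the stochastic gradient. -/
theorem integral_norm_stochGrad_sq_le (hR : 0 ≤ R) (hbdd : BoundedRegret mdp R)
    (hreg : ExpectedLipschitzSmooth mdp pol H G L) (θ : Param d) :
    ∫ τ : Traj S A H, ‖stochGrad mdp pol H τ θ‖ ^ 2 ∂(trajLaw mdp pol H θ) ≤ gradVar mdp R G := by
  have hγ : 0 < 1 - mdp.γ := by linarith [mdp.γ_lt_one]
  have hγ0 := mdp.γ_nonneg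
  -- Cauchy–Schwarz with weights γ^i costs one factor 1/(1 - γ). The other two come from the sum of
  -- γ^i (i + 1), since the first i + 1 scores have second moment at most (i + 1) G².
  have hpath : ∀ τ : Traj S A H, ‖stochGrad mdp pol H τ θ‖ ^ 2 ≤
      R ^ 2 * (1 / (1 - mdp.γ) * ∑ i : Fin H, mdp.γ ^ (i : ℕ) * ‖partialScore pol τ i θ‖ ^ 2) := by
    intro τ
    have h1 : ‖stochGrad mdp pol H τ θ‖ ≤
        R * ∑ i : Fin H, mdp.γ ^ (i : ℕ) * ‖partialScore pol τ i θ‖ := by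
      rw [stochGrad_eq_sum_partialScore, Finset.mul_sum]
      refine (norm_sum_le _ _).trans (Finset.sum_le_sum fun i _ => ?_)
      rw [norm_smul, norm_mul, Real.norm_of_nonneg (pow_nonneg hγ0 _), Real.norm_eq_abs]
      calc _ ≤ mdp.γ ^ (i : ℕ) * R * ‖partialScore pol τ i θ‖ := by
            gcongr
            exact hbdd _ _
        _ = _ := by ring
    calc _ ≤ (R * ∑ i : Fin H, mdp.γ ^ (i : ℕ) * ‖partialScore pol τ i θ‖) ^ 2 :=
          pow_le_pow_left₀ (norm_nonneg _) h1 2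
      _ ≤ _ := by
          rw [mul_pow]
          exact mul_le_mul_of_nonneg_left (sq_sum_pow_mul_le hγ0 mdp.γ_lt_one _ _) (sq_nonneg _)
  have hi : ∀ i : Fin H, Integrable
      (fun τ : Traj S A H => mdp.γ ^ (i : ℕ) * ‖partialScore pol τ i θ‖ ^ 2) (trajLaw mdp pol H θ) := fun i =>
    (MemLp.integrable_norm_sq (integral_norm_partialScore_sq_le hreg θ i).1).const_mul _
  refine (integral_mono (MemLp.integrable_norm_sq (memLp_stochGrad hR hbdd hreg θ))
    (((integrable_finsetSum _ fun i _ => hi i).const_mul _).const_mul _) hpath).trans ?_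
  rw [integral_const_mul, integral_const_mul, integral_finsetSum _ fun i _ => hi i]
  simp_rw [integral_const_mul]
  have h2 : ∑ i : Fin H, mdp.γ ^ (i : ℕ) * ∫ τ : Traj S A H, ‖partialScore pol τ i θ‖ ^ 2
      ∂(trajLaw mdp pol H θ) ≤ 1 / (1 - mdp.γ) ^ 2 * G ^ 2 := by
    calc _ ≤ ∑ i : Fin H, mdp.γ ^ (i : ℕ) * (((i : ℕ) + 1 : ℝ) * G ^ 2) := by
          gcongr with i
          exact (integral_norm_partialScore_sq_le hreg θ i).2
      _ = (∑ i ∈ Finset.range H, mdp.γ ^ i * ((i : ℝ) + 1)) * G ^ 2 := by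
          rw [Finset.sum_mul, ← Fin.sum_univ_eq_sum_range
            fun i => mdp.γ ^ i * ((i : ℝ) + 1) * G ^ 2]
          exact Finset.sum_congr rfl fun i _ => by ring
      _ ≤ _ := mul_le_mul_of_nonneg_right (sum_succ_mul_pow_le hγ0 mdp.γ_lt_one H) (sq_nonneg _)
  calc _ ≤ R ^ 2 * (1 / (1 - mdp.γ) * (1 / (1 - mdp.γ) ^ 2 * G ^ 2)) := by gcongr
    _ = gradVar mdp R G := by rw [gradVar]; field_simp

/-- The stochastic gradient is unbiased. -/
theorem inner_gradient_objective (hbdd : BoundedRegret mdp R)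
    (hreg : ExpectedLipschitzSmooth mdp pol H G L)
    (hJ : Differentiable ℝ (objective mdp pol H)) (θ v : Param d) :
    ⟪gradient (objective mdp pol H) θ, v⟫ =
      ∫ τ : Traj S A H, ⟪stochGrad mdp pol H τ θ, v⟫ ∂(trajLaw mdp pol H θ) := by
  have hr : ∀ (m : ℕ) (i : Fin m), Measurable fun τ : Traj S A m => mdp.r (τ i).1 (τ i).2 :=
    fun m i => mdp.measurable_r.comp (measurable_pi_apply i)
  have hi : ∀ θ (i : Fin H), Integrable (fun τ : Traj S A H =>
      mdp.γ ^ (i : ℕ) * mdp.r (τ i).1 (τ i).2) (trajLaw mdp pol H θ) := fun θ i =>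
    (Integrable.of_bound (hr H i).aestronglyMeasurable R
      (Filter.Eventually.of_forall fun τ => hbdd _ _)).const_mul _
  -- Each cost is averaged over the law of the trajectory up to its own time, so its derivative
  -- contains no later scores; this produces the cost-to-go weights.
  have hobj : ∀ θ, objective mdp pol H θ = ∑ i : Fin H, mdp.γ ^ (i : ℕ) *
      ∫ τ : Traj S A (i + 1), mdp.r (τ (Fin.last i)).1 (τ (Fin.last i)).2
        ∂(trajLaw mdp pol (i + 1) θ) := by
    intro θ
    simp only [objective, regret]
    rw [integral_finsetSum _ fun i _ => hi θ i]
    refine Finset.sum_congr rfl fun i _ => ?_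
    have hmp := measurePreserving_castLE mdp pol θ (n := i + 1) i.isLt
    rw [integral_const_mul, ← hmp.map_eq, integral_map hmp.measurable.aemeasurable
      (hr _ _).aestronglyMeasurable]
    rfl
  have h1 := hasDerivAt_comp_line hJ θ v 0
  rw [zero_smul, add_zero] at h1
  have h2 : HasDerivAt (fun t : ℝ => objective mdp pol H (θ + t • v)) (∑ i : Fin H,
      mdp.γ ^ (i : ℕ) * ∫ τ : Traj S A (i + 1), mdp.r (τ (Fin.last i)).1 (τ (Fin.last i)).2 *
        ⟪totalScore pol τ θ, v⟫ ∂(trajLaw mdp pol (i + 1) θ)) 0 := by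
    simp_rw [hobj]
    exact HasDerivAt.fun_sum fun i _ => (hasDerivAt_mean_const (hreg.mono i.isLt)
      (hr _ _) (fun τ => hbdd _ _) θ v).const_mul _
  rw [h1.unique h2]
  have hi' : ∀ i : Fin H, Integrable (fun τ : Traj S A H =>
      mdp.γ ^ (i : ℕ) * (mdp.r (τ i).1 (τ i).2 * ⟪partialScore pol τ i θ, v⟫))
      (trajLaw mdp pol H θ) := fun i => by
    refine (Integrable.bdd_mul (c := R) ?_ (hr H i).aestronglyMeasurable
      (Filter.Eventually.of_forall fun τ => hbdd _ _)).const_mul _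
    exact ((integral_norm_partialScore_sq_le hreg θ i).1.inner_const v).integrable (by norm_num)
  have e : ∀ τ : Traj S A H, ⟪stochGrad mdp pol H τ θ, v⟫ = ∑ i : Fin H,
      mdp.γ ^ (i : ℕ) * (mdp.r (τ i).1 (τ i).2 * ⟪partialScore pol τ i θ, v⟫) := by
    intro τ
    rw [stochGrad_eq_sum_partialScore, sum_inner]
    refine Finset.sum_congr rfl fun i _ => ?_
    rw [inner_smul_left, conj_trivial, mul_assoc]
  simp_rw [e]
  rw [integral_finsetSum _ fun i _ => hi' i]
  refine Finset.sum_congr rfl fun i _ => ?_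
  have hmp := measurePreserving_castLE mdp pol θ (n := i + 1) i.isLt
  have hm : Measurable fun τ : Traj S A (i + 1) =>
      mdp.r (τ (Fin.last i)).1 (τ (Fin.last i)).2 * ⟪totalScore pol τ θ, v⟫ :=
    (hr _ _).mul ((measurable_totalScore pol θ).inner measurable_const)
  rw [integral_const_mul, ← hmp.map_eq, integral_map hmp.measurable.aemeasurable
    hm.aestronglyMeasurable]
  simp only [partialScore_eq]
  rfl

/-- The stochastic Hessian is unbiased. -/
theorem inner_hess_objective (hR : 0 ≤ R) (hbdd : BoundedRegret mdp R)
    (hreg : ExpectedLipschitzSmooth mdp pol H G L)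
    (hJ : Differentiable ℝ (objective mdp pol H))
    (hJ' : Differentiable ℝ (gradient (objective mdp pol H))) (θ v w : Param d) :
    ⟪hess (objective mdp pol H) θ v, w⟫ =
      ∫ τ : Traj S A H, ⟪stochHess mdp pol H τ θ v, w⟫ ∂(trajLaw mdp pol H θ) := by
  have h1 : HasDerivAt (fun t : ℝ => ⟪gradient (objective mdp pol H) (θ + t • v), w⟫)
      ⟪hess (objective mdp pol H) θ v, w⟫ 0 := by
    have := (hasDerivAt_gradient_comp_line hJ' θ v 0).inner ℝ (hasDerivAt_const 0 w)
    simpa using this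
  -- The gradient formula holds at every parameter and can be differentiated once more along the
  -- line.
  simp_rw [inner_gradient_objective hbdd hreg hJ] at h1
  have h2 := hasDerivAt_mean_weightedScore hreg (c := regretToGo mdp H) (measurable_regretToGo mdp)
    (D := R / (1 - mdp.γ)) (abs_regretToGo_le' hR hbdd) θ v w
  simp_rw [inner_stochHess]
  exact h1.unique h2

end Unbiased

/-! ### A measurable orthogonal frame of the search plane. -/

section Frame

variable {d : ℕ}

theorem inner_normalized_self (x : Param d) : ⟪‖x‖⁻¹ • x, x⟫ = ‖x‖ := by
  rw [inner_smul_left, real_inner_self_eq_norm_sq, conj_trivial]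
  rcases eq_or_ne ‖x‖ 0 with h | h
  · simp [h]
  · field_simp

theorem norm_smul_normalized (x : Param d) : ‖x‖ • ‖x‖⁻¹ • x = x := by
  rcases eq_or_ne x 0 with h | h
  · simp [h]
  · rw [smul_smul, mul_inv_cancel₀ (norm_ne_zero_iff.2 h), one_smul]

/-- With the convention that the inverse of 0 is 0, this identity holds for zero vectors as well and
replaces ‖e‖ = 1. It spares all distinctions on the dimension of the span. -/
theorem inner_normalized_normalized (x : Param d) :
    ⟪‖x‖⁻¹ • x, ‖x‖⁻¹ • x⟫ • ‖x‖⁻¹ • x = ‖x‖⁻¹ • x := by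
  rcases eq_or_ne x 0 with h | h
  · simp [h]
  · have h' := norm_ne_zero_iff.2 h
    rw [inner_smul_right, inner_normalized_self, inv_mul_cancel₀ h', one_smul]

/-- The Gram–Schmidt orthogonalization of `v` against `g`. -/
def residual (g v : Param d) : Param d := v - ⟪‖g‖⁻¹ • g, v⟫ • ‖g‖⁻¹ • g

/-- The Gram–Schmidt frame of the span of `g` and `v`; its vectors are unit vectors or zero. -/
def frame (g v : Param d) : Fin 2 → Param d :=
  ![‖g‖⁻¹ • g, ‖residual g v‖⁻¹ • residual g v]

theorem inner_normalized_residual (g v : Param d) : ⟪‖g‖⁻¹ • g, residual g v⟫ = 0 := by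
  have h := congrArg (fun x => ⟪x, v⟫) (inner_normalized_normalized g)
  rw [inner_smul_left, conj_trivial] at h
  rw [residual, inner_sub_right, inner_smul_right]
  linarith

theorem inner_frame_frame (g v : Param d) : ⟪frame g v 0, frame g v 1⟫ = 0 := by
  simp only [frame, Matrix.cons_val_zero, Matrix.cons_val_one]
  rw [inner_smul_right, inner_normalized_residual, mul_zero]

theorem inner_self_smul_frame (g v : Param d) (a : Fin 2) :
    ⟪frame g v a, frame g v a⟫ • frame g v a = frame g v a := by
  fin_cases a
  · exact inner_normalized_normalized g
  · exact inner_normalized_normalized (residual g v)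

theorem eq_smul_frame_left (g v : Param d) : g = ‖g‖ • frame g v 0 :=
  (norm_smul_normalized g).symm

theorem eq_smul_frame_right (g v : Param d) :
    v = ⟪frame g v 0, v⟫ • frame g v 0 + ‖residual g v‖ • frame g v 1 := by
  have h : ‖residual g v‖ • frame g v 1 = residual g v := norm_smul_normalized _
  rw [h, residual]
  simp [frame]

theorem frame_mem (g v : Param d) (a : Fin 2) : frame g v a ∈ Submodule.span ℝ {g, v} := by
  have hg : g ∈ Submodule.span ℝ {g, v} := Submodule.subset_span (by simp)
  have hv : v ∈ Submodule.span ℝ {g, v} := Submodule.subset_span (by simp)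
  have hg' := Submodule.smul_mem _ ‖g‖⁻¹ hg
  fin_cases a
  · exact hg'
  · exact Submodule.smul_mem _ _ (Submodule.sub_mem _ hv (Submodule.smul_mem _ _ hg'))

/-- An explicit formula, valid even when g and v are dependent or zero; measurability of the random
projection is read off from it. -/
theorem starProjection_span_pair (g v y : Param d) :
    (Submodule.span ℝ {g, v}).starProjection y = ∑ a, ⟪frame g v a, y⟫ • frame g v a := by
  have hself : ∀ a, ⟪frame g v a, y⟫ * ⟪frame g v a, frame g v a⟫ = ⟪frame g v a, y⟫ := by
    intro a
    conv_rhs => rw [← inner_self_smul_frame g v a, inner_smul_left, conj_trivial]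
    ring
  have h01 := inner_frame_frame g v
  have h10 : ⟪frame g v 1, frame g v 0⟫ = 0 := by rw [real_inner_comm, h01]
  have horth : ∀ a, ⟪y - ∑ b, ⟪frame g v b, y⟫ • frame g v b, frame g v a⟫ = 0 := by
    intro a
    rw [Fin.sum_univ_two, inner_sub_left, inner_add_left, inner_smul_left, inner_smul_left,
      conj_trivial, conj_trivial]
    have := hself a
    fin_cases a <;> simp only [Fin.zero_eta, Fin.mk_one, h01, h10] at this ⊢ <;>
      rw [this, real_inner_comm] <;> ring
  refine Submodule.eq_starProjection_of_mem_of_inner_eq_zero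
    (Submodule.sum_mem _ fun a _ => Submodule.smul_mem _ _ (frame_mem g v a)) fun w hw => ?_
  obtain ⟨p, q, rfl⟩ := Submodule.mem_span_pair.1 hw
  rw [inner_add_right, inner_smul_right, inner_smul_right]
  have e1 : ⟪y - ∑ b, ⟪frame g v b, y⟫ • frame g v b, g⟫ = 0 := by
    rw [congrArg (inner ℝ (y - ∑ b, ⟪frame g v b, y⟫ • frame g v b)) (eq_smul_frame_left g v),
      inner_smul_right, horth, mul_zero]
  have e2 : ⟪y - ∑ b, ⟪frame g v b, y⟫ • frame g v b, v⟫ = 0 := by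
    rw [congrArg (inner ℝ (y - ∑ b, ⟪frame g v b, y⟫ • frame g v b)) (eq_smul_frame_right g v),
      inner_add_right, inner_smul_right, inner_smul_right, horth, horth, mul_zero, mul_zero,
      add_zero]
  rw [e1, e2, mul_zero, mul_zero, add_zero]

theorem sum_inner_frame_sq (g v y : Param d) :
    ∑ a, ⟪frame g v a, y⟫ ^ 2 = ‖(Submodule.span ℝ {g, v}).starProjection y‖ ^ 2 := by
  set E := Submodule.span ℝ {g, v}
  have h : ⟪E.starProjection y, E.starProjection y⟫ = ⟪E.starProjection y, y⟫ := by
    rw [← Submodule.inner_starProjection_left_eq_right,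
      Submodule.starProjection_eq_self_iff.2 (E.starProjection_apply_mem y)]
  rw [← real_inner_self_eq_norm_sq, h, starProjection_span_pair, sum_inner]
  refine Finset.sum_congr rfl fun a _ => ?_
  rw [inner_smul_left, conj_trivial, sq]

/-- Bessel's inequality for the frame. -/
theorem sum_inner_frame_sq_le (g v y : Param d) : ∑ a, ⟪frame g v a, y⟫ ^ 2 ≤ ‖y‖ ^ 2 := by
  rw [sum_inner_frame_sq]
  exact pow_le_pow_left₀ (norm_nonneg _) (Submodule.norm_starProjection_apply_le _ y) 2

theorem norm_frame_le_one (g v : Param d) (a : Fin 2) : ‖frame g v a‖ ≤ 1 := by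
  have h := congrArg norm (inner_self_smul_frame g v a)
  rw [norm_smul, real_inner_self_eq_norm_sq, norm_pow, norm_norm] at h
  by_contra! hc
  nlinarith [mul_pos (mul_pos (zero_lt_one.trans hc) (zero_lt_one.trans hc)) (sub_pos.2 hc)]

/-- The Hilbert–Schmidt norm of the compression of `K` to the span of `g` and `v`. -/
def frameNorm (g v : Param d) (K : Param d →L[ℝ] Param d) : ℝ :=
  √(∑ a, ∑ b, ⟪frame g v a, K (frame g v b)⟫ ^ 2)

theorem frameNorm_nonneg (g v : Param d) (K : Param d →L[ℝ] Param d) : 0 ≤ frameNorm g v K :=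
  Real.sqrt_nonneg _

theorem frameNorm_sq (g v : Param d) (K : Param d →L[ℝ] Param d) :
    frameNorm g v K ^ 2 = ∑ a, ∑ b, ⟪frame g v a, K (frame g v b)⟫ ^ 2 :=
  Real.sq_sqrt (Finset.sum_nonneg fun _ _ => Finset.sum_nonneg fun _ _ => sq_nonneg _)

/-- Cauchy–Schwarz over the four matrix entries, the coefficients of y and z being controlled by
Bessel's inequality. -/
theorem abs_inner_le_frameNorm (g v : Param d) (K : Param d →L[ℝ] Param d) {y z : Param d}
    (hy : y ∈ Submodule.span ℝ {g, v}) (hz : z ∈ Submodule.span ℝ {g, v}) :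
    |⟪y, K z⟫| ≤ frameNorm g v K * ‖y‖ * ‖z‖ := by
  have ey : y = ∑ a, ⟪frame g v a, y⟫ • frame g v a := by
    rw [← starProjection_span_pair, Submodule.starProjection_eq_self_iff.2 hy]
  have ez : z = ∑ a, ⟪frame g v a, z⟫ • frame g v a := by
    rw [← starProjection_span_pair, Submodule.starProjection_eq_self_iff.2 hz]
  have e : ⟪y, K z⟫ = ∑ p : Fin 2 × Fin 2, (⟪frame g v p.1, y⟫ * ⟪frame g v p.2, z⟫) *
      ⟪frame g v p.1, K (frame g v p.2)⟫ := by
    conv_lhs => rw [ey, ez]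
    rw [map_sum, sum_inner, Fintype.sum_prod_type]
    refine Finset.sum_congr rfl fun a _ => ?_
    rw [inner_sum]
    refine Finset.sum_congr rfl fun b _ => ?_
    rw [map_smul, inner_smul_left, inner_smul_right, conj_trivial]
    ring
  have hcs := Finset.sum_mul_sq_le_sq_mul_sq (Finset.univ : Finset (Fin 2 × Fin 2))
    (fun p => ⟪frame g v p.1, y⟫ * ⟪frame g v p.2, z⟫)
    (fun p => ⟪frame g v p.1, K (frame g v p.2)⟫)
  rw [← e, Fintype.sum_prod_type, Fintype.sum_prod_type] at hcs
  simp only [mul_pow, ← Finset.mul_sum, ← Finset.sum_mul] at hcs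
  rw [← frameNorm_sq] at hcs
  refine abs_le_of_sq_le_sq (hcs.trans ?_) (by have := frameNorm_nonneg g v K; positivity)
  calc _ ≤ ‖y‖ ^ 2 * ‖z‖ ^ 2 * frameNorm g v K ^ 2 := by
        gcongr
        · exact sum_inner_frame_sq_le g v y
        · exact sum_inner_frame_sq_le g v z
    _ = _ := by ring

/-- The factor 2 is the number of frame vectors: each image contributes at most ‖K‖² by Bessel's
inequality. -/
theorem sum_inner_frame_apply_sq_le (g v : Param d) (K : Param d →L[ℝ] Param d) :
    ∑ a, ∑ b, ⟪frame g v a, K (frame g v b)⟫ ^ 2 ≤ 2 * ‖K‖ ^ 2 := by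
  rw [Finset.sum_comm]
  calc _ ≤ ∑ _b : Fin 2, ‖K‖ ^ 2 := by
        refine Finset.sum_le_sum fun b _ => (sum_inner_frame_sq_le g v _).trans ?_
        refine pow_le_pow_left₀ (norm_nonneg _) ((K.le_opNorm _).trans ?_) 2
        exact mul_le_of_le_one_right (norm_nonneg _) (norm_frame_le_one g v b)
    _ = _ := by simp

theorem sum_inner_frame_mul_sq_le (g v p q : Param d) :
    ∑ a, ∑ b, (⟪frame g v a, p⟫ * ⟪frame g v b, q⟫) ^ 2 ≤ (‖p‖ * ‖q‖) ^ 2 := by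
  simp only [mul_pow, ← Finset.mul_sum, ← Finset.sum_mul]
  gcongr
  · exact sum_inner_frame_sq_le g v p
  · exact sum_inner_frame_sq_le g v q

theorem measurable_frame {X : Type*} {mX : MeasurableSpace X} {g v : X → Param d} (hg : Measurable g)
    (hv : Measurable v) (a : Fin 2) : Measurable fun x => frame (g x) (v x) a := by
  have h1 : Measurable fun x => ‖g x‖⁻¹ • g x := hg.norm.inv.smul hg
  have h2 : Measurable fun x => residual (g x) (v x) := hv.sub (Measurable.fun_smul (h1.inner hv) h1)
  fin_cases a
  · exact h1
  · exact h2.norm.inv.smul h2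

theorem measurable_clm_apply {X : Type*} {mX : MeasurableSpace X} {K : X → Param d →L[ℝ] Param d}
    {y : X → Param d} (hK : Measurable K) (hy : Measurable y) : Measurable fun x => K x (y x) := by
  have e : ∀ x, K x (y x) = ∑ j, ⟪EuclideanSpace.basisFun (Fin d) ℝ j, y x⟫ •
      K x (EuclideanSpace.basisFun (Fin d) ℝ j) := fun x => by
    conv_lhs => rw [← (EuclideanSpace.basisFun (Fin d) ℝ).sum_repr' (y x), map_sum]
    simp only [map_smul]
  simp only [e]
  exact Finset.measurable_sum _ fun j _ => Measurable.fun_smul (measurable_const.inner hy)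
    ((ContinuousLinearMap.measurable_apply _).comp hK)

theorem measurable_frameNorm {X : Type*} {mX : MeasurableSpace X} {g v : X → Param d}
    {K : X → Param d →L[ℝ] Param d} (hg : Measurable g) (hv : Measurable v) (hK : Measurable K) :
    Measurable fun x => frameNorm (g x) (v x) (K x) := by
  refine Measurable.sqrt (Finset.measurable_sum _ fun a _ => Finset.measurable_sum _ fun b _ => ?_)
  exact ((measurable_frame hg hv a).inner (measurable_clm_apply hK (measurable_frame hg hv b))).pow_const 2

theorem measurable_projected {X : Type*} {mX : MeasurableSpace X} {g v : X → Param d}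
    {K : X → Param d →L[ℝ] Param d} (hg : Measurable g) (hv : Measurable v) (hK : Measurable K) :
    Measurable fun x => projected (g x) (v x) (K x) := by
  refine measurable_clm fun y => ?_
  have hP : ∀ y : X → Param d, Measurable y → Measurable fun x =>
      (Submodule.span ℝ {g x, v x}).starProjection (y x) := by
    intro y hy
    simp only [starProjection_span_pair]
    exact Finset.measurable_sum _ fun a _ =>
      Measurable.fun_smul ((measurable_frame hg hv a).inner hy) (measurable_frame hg hv a)
  have h := hP _ (measurable_clm_apply hK (hP (fun _ => y) measurable_const))
  exact h

end Frame

/-! ### Second moment of the stochastic Hessian on a plane. -/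

section HessMoments

variable {d : ℕ}

theorem inner_hess_comm {f : Param d → ℝ} (hf : Differentiable ℝ f)
    (hf' : Differentiable ℝ (gradient f)) (x v w : Param d) :
    ⟪hess f x v, w⟫ = ⟪v, hess f x w⟫ := by
  have h := second_derivative_symmetric (𝕜 := ℝ) (f := f) (f' := fun y => innerSL ℝ (gradient f y))
    (f'' := (innerSL ℝ).comp (hess f x)) (x := x)
    (fun y => by
      have e : innerSL ℝ (gradient f y) = fderiv ℝ f y :=
        ContinuousLinearMap.ext fun z => inner_gradient_left y z
      exact e ▸ (hf y).hasFDerivAt)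
    ((innerSL ℝ).hasFDerivAt.comp x (hf' x).hasFDerivAt) v w
  simpa [real_inner_comm] using h

variable {S A : Type*} [MeasurableSpace S] [MeasurableSpace A] {ν : Measure A}
  {mdp : MDP S A} {pol : PolicyClass S A ν d} {H : ℕ} {G L R : ℝ}

/-- The symmetrized bilinear form of the stochastic Hessian. -/
def symForm (mdp : MDP S A) (pol : PolicyClass S A ν d) (τ : Traj S A H) (θ v w : Param d) : ℝ :=
  (⟪v, stochHess mdp pol H τ θ w⟫ + ⟪w, stochHess mdp pol H τ θ v⟫) / 2

theorem sum_pow_four_le {n : ℕ} (b : Fin n → ℝ) : (∑ h, b h) ^ 4 ≤ n ^ 3 * ∑ h, b h ^ 4 := by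
  have h2 : (∑ h, b h) ^ 2 ≤ n * ∑ h, b h ^ 2 := by
    simpa using sq_sum_le_card_mul_sum_sq (s := Finset.univ) (f := b)
  have h3 : (∑ h, b h ^ 2) ^ 2 ≤ n * ∑ h, b h ^ 4 := by
    have := sq_sum_le_card_mul_sum_sq (s := Finset.univ) (f := fun h => b h ^ 2)
    simpa [← pow_mul] using this
  calc _ = ((∑ h, b h) ^ 2) ^ 2 := by ring
    _ ≤ (n * ∑ h, b h ^ 2) ^ 2 := by gcongr
    _ = (n : ℝ) ^ 2 * (∑ h, b h ^ 2) ^ 2 := by ring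
    _ ≤ (n : ℝ) ^ 2 * (n * ∑ h, b h ^ 4) := by gcongr
    _ = _ := by ring

theorem norm_weightedScoreDeriv_sq_le (hR : 0 ≤ R) (hbdd : BoundedRegret mdp R) (τ : Traj S A H)
    (θ : Param d) : ‖weightedScoreDeriv pol (regretToGo mdp H τ) τ θ‖ ^ 2 ≤
      R ^ 2 / (1 - mdp.γ) ^ 3 * ∑ h : Fin H, mdp.γ ^ (h : ℕ) * ‖scoreDeriv pol (τ h) θ‖ ^ 2 := by
  have hγ : 0 < 1 - mdp.γ := by linarith [mdp.γ_lt_one]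
  have h1 : ‖weightedScoreDeriv pol (regretToGo mdp H τ) τ θ‖ ≤
      R / (1 - mdp.γ) * ∑ h : Fin H, mdp.γ ^ (h : ℕ) * ‖scoreDeriv pol (τ h) θ‖ := by
    rw [weightedScoreDeriv, Finset.mul_sum]
    refine (norm_sum_le _ _).trans (Finset.sum_le_sum fun h _ => ?_)
    rw [norm_smul, Real.norm_eq_abs, ← mul_assoc]
    exact mul_le_mul_of_nonneg_right (abs_regretToGo_le mdp hR hbdd τ h) (norm_nonneg _)
  calc _ ≤ (R / (1 - mdp.γ) * ∑ h : Fin H, mdp.γ ^ (h : ℕ) * ‖scoreDeriv pol (τ h) θ‖) ^ 2 :=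
        pow_le_pow_left₀ (norm_nonneg _) h1 2
    _ ≤ (R / (1 - mdp.γ)) ^ 2 * (1 / (1 - mdp.γ) *
          ∑ h : Fin H, mdp.γ ^ (h : ℕ) * ‖scoreDeriv pol (τ h) θ‖ ^ 2) := by
        rw [mul_pow]
        exact mul_le_mul_of_nonneg_left (sq_sum_pow_mul_le mdp.γ_nonneg mdp.γ_lt_one _ _)
          (sq_nonneg _)
    _ = _ := by field_simp

theorem norm_weightedScore_mul_sq_le (hR : 0 ≤ R) (hbdd : BoundedRegret mdp R) (τ : Traj S A H)
    (θ : Param d) :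
    (‖weightedScore pol (regretToGo mdp H τ) τ θ‖ * ‖totalScore pol τ θ‖) ^ 2 ≤
      (R / (1 - mdp.γ)) ^ 2 * ((H : ℝ) ^ 3 * ∑ h : Fin H, ‖score pol (τ h) θ‖ ^ 4) := by
  have hγ : 0 < 1 - mdp.γ := by linarith [mdp.γ_lt_one]
  have h1 : ‖weightedScore pol (regretToGo mdp H τ) τ θ‖ ≤
      R / (1 - mdp.γ) * ∑ h : Fin H, ‖score pol (τ h) θ‖ := by
    rw [weightedScore, Finset.mul_sum]
    refine (norm_sum_le _ _).trans (Finset.sum_le_sum fun h _ => ?_)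
    rw [norm_smul, Real.norm_eq_abs]
    exact mul_le_mul_of_nonneg_right (abs_regretToGo_le' hR hbdd τ h) (norm_nonneg _)
  have h2 : ‖totalScore pol τ θ‖ ≤ ∑ h : Fin H, ‖score pol (τ h) θ‖ := norm_sum_le _ _
  calc _ ≤ (R / (1 - mdp.γ) * (∑ h : Fin H, ‖score pol (τ h) θ‖) *
        ∑ h : Fin H, ‖score pol (τ h) θ‖) ^ 2 := by
        refine pow_le_pow_left₀ (by positivity) (mul_le_mul h1 h2 (norm_nonneg _) ?_) 2
        exact (norm_nonneg _).trans h1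
    _ = (R / (1 - mdp.γ)) ^ 2 * (∑ h : Fin H, ‖score pol (τ h) θ‖) ^ 4 := by ring
    _ ≤ _ := mul_le_mul_of_nonneg_left (sum_pow_four_le _) (sq_nonneg _)

/-- The derivative part has squared Hilbert–Schmidt norm at most 2 ‖D‖² on the plane, while the
rank-one part does not lose this factor. The splitting (x + y)² ≤ (3/2) x² + 3 y² balances them to a
common factor 3, and symmetrization does not increase the sum. -/
theorem sum_symForm_frame_sq_le (τ : Traj S A H) (θ g v : Param d) :
    ∑ a, ∑ b, symForm mdp pol τ θ (frame g v a) (frame g v b) ^ 2 ≤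
      3 * (‖weightedScoreDeriv pol (regretToGo mdp H τ) τ θ‖ ^ 2 +
        (‖weightedScore pol (regretToGo mdp H τ) τ θ‖ * ‖totalScore pol τ θ‖) ^ 2) := by
  set D := weightedScoreDeriv pol (regretToGo mdp H τ) τ θ
  set p := weightedScore pol (regretToGo mdp H τ) τ θ
  set q := totalScore pol τ θ
  have h1 := sum_inner_frame_apply_sq_le g v D
  have h2 := sum_inner_frame_mul_sq_le g v p q
  set X : Fin 2 → Fin 2 → ℝ := fun a b => 3 / 2 * ⟪frame g v a, D (frame g v b)⟫ ^ 2 +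
    3 * (⟪frame g v a, p⟫ * ⟪frame g v b, q⟫) ^ 2 with hX
  have hpt : ∀ a b, symForm mdp pol τ θ (frame g v a) (frame g v b) ^ 2 ≤
      1 / 2 * X a b + 1 / 2 * X b a := by
    intro a b
    have key : ∀ a b, ⟪frame g v a, stochHess mdp pol H τ θ (frame g v b)⟫ ^ 2 ≤ X a b := by
      intro a b
      rw [real_inner_comm, inner_stochHess, hX, real_inner_comm _ (D _), real_inner_comm _ p,
        real_inner_comm _ q]
      nlinarith [sq_nonneg (⟪frame g v a, D (frame g v b)⟫ -
        2 * (⟪frame g v a, p⟫ * ⟪frame g v b, q⟫))]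
    have k1 := key a b
    have k2 := key b a
    rw [symForm]
    nlinarith [sq_nonneg (⟪frame g v a, stochHess mdp pol H τ θ (frame g v b)⟫ -
      ⟪frame g v b, stochHess mdp pol H τ θ (frame g v a)⟫)]
  calc _ ≤ ∑ a, ∑ b, (1 / 2 * X a b + 1 / 2 * X b a) :=
        Finset.sum_le_sum fun a _ => Finset.sum_le_sum fun b _ => hpt a b
    _ = 3 / 2 * (∑ a, ∑ b, ⟪frame g v a, D (frame g v b)⟫ ^ 2) +
        3 * ∑ a, ∑ b, (⟪frame g v a, p⟫ * ⟪frame g v b, q⟫) ^ 2 := by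
        simp only [hX, Fin.sum_univ_two]
        ring
    _ ≤ _ := by linarith

theorem memLp_symForm (hR : 0 ≤ R) (hbdd : BoundedRegret mdp R)
    (hreg : ExpectedLipschitzSmooth mdp pol H G L) (θ v w : Param d) :
    MemLp (fun τ : Traj S A H => symForm mdp pol τ θ v w) 2 (trajLaw mdp pol H θ) := by
  have h := ((memLp_inner_stochHess hR hbdd hreg θ w v).add
    (memLp_inner_stochHess hR hbdd hreg θ v w)).const_mul (1 / 2)
  refine h.ae_eq (Filter.Eventually.of_forall fun τ => ?_)
  simp only [symForm, Pi.add_apply]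
  rw [real_inner_comm v, real_inner_comm w]
  ring

/-- The second moment of the compression of the stochastic Hessian to a plane. -/
theorem sum_integral_symForm_sq_le (hR : 0 ≤ R) (hbdd : BoundedRegret mdp R)
    (hreg : ExpectedLipschitzSmooth mdp pol H G L) (θ g v : Param d) :
    ∑ a, ∑ b, ∫ τ : Traj S A H, symForm mdp pol τ θ (frame g v a) (frame g v b) ^ 2
      ∂(trajLaw mdp pol H θ) ≤ 3 * hessVar mdp H R G L := by
  have hγ : 0 < 1 - mdp.γ := by linarith [mdp.γ_lt_one]
  have hγ0 := mdp.γ_nonneg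
  have hi : ∀ a b, Integrable (fun τ : Traj S A H =>
      symForm mdp pol τ θ (frame g v a) (frame g v b) ^ 2) (trajLaw mdp pol H θ) := fun a b =>
    (memLp_symForm hR hbdd hreg θ _ _).integrable_sq
  have hi2 : ∀ h : Fin H, Integrable (fun τ : Traj S A H =>
      mdp.γ ^ (h : ℕ) * ‖scoreDeriv pol (τ h) θ‖ ^ 2) (trajLaw mdp pol H θ) := fun h =>
    (hreg.scoreDeriv_two θ h).1.const_mul _
  have hi4 : ∀ h : Fin H, Integrable (fun τ : Traj S A H =>
      ‖score pol (τ h) θ‖ ^ 4) (trajLaw mdp pol H θ) := fun h => (hreg.score_four θ h).1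
  have hs2 : Integrable (fun τ : Traj S A H => R ^ 2 / (1 - mdp.γ) ^ 3 * ∑ h : Fin H,
      mdp.γ ^ (h : ℕ) * ‖scoreDeriv pol (τ h) θ‖ ^ 2) (trajLaw mdp pol H θ) :=
    (integrable_finsetSum _ fun h _ => hi2 h).const_mul _
  have hs4 : Integrable (fun τ : Traj S A H => (R / (1 - mdp.γ)) ^ 2 * ((H : ℝ) ^ 3 *
      ∑ h : Fin H, ‖score pol (τ h) θ‖ ^ 4)) (trajLaw mdp pol H θ) :=
    ((integrable_finsetSum _ fun h _ => hi4 h).const_mul _).const_mul _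
  have hs : Integrable (fun τ : Traj S A H => 3 * (R ^ 2 / (1 - mdp.γ) ^ 3 * (∑ h : Fin H,
      mdp.γ ^ (h : ℕ) * ‖scoreDeriv pol (τ h) θ‖ ^ 2) + (R / (1 - mdp.γ)) ^ 2 * ((H : ℝ) ^ 3 *
      ∑ h : Fin H, ‖score pol (τ h) θ‖ ^ 4))) (trajLaw mdp pol H θ) := (hs2.add hs4).const_mul _
  simp_rw [← integral_finsetSum Finset.univ fun b _ => hi _ b]
  rw [← integral_finsetSum Finset.univ fun a _ => integrable_finsetSum _ fun b _ => hi a b]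
  refine (integral_mono (integrable_finsetSum _ fun a _ => integrable_finsetSum _ fun b _ => hi a b)
    hs fun τ => (sum_symForm_frame_sq_le τ θ g v).trans ?_).trans ?_
  · have h1 := norm_weightedScoreDeriv_sq_le (pol := pol) hR hbdd τ θ
    have h2 := norm_weightedScore_mul_sq_le (pol := pol) hR hbdd τ θ
    linarith
  · rw [integral_const_mul, integral_add hs2 hs4, integral_const_mul, integral_const_mul,
      integral_const_mul, integral_finsetSum _ fun h _ => hi2 h,
      integral_finsetSum _ fun h _ => hi4 h]
    simp_rw [integral_const_mul]
    have e4 : ∑ h : Fin H, ∫ τ, ‖score pol (τ h) θ‖ ^ 4 ∂(trajLaw mdp pol H θ) ≤ H * G ^ 4 := by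
      refine (Finset.sum_le_sum fun h _ => (hreg.score_four θ h).2).trans ?_
      simp
    have e2 : ∑ h : Fin H, mdp.γ ^ (h : ℕ) * ∫ τ, ‖scoreDeriv pol (τ h) θ‖ ^ 2
        ∂(trajLaw mdp pol H θ) ≤ 1 / (1 - mdp.γ) * L ^ 2 := by
      calc _ ≤ ∑ h : Fin H, mdp.γ ^ (h : ℕ) * L ^ 2 := by
            gcongr with h
            exact (hreg.scoreDeriv_two θ h).2
        _ = (∑ h : Fin H, mdp.γ ^ (h : ℕ)) * L ^ 2 := by rw [Finset.sum_mul]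
        _ ≤ _ := by
            gcongr
            exact sum_pow_fin_le hγ0 mdp.γ_lt_one H
    calc _ ≤ 3 * (R ^ 2 / (1 - mdp.γ) ^ 3 * (1 / (1 - mdp.γ) * L ^ 2) +
          (R / (1 - mdp.γ)) ^ 2 * ((H : ℝ) ^ 3 * (H * G ^ 4))) := by gcongr
      _ = _ := by
        rw [hessVar]
        field_simp
        ring

end HessMoments

/-! ### Mean square errors of the batches. -/

section Batches

/-- The mean square error of a sample mean. -/
theorem integral_pi_mean_sub_sq_le {T : Type*} [MeasurableSpace T] {m : Measure T}
    [IsProbabilityMeasure m] {X : T → ℝ} (hX : MemLp X 2 m) {N : ℕ} (hN : 0 < N) :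
    Integrable (fun B : Fin N → T => ((N : ℝ)⁻¹ * ∑ i, X (B i) - ∫ x, X x ∂m) ^ 2)
      (Measure.pi fun _ => m) ∧
    ∫ B : Fin N → T, ((N : ℝ)⁻¹ * ∑ i, X (B i) - ∫ x, X x ∂m) ^ 2 ∂(Measure.pi fun _ => m) ≤
      (∫ x, X x ^ 2 ∂m) / N := by
  have hN' : (N : ℝ) ≠ 0 := Nat.cast_ne_zero.2 hN.ne'
  have hmp : ∀ i : Fin N, MeasurePreserving (Function.eval i) (Measure.pi fun _ : Fin N => m) m :=
    fun i => measurePreserving_eval _ i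
  have hXi : ∀ i : Fin N, MemLp (fun B : Fin N → T => X (B i)) 2 (Measure.pi fun _ => m) :=
    fun i => hX.comp_measurePreserving (hmp i)
  set Y : (Fin N → T) → ℝ := ∑ i, fun B => X (B i) with hY
  have hYm : MemLp Y 2 (Measure.pi fun _ => m) := memLp_finsetSum' _ fun i _ => hXi i
  have hYa : ∀ B, ∑ i, X (B i) = Y B := fun B => by simp [hY]
  have hmean : ∫ B, Y B ∂(Measure.pi fun _ => m) = N * ∫ x, X x ∂m := by
    simp only [hY, Finset.sum_apply]
    rw [integral_finsetSum _ fun i _ => (hXi i).integrable (by norm_num)]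
    have : ∀ i : Fin N, ∫ B : Fin N → T, X (B i) ∂(Measure.pi fun _ => m) = ∫ x, X x ∂m := by
      intro i
      conv_rhs => rw [← (hmp i).map_eq]
      rw [integral_map (hmp i).measurable.aemeasurable
        (by rw [(hmp i).map_eq]; exact hX.aestronglyMeasurable)]
    simp [this]
  have hpt : ∀ B, ((N : ℝ)⁻¹ * ∑ i, X (B i) - ∫ x, X x ∂m) ^ 2 =
      ((N : ℝ)⁻¹) ^ 2 * (Y B - ∫ B, Y B ∂(Measure.pi fun _ => m)) ^ 2 := by
    intro B
    rw [hmean, hYa]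
    field_simp
  have hYc : MemLp (fun B => Y B - ∫ B, Y B ∂(Measure.pi fun _ => m)) 2 (Measure.pi fun _ => m) :=
    hYm.sub (memLp_const _)
  simp_rw [hpt]
  refine ⟨hYc.integrable_sq.const_mul _, ?_⟩
  rw [integral_const_mul, ← variance_eq_integral hYm.aestronglyMeasurable.aemeasurable, hY,
    variance_sum_pi fun _ => hX]
  have hv : Var[X; m] ≤ ∫ x, X x ^ 2 ∂m := variance_le_expectation_sq hX.aestronglyMeasurable
  simp only [Finset.sum_const, Finset.card_univ, Fintype.card_fin, nsmul_eq_mul]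
  rw [div_eq_inv_mul]
  calc _ = (N : ℝ)⁻¹ * Var[X; m] := by field_simp
    _ ≤ _ := by gcongr

variable {d : ℕ} {S A : Type*} [MeasurableSpace S] [MeasurableSpace A] {ν : Measure A}
  {mdp : MDP S A} {pol : PolicyClass S A ν d} {H N : ℕ} {G L R : ℝ}

theorem norm_sq_eq_sum_basisFun (x : Param d) :
    ‖x‖ ^ 2 = ∑ i, ⟪x, EuclideanSpace.basisFun (Fin d) ℝ i⟫ ^ 2 := by
  rw [← real_inner_self_eq_norm_sq, inner_eq_sum_basisFun]
  exact Finset.sum_congr rfl fun i _ => (sq _).symm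

theorem inner_batchHess_comm (B : Fin N → Traj S A H) (θ v w : Param d) :
    ⟪batchHess mdp pol H B θ v, w⟫ = ⟪v, batchHess mdp pol H B θ w⟫ := by
  simp only [batchHess, smul_apply, add_apply, inner_smul_left, inner_smul_right, inner_add_left,
    inner_add_right, ContinuousLinearMap.adjoint_inner_left,
    ContinuousLinearMap.adjoint_inner_right, conj_trivial]
  ring

theorem inner_batchHess (B : Fin N → Traj S A H) (θ v w : Param d) :
    ⟪v, batchHess mdp pol H B θ w⟫ = (N : ℝ)⁻¹ * ∑ i, symForm mdp pol (B i) θ v w := by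
  simp only [batchHess, smul_apply, add_apply, inner_smul_left, inner_smul_right,
    inner_add_right, sum_apply, ContinuousLinearMap.adjoint_inner_right, conj_trivial, sum_inner, inner_sum, symForm]
  rw [← mul_add, ← Finset.sum_add_distrib, ← Finset.sum_div]
  simp only [real_inner_comm w]
  ring

variable [SFinite ν]

/-- The error is summed coordinate by coordinate, so the variances recombine to the second moment of
the norm without a dimensional factor. -/
theorem lintegral_batchGrad_sub_sq_le (hR : 0 ≤ R) (hbdd : BoundedRegret mdp R)
    (hreg : ExpectedLipschitzSmooth mdp pol H G L)
    (hJ : Differentiable ℝ (objective mdp pol H)) (hN : 0 < N) (θ : Param d) :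
    ∫⁻ B : Fin N → Traj S A H, ENNReal.ofReal
      (‖gradient (objective mdp pol H) θ - batchGrad mdp pol H B θ‖ ^ 2)
      ∂(Measure.pi fun _ => trajLaw mdp pol H θ) ≤ ENNReal.ofReal (gradVar mdp R G / N) := by
  set e := EuclideanSpace.basisFun (Fin d) ℝ
  have hmem : ∀ j, MemLp (fun τ : Traj S A H => ⟪stochGrad mdp pol H τ θ, e j⟫) 2
      (trajLaw mdp pol H θ) := fun j => (memLp_stochGrad hR hbdd hreg θ).inner_const _
  have hpt : ∀ B : Fin N → Traj S A H,
      ‖gradient (objective mdp pol H) θ - batchGrad mdp pol H B θ‖ ^ 2 = ∑ j,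
        ((N : ℝ)⁻¹ * ∑ i, ⟪stochGrad mdp pol H (B i) θ, e j⟫ -
          ∫ τ, ⟪stochGrad mdp pol H τ θ, e j⟫ ∂(trajLaw mdp pol H θ)) ^ 2 := by
    intro B
    rw [norm_sub_rev, norm_sq_eq_sum_basisFun]
    refine Finset.sum_congr rfl fun j _ => ?_
    rw [← inner_gradient_objective hbdd hreg hJ, inner_sub_left, batchGrad, inner_smul_left,
      sum_inner, conj_trivial]
  simp_rw [hpt]
  refine lintegral_le_of_integral_le (fun B => Finset.sum_nonneg fun _ _ => sq_nonneg _)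
    (integrable_finsetSum _ fun j _ => (integral_pi_mean_sub_sq_le (hmem j) hN).1) ?_
  rw [integral_finsetSum _ fun j _ => (integral_pi_mean_sub_sq_le (hmem j) hN).1]
  refine (Finset.sum_le_sum fun j _ => (integral_pi_mean_sub_sq_le (hmem j) hN).2).trans ?_
  rw [← Finset.sum_div, ← integral_finsetSum _ fun j _ => (hmem j).integrable_sq]
  simp_rw [e, ← norm_sq_eq_sum_basisFun]
  gcongr
  exact integral_norm_stochGrad_sq_le hR hbdd hreg θ

/-- On a plane fixed before the batch is drawn, the squared error is a sum of four variances of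
sample means. The dimension of the parameter space plays no role. -/
theorem lintegral_frameNorm_batchHess_sub_sq_le (hR : 0 ≤ R) (hbdd : BoundedRegret mdp R)
    (hreg : ExpectedLipschitzSmooth mdp pol H G L)
    (hJ : Differentiable ℝ (objective mdp pol H))
    (hJ' : Differentiable ℝ (gradient (objective mdp pol H))) (hN : 0 < N) (θ g v : Param d) :
    ∫⁻ B : Fin N → Traj S A H, ENNReal.ofReal
      (frameNorm g v (hess (objective mdp pol H) θ - batchHess mdp pol H B θ) ^ 2)
      ∂(Measure.pi fun _ => trajLaw mdp pol H θ) ≤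
        ENNReal.ofReal (3 * hessVar mdp H R G L / N) := by
  have hmean : ∀ x y : Param d, ∫ τ : Traj S A H, symForm mdp pol τ θ x y
      ∂(trajLaw mdp pol H θ) = ⟪x, hess (objective mdp pol H) θ y⟫ := by
    intro x y
    have i1 : ∀ x y : Param d, Integrable (fun τ : Traj S A H => ⟪x, stochHess mdp pol H τ θ y⟫)
        (trajLaw mdp pol H θ) := fun x y => by
      simp_rw [real_inner_comm _ x]
      exact (memLp_inner_stochHess hR hbdd hreg θ y x).integrable (by norm_num)
    have e1 : ∀ x y : Param d, ∫ τ : Traj S A H, ⟪x, stochHess mdp pol H τ θ y⟫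
        ∂(trajLaw mdp pol H θ) = ⟪x, hess (objective mdp pol H) θ y⟫ := fun x y => by
      simp_rw [real_inner_comm _ x]
      exact (inner_hess_objective hR hbdd hreg hJ hJ' θ y x).symm
    simp only [symForm]
    rw [integral_div, integral_add (i1 x y) (i1 y x), e1, e1, ← inner_hess_comm hJ hJ' θ y x,
      real_inner_comm x]
    ring
  have hpt : ∀ B : Fin N → Traj S A H,
      frameNorm g v (hess (objective mdp pol H) θ - batchHess mdp pol H B θ) ^ 2 = ∑ a, ∑ b,
        ((N : ℝ)⁻¹ * ∑ i, symForm mdp pol (B i) θ (frame g v a) (frame g v b) -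
          ∫ τ, symForm mdp pol τ θ (frame g v a) (frame g v b) ∂(trajLaw mdp pol H θ)) ^ 2 := by
    intro B
    rw [frameNorm_sq]
    refine Finset.sum_congr rfl fun a _ => Finset.sum_congr rfl fun b _ => ?_
    rw [hmean, ← inner_batchHess, sub_apply, inner_sub_right]
    ring
  have hV := fun a b => integral_pi_mean_sub_sq_le
    (memLp_symForm hR hbdd hreg θ (frame g v a) (frame g v b)) hN
  simp_rw [hpt]
  refine lintegral_le_of_integral_le
    (fun B => Finset.sum_nonneg fun _ _ => Finset.sum_nonneg fun _ _ => sq_nonneg _)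
    (integrable_finsetSum _ fun a _ => integrable_finsetSum _ fun b _ => (hV a b).1) ?_
  rw [integral_finsetSum _ fun a _ => integrable_finsetSum _ fun b _ => (hV a b).1]
  simp_rw [integral_finsetSum Finset.univ fun b _ => (hV _ b).1]
  refine (Finset.sum_le_sum fun a _ => Finset.sum_le_sum fun b _ => (hV a b).2).trans ?_
  simp_rw [← Finset.sum_div]
  gcongr
  exact sum_integral_symForm_sq_le hR hbdd hreg θ g v

end Batches

/-! ### Conditional sampling and joint measurability. -/

section Conditional

/-- Integration of a function of the past and of a fresh sample. -/
theorem lintegral_of_sampling {Ω X Z : Type*} {m : MeasurableSpace Ω} [mΩ : MeasurableSpace Ω]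
    [MeasurableSpace X] [MeasurableSpace Z] {μ : Measure Ω} [IsFiniteMeasure μ] (hm : m ≤ mΩ)
    {x : Ω → X} (hx : Measurable[m] x) {z : Ω → Z} (hz : Measurable z) (κ : Kernel X Z)
    [IsMarkovKernel κ]
    (h : ∀ U : Set Ω, MeasurableSet[m] U → ∀ W : Set Z, MeasurableSet W →
      μ (U ∩ {ω | z ω ∈ W}) = ∫⁻ ω in U, κ (x ω) W ∂μ)
    {F : X × Z → ℝ≥0∞} (hF : Measurable F) :
    ∫⁻ ω, F (x ω, z ω) ∂μ = ∫⁻ ω, ∫⁻ y, F (x ω, y) ∂(κ (x ω)) ∂μ := by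
  have hx' : Measurable x := fun s hs => hm _ (hx hs)
  -- The sampling hypothesis identifies the joint law of past and sample on rectangles, which
  -- determine it.
  have hlaw : μ.map (fun ω => (x ω, z ω)) = μ.map x ⊗ₘ κ := by
    refine Measure.ext_prod fun {s t} hs ht => ?_
    rw [Measure.map_apply (hx'.prodMk hz) (hs.prod ht), Measure.compProd_apply_prod hs ht,
      setLIntegral_map hs (κ.measurable_coe ht) hx', ← h _ (hx hs) t ht]
    rfl
  rw [← lintegral_map hF (hx'.prodMk hz), hlaw, Measure.lintegral_compProd hF,
    lintegral_map hF.lintegral_kernel_prod_right' hx']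

theorem measurable_measure_pi {X T ι : Type*} [MeasurableSpace X] [MeasurableSpace T] [Fintype ι]
    {κ : X → Measure T} [∀ x, IsProbabilityMeasure (κ x)] (h : Measurable κ) :
    Measurable fun x => Measure.pi fun _ : ι => κ x := by
  refine Measurable.measure_of_isPiSystem_of_isProbabilityMeasure generateFrom_pi.symm isPiSystem_pi
    ?_
  rintro _ ⟨s, hs, rfl⟩
  simp only [Measure.pi_pi]
  exact Finset.measurable_prod _ fun i _ =>
    (Measure.measurable_coe (hs i (Set.mem_univ i))).comp h

/-- A bound on the mean from a bound on the mean square. -/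
theorem integrable_of_lintegral_sq_le {Ω : Type*} [MeasurableSpace Ω] {μ : Measure Ω}
    [IsProbabilityMeasure μ] {F : Ω → ℝ} (hF : Measurable F) {c : ℝ} (hc : 0 < c)
    (h : ∫⁻ ω, ENNReal.ofReal (F ω ^ 2) ∂μ ≤ ENNReal.ofReal (c ^ 2)) :
    Integrable F μ ∧ ∫ ω, F ω ∂μ ≤ c := by
  obtain ⟨h1, h2⟩ := integrable_of_lintegral_le (hF.pow_const 2) (fun _ => sq_nonneg _)
    (sq_nonneg c) h
  have hi : Integrable F μ :=
    ((memLp_two_iff_integrable_sq hF.aestronglyMeasurable).2 h1).integrable (by norm_num)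
  refine ⟨hi, ?_⟩
  -- The mean is compared with the mean square through 2cF ≤ F² + c².
  have h3 : ∫ ω, 2 * c * F ω ∂μ ≤ ∫ ω, (F ω ^ 2 + c ^ 2) ∂μ :=
    integral_mono (hi.const_mul _) (h1.add (integrable_const _)) fun ω => by
      simp only
      nlinarith [sq_nonneg (F ω - c)]
  rw [integral_const_mul, integral_add h1 (integrable_const _)] at h3
  simp only [integral_const, probReal_univ, smul_eq_mul, one_mul] at h3
  by_contra! hlt
  nlinarith

variable {d : ℕ} {S A : Type*} [MeasurableSpace S] [MeasurableSpace A] {ν : Measure A}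
  (mdp : MDP S A) (pol : PolicyClass S A ν d) (H : ℕ) {N : ℕ}

theorem continuous_batchGrad (B : Fin N → Traj S A H) : Continuous (batchGrad mdp pol H B) := by
  unfold batchGrad
  simp only [stochGrad_eq]
  exact (continuous_finsetSum _ fun i _ => continuous_weightedScore pol _ _).const_smul (N : ℝ)⁻¹

theorem measurable_batchGrad {X : Type*} {mX : MeasurableSpace X} {θ : X → Param d}
    {B : X → Fin N → Traj S A H} (hθ : Measurable θ) (hB : Measurable B) :
    Measurable fun x => batchGrad mdp pol H (B x) (θ x) := by
  suffices h : Measurable (Function.uncurry fun (θ : Param d) (B : Fin N → Traj S A H) =>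
      batchGrad mdp pol H B θ) by
    have h' : Measurable fun x => (θ x, B x) := hθ.prodMk hB
    have h'' := h.comp h'
    exact h''
  refine measurable_uncurry_of_continuous_of_measurable (continuous_batchGrad mdp pol H)
    fun θ => ?_
  unfold batchGrad
  simp only [stochGrad_eq]
  exact (Finset.measurable_sum _ fun i _ => (measurable_weightedScore pol
    (measurable_regretToGo mdp) θ).comp (measurable_pi_apply i)).const_smul (N : ℝ)⁻¹

theorem continuous_stochHess (τ : Traj S A H) : Continuous (stochHess mdp pol H τ) := by
  have : stochHess mdp pol H τ = fun θ => weightedScoreDeriv pol (regretToGo mdp H τ) τ θ +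
      InnerProductSpace.rankOne ℝ (weightedScore pol (regretToGo mdp H τ) τ θ)
        (totalScore pol τ θ) := funext fun θ => stochHess_eq pol mdp τ θ
  rw [this]
  have h1 := continuous_weightedScore pol (regretToGo mdp H τ) τ
  have h2 := continuous_totalScore pol τ
  have h3 := continuous_weightedScoreDeriv pol (regretToGo mdp H τ) τ
  exact h3.add (((InnerProductSpace.rankOne ℝ).continuous.comp h1).clm_apply h2)

theorem measurable_stochHess (θ : Param d) :
    Measurable fun τ : Traj S A H => stochHess mdp pol H τ θ := by
  refine measurable_clm fun v => ?_
  simp only [stochHess_eq, add_apply, InnerProductSpace.rankOne_apply]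
  exact ((ContinuousLinearMap.measurable_apply v).comp (measurable_weightedScoreDeriv pol
    (measurable_regretToGo mdp) θ)).add (Measurable.fun_smul
      ((measurable_totalScore pol θ).inner measurable_const)
      (measurable_weightedScore pol (measurable_regretToGo mdp) θ))

theorem measurable_batchHess {X : Type*} {mX : MeasurableSpace X} {θ : X → Param d}
    {B : X → Fin N → Traj S A H} (hθ : Measurable θ) (hB : Measurable B) :
    Measurable fun x => batchHess mdp pol H (B x) (θ x) := by
  suffices h : Measurable (Function.uncurry fun (θ : Param d) (B : Fin N → Traj S A H) =>
      batchHess mdp pol H B θ) by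
    have h' : Measurable fun x => (θ x, B x) := hθ.prodMk hB
    have h'' := h.comp h'
    exact h''
  have hadj : Continuous fun K : Param d →L[ℝ] Param d => ContinuousLinearMap.adjoint K :=
    ContinuousLinearMap.adjoint.continuous
  refine measurable_uncurry_of_continuous_of_measurable (β := Param d →L[ℝ] Param d)
    (u := fun θ B => batchHess mdp pol H B θ) (fun B => ?_) fun θ => ?_
  · have hK : Continuous fun θ => (N : ℝ)⁻¹ • ∑ i, stochHess mdp pol H (B i) θ :=
      (continuous_finsetSum _ fun i _ => continuous_stochHess mdp pol H (B i)).const_smul (N : ℝ)⁻¹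
    exact (hK.add (hadj.comp hK)).const_smul (2 : ℝ)⁻¹
  · have hK : Measurable fun B : Fin N → Traj S A H =>
        (N : ℝ)⁻¹ • ∑ i, stochHess mdp pol H (B i) θ :=
      (Finset.measurable_sum _ fun i _ =>
        (measurable_stochHess mdp pol H θ).comp (measurable_pi_apply i)).const_smul (N : ℝ)⁻¹
    exact (hK.add (hadj.measurable.comp hK)).const_smul (2 : ℝ)⁻¹

variable [SFinite ν]

theorem measurable_trajLaw : Measurable (trajLaw mdp pol H) := by
  refine Measure.measurable_of_measurable_coe _ fun W hW => ?_
  have hj : Measurable fun p : Param d × Traj S A H => trajDens pol H p.1 p.2 :=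
    measurable_uncurry_of_continuous_of_measurable (continuous_trajDens pol)
      fun θ => measurable_trajDens pol H θ
  simp_rw [trajLaw_eq, withDensity_apply _ hW]
  exact hj.ennreal_ofReal.lintegral_prod_right'

/-- The law of a batch, given the parameter. -/
def batchLaw (N : ℕ) : Kernel (Param d) (Fin N → Traj S A H) :=
  ⟨fun θ => Measure.pi fun _ : Fin N => trajLaw mdp pol H θ,
    measurable_measure_pi (measurable_trajLaw mdp pol H)⟩

theorem batchLaw_apply (N : ℕ) (θ : Param d) :
    batchLaw mdp pol H N θ = Measure.pi fun _ : Fin N => trajLaw mdp pol H θ := rfl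

instance isMarkovKernel_batchLaw (N : ℕ) : IsMarkovKernel (batchLaw mdp pol H N) :=
  ⟨fun θ => by rw [batchLaw_apply]; infer_instance⟩

end Conditional

/-! ### Noise along a run. -/

section Run

variable {d : ℕ} {S A Ω : Type*} [MeasurableSpace S] [MeasurableSpace A] [mΩ : MeasurableSpace Ω]
  {ν : Measure A} {mdp : MDP S A} {pol : PolicyClass S A ν d} {H Ng NH T : ℕ}
  {G L R M Δ : ℝ} {θ₀ d₀ : Param d} {μ : Measure Ω} {𝓕 : Filtration ℕ mΩ}
  {θ : ℕ → Ω → Param d} {Bg : ℕ → Ω → Fin Ng → Traj S A H}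
  {BH : ℕ → Ω → Fin NH → Traj S A H} {α : ℕ → Ω → Fin 2 → ℝ}

namespace IsRun

theorem measurable_direction (h : IsRun mdp pol H Ng NH T Δ θ₀ d₀ μ 𝓕 θ Bg BH α) {t : ℕ}
    (ht : t ≤ T + 1) : Measurable[𝓕 t] (direction d₀ θ t) := by
  cases t with
  | zero => exact measurable_const
  | succ t =>
    have h1 := h.measurable_iterate (t + 1) ht
    have h2 : Measurable[𝓕 (t + 1)] (θ t) := fun s hs =>
      𝓕.mono t.le_succ _ (h.measurable_iterate t (by omega) hs)
    exact h1.sub h2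

theorem measurable_batchGrad_succ (h : IsRun mdp pol H Ng NH T Δ θ₀ d₀ μ 𝓕 θ Bg BH α) {t : ℕ}
    (ht : t ≤ T) :
    Measurable[𝓕 (t + 1)] fun ω => batchGrad mdp pol H (Bg t ω) (θ t ω) := by
  have h2 : Measurable[𝓕 (t + 1)] (θ t) := fun s hs =>
    𝓕.mono t.le_succ _ (h.measurable_iterate t (by omega) hs)
  exact measurable_batchGrad mdp pol H h2 (h.measurable_Bg t ht)

variable [SFinite ν] [IsProbabilityMeasure μ]

/-- Integration over an iteration of the run: the batches are fresh. -/
theorem lintegral_eq (h : IsRun mdp pol H Ng NH T Δ θ₀ d₀ μ 𝓕 θ Bg BH α) {t : ℕ} (ht : t ≤ T)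
    {F : (Param d × Param d) × ((Fin Ng → Traj S A H) × (Fin NH → Traj S A H)) → ℝ≥0∞}
    (hF : Measurable F) :
    ∫⁻ ω, F ((θ t ω, direction d₀ θ t ω), (Bg t ω, BH t ω)) ∂μ =
      ∫⁻ ω, ∫⁻ B, ∫⁻ B', F ((θ t ω, direction d₀ θ t ω), (B, B'))
        ∂(batchLaw mdp pol H NH (θ t ω)) ∂(batchLaw mdp pol H Ng (θ t ω)) ∂μ := by
  have hx : Measurable[𝓕 t] fun ω => (θ t ω, direction d₀ θ t ω) :=
    (h.measurable_iterate t (by omega)).prodMk (h.measurable_direction (by omega))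
  have hz : Measurable fun ω => (Bg t ω, BH t ω) :=
    Measurable.prodMk (fun s hs => 𝓕.le _ _ (h.measurable_Bg t ht hs))
      fun s hs => 𝓕.le _ _ (h.measurable_BH t ht hs)
  have := lintegral_of_sampling (μ := μ) (𝓕.le t) hx hz
    ((batchLaw mdp pol H Ng ×ₖ batchLaw mdp pol H NH).comap Prod.fst measurable_fst)
    (fun U hU W hW => by
      simp only [Kernel.comap_apply, Kernel.prod_apply]
      exact h.sampling t ht U hU W hW) hF
  rw [this]
  refine lintegral_congr fun ω => ?_
  rw [Kernel.comap_apply, Kernel.prod_apply]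
  exact lintegral_prod (fun Y => F ((θ t ω, direction d₀ θ t ω), Y))
    (hF.comp measurable_prodMk_left).aemeasurable

theorem lintegral_grad_noise (h : IsRun mdp pol H Ng NH T Δ θ₀ d₀ μ 𝓕 θ Bg BH α)
    (hR : 0 ≤ R) (hbdd : BoundedRegret mdp R) (hreg : ExpectedLipschitzSmooth mdp pol H G L)
    (hlip : LipschitzHessian (objective mdp pol H) M) (hNg : 0 < Ng) {t : ℕ} (ht : t ≤ T) :
    ∫⁻ ω, ENNReal.ofReal (‖gradient (objective mdp pol H) (θ t ω) -
      batchGrad mdp pol H (Bg t ω) (θ t ω)‖ ^ 2) ∂μ ≤ ENNReal.ofReal (gradVar mdp R G / Ng) := by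
  have hF : Measurable fun p : (Param d × Param d) × ((Fin Ng → Traj S A H) ×
      (Fin NH → Traj S A H)) => ENNReal.ofReal (‖gradient (objective mdp pol H) p.1.1 -
      batchGrad mdp pol H p.2.1 p.1.1‖ ^ 2) := by
    have h1 : Measurable fun p : (Param d × Param d) × ((Fin Ng → Traj S A H) ×
      (Fin NH → Traj S A H)) => gradient (objective mdp pol H) p.1.1 :=
      hlip.2.1.continuous.measurable.comp (measurable_fst.comp measurable_fst)
    have h2 : Measurable fun p : (Param d × Param d) × ((Fin Ng → Traj S A H) ×
      (Fin NH → Traj S A H)) => batchGrad mdp pol H p.2.1 p.1.1 :=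
      measurable_batchGrad mdp pol H (measurable_fst.comp measurable_fst)
        (measurable_fst.comp measurable_snd)
    exact ((h1.sub h2).norm.pow_const 2).ennreal_ofReal
  rw [h.lintegral_eq ht hF]
  calc _ ≤ ∫⁻ _ω : Ω, ENNReal.ofReal (gradVar mdp R G / Ng) ∂μ := by
        refine lintegral_mono fun ω => ?_
        simp only [lintegral_const, measure_univ, mul_one]
        exact lintegral_batchGrad_sub_sq_le hR hbdd hreg hlip.1 hNg (θ t ω)
    _ = _ := by simp

/-- The plane is random through the gradient batch and the past. Integrating first over the
independent Hessian batch freezes it, and the bound for a fixed plane applies. -/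
theorem lintegral_hess_noise (h : IsRun mdp pol H Ng NH T Δ θ₀ d₀ μ 𝓕 θ Bg BH α)
    (hR : 0 ≤ R) (hbdd : BoundedRegret mdp R) (hreg : ExpectedLipschitzSmooth mdp pol H G L)
    (hlip : LipschitzHessian (objective mdp pol H) M) (hcont : Continuous (hess (objective mdp pol H)))
    (hNH : 0 < NH) {t : ℕ} (ht : t ≤ T) :
    ∫⁻ ω, ENNReal.ofReal (frameNorm (batchGrad mdp pol H (Bg t ω) (θ t ω)) (direction d₀ θ t ω)
      (hess (objective mdp pol H) (θ t ω) - batchHess mdp pol H (BH t ω) (θ t ω)) ^ 2) ∂μ ≤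
        ENNReal.ofReal (3 * hessVar mdp H R G L / NH) := by
  have hF : Measurable fun p : (Param d × Param d) × ((Fin Ng → Traj S A H) ×
      (Fin NH → Traj S A H)) => ENNReal.ofReal (frameNorm (batchGrad mdp pol H p.2.1 p.1.1) p.1.2
      (hess (objective mdp pol H) p.1.1 - batchHess mdp pol H p.2.2 p.1.1) ^ 2) := by
    have h1 : Measurable fun p : (Param d × Param d) × ((Fin Ng → Traj S A H) ×
      (Fin NH → Traj S A H)) => hess (objective mdp pol H) p.1.1 :=
      hcont.measurable.comp (measurable_fst.comp measurable_fst)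
    have h2 : Measurable fun p : (Param d × Param d) × ((Fin Ng → Traj S A H) ×
      (Fin NH → Traj S A H)) => batchGrad mdp pol H p.2.1 p.1.1 :=
      measurable_batchGrad mdp pol H (measurable_fst.comp measurable_fst)
        (measurable_fst.comp measurable_snd)
    have h3 : Measurable fun p : (Param d × Param d) × ((Fin Ng → Traj S A H) ×
      (Fin NH → Traj S A H)) => batchHess mdp pol H p.2.2 p.1.1 :=
      measurable_batchHess mdp pol H (measurable_fst.comp measurable_fst)
        (measurable_snd.comp measurable_snd)
    exact ((measurable_frameNorm h2 (measurable_snd.comp measurable_fst)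
      (h1.sub h3)).pow_const 2).ennreal_ofReal
  rw [h.lintegral_eq ht hF]
  calc _ ≤ ∫⁻ _ω : Ω, ENNReal.ofReal (3 * hessVar mdp H R G L / NH) ∂μ := by
        refine lintegral_mono fun ω => ?_
        calc _ ≤ ∫⁻ _B, ENNReal.ofReal (3 * hessVar mdp H R G L / NH)
              ∂(batchLaw mdp pol H Ng (θ t ω)) := lintegral_mono fun B =>
                lintegral_frameNorm_batchHess_sub_sq_le hR hbdd hreg hlip.1 hlip.2.1 hNH (θ t ω)
                  (batchGrad mdp pol H B (θ t ω)) (direction d₀ θ t ω)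
          _ = _ := by simp
    _ = _ := by simp

end IsRun

end Run

/-! ### Passage to normalized units. -/

section Scaling

variable {d : ℕ}

theorem smul_clm_sub (r : ℝ) (K K' : Param d →L[ℝ] Param d) :
    r • K - r • K' = r • (K - K') := by
  refine ContinuousLinearMap.ext fun x => ?_
  simp only [sub_apply, smul_apply, smul_sub]

theorem gradient_scale {f : Param d → ℝ} (hf : Differentiable ℝ f) (c a : ℝ) (y : Param d) :
    gradient (fun y => c * f (a • y)) y = (c * a) • gradient f (a • y) := by
  have h1 : HasFDerivAt (fun y : Param d => c * f (a • y))
      (c • (fderiv ℝ f (a • y)).comp (a • ContinuousLinearMap.id ℝ (Param d))) y :=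
    ((hf (a • y)).hasFDerivAt.comp y ((hasFDerivAt_id y).const_smul a)).const_mul c
  refine ext_inner_right ℝ fun v => ?_
  rw [inner_gradient_left, h1.fderiv, inner_smul_left, inner_gradient_left, conj_trivial]
  simp [mul_assoc]

theorem hess_scale {f : Param d → ℝ} (hf : Differentiable ℝ f)
    (hf' : Differentiable ℝ (gradient f)) (c a : ℝ) (y : Param d) :
    hess (fun y => c * f (a • y)) y = (c * a ^ 2) • hess f (a • y) := by
  have h1 : HasFDerivAt (fun y : Param d => (c * a) • gradient f (a • y))
      ((c * a) • (hess f (a • y)).comp (a • ContinuousLinearMap.id ℝ (Param d))) y :=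
    ((hf' (a • y)).hasFDerivAt.comp y ((hasFDerivAt_id y).const_smul a)).const_smul (c * a)
  have h2 : gradient (fun y => c * f (a • y)) = fun y => (c * a) • gradient f (a • y) :=
    funext (gradient_scale hf c a)
  rw [hess, h2, h1.fderiv]
  refine ContinuousLinearMap.ext fun v => ?_
  simp only [smul_apply, ContinuousLinearMap.comp_apply, ContinuousLinearMap.id_apply, map_smul,
    smul_smul]
  congr 1
  ring

/-- The Lipschitz constant of the Hessian scales like a third derivative, hence the normalization by
c * a ^ 3. -/
theorem LipschitzHessian.scale {f : Param d → ℝ} {M : ℝ} (hf : LipschitzHessian f M) {c a : ℝ}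
    (hc : 0 ≤ c) (ha : 0 ≤ a) (h : c * a ^ 3 * M = 1) :
    LipschitzHessian (fun y => c * f (a • y)) 1 := by
  obtain ⟨h1, h2, h3⟩ := hf
  refine ⟨?_, ?_, fun x y => ?_⟩
  · exact (h1.comp (differentiable_id.const_smul a)).const_mul c
  · rw [show gradient (fun y => c * f (a • y)) = fun y => (c * a) • gradient f (a • y) from
      funext (gradient_scale h1 c a)]
    exact (h2.comp (differentiable_id.const_smul a)).const_smul (c * a)
  · rw [hess_scale h1 h2, hess_scale h1 h2, smul_clm_sub, norm_smul,
      Real.norm_of_nonneg (by positivity)]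
    calc _ ≤ c * a ^ 2 * (M * ‖a • x - a • y‖) := by gcongr; exact h3 _ _
      _ = (c * a ^ 3 * M) * ‖x - y‖ := by
        rw [← smul_sub, norm_smul, Real.norm_of_nonneg ha]; ring
      _ = _ := by rw [h]

theorem LipschitzHessian.continuous_hess {f : Param d → ℝ} {M : ℝ} (hf : LipschitzHessian f M) :
    Continuous (hess f) := by
  refine (LipschitzWith.of_dist_le_mul (K := Real.toNNReal M) fun x y => ?_).continuous
  rw [dist_eq_norm, dist_eq_norm]
  refine (hf.2.2 x y).trans ?_
  gcongr
  exact Real.le_coe_toNNReal M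

theorem IsStep.scale {E : Submodule ℝ (Param d)} {g s : Param d} {K : Param d →L[ℝ] Param d}
    {a c : ℝ} (ha : 0 < a) (hc : 0 < c) (h : IsStep E g K (2 * a) s) :
    IsStep E ((c * a) • g) ((c * a ^ 2) • K) 2 (a⁻¹ • s) := by
  refine ⟨E.smul_mem _ h.mem, ?_, fun z hz hz2 => ?_⟩
  · rw [norm_smul, norm_inv, Real.norm_of_nonneg ha.le, inv_mul_le_iff₀ ha, mul_comm]
    exact h.norm_le
  · have h1 := h.le (a • z) (E.smul_mem _ hz) (by
      rw [norm_smul, Real.norm_of_nonneg ha.le, mul_comm]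
      gcongr)
    simp only [smul_apply, map_smul, inner_smul_left, inner_smul_right, conj_trivial] at h1 ⊢
    have h2 := mul_le_mul_of_nonneg_left h1 hc.le
    have e1 : a⁻¹ * (c * a * ⟪g, s⟫) = c * ⟪g, s⟫ := by field_simp
    have e2 : a⁻¹ * (c * a ^ 2 * (a⁻¹ * ⟪s, K s⟫)) = c * ⟪s, K s⟫ := by field_simp
    rw [e1, e2]
    linarith

/-- A step of the algorithm in the units in which the Hessian is `1`-Lipschitz and the radius
is `2`. -/
theorem exists_noisyStep {f : Param d → ℝ} {M : ℝ} (hf : LipschitzHessian f M)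
    {E : Submodule ℝ (Param d)} {g x s : Param d} {K : Param d →L[ℝ] Param d} {a c b C : ℝ}
    (ha : 0 < a) (hc : 0 < c) (hac : c * a ^ 3 * M = 1) (hK : ∀ x y, ⟪K x, y⟫ = ⟪x, K y⟫)
    (hg : g ∈ E) (h : IsStep E g K (2 * a) s) (hb : 0 ≤ b)
    (hH : ∀ y ∈ E, ∀ z ∈ E, |⟪y, (hess f x - K) z⟫| ≤ b * ‖y‖ * ‖z‖)
    (hleak : ‖hess f x s - E.starProjection (hess f x s)‖ ≤ M * C * (2 * a) ^ 2) :
    ∃ l : ℝ, NoisyStep (fun y => c * f (a • y)) E ((c * a) • g) ((c * a ^ 2) • K) (a⁻¹ • x)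
        (a⁻¹ • s) l (c * a * ‖gradient f x - g‖) (c * a ^ 2 * b) C ∧
      ∀ z ∈ E, 0 ≤ ⟪z, ((c * a ^ 2) • K) z⟫ + l * ‖z‖ ^ 2 := by
  have hs := h.scale ha hc
  obtain ⟨l, hl, h1, h2, h3⟩ := hs.exists_multiplier two_pos (fun x y => by
    simp only [smul_apply, inner_smul_left, inner_smul_right, hK, conj_trivial])
  have hax : a • a⁻¹ • x = x := by rw [smul_smul, mul_inv_cancel₀ ha.ne', one_smul]
  refine ⟨l, ⟨E.smul_mem _ hg, hs.mem, hs.norm_le, hl, h1, h2 _ hs.mem, h3, ?_, ?_, by positivity,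
    ?_⟩, h2⟩
  · rw [gradient_scale hf.1, hax, ← smul_sub, norm_smul, Real.norm_of_nonneg (by positivity)]
  · intro y hy z hz
    rw [hess_scale hf.1 hf.2.1, hax, smul_clm_sub, smul_apply, inner_smul_right, abs_mul,
      abs_of_nonneg (by positivity : 0 ≤ c * a ^ 2), mul_assoc (c * a ^ 2), mul_assoc (c * a ^ 2)]
    exact mul_le_mul_of_nonneg_left (hH y hy z hz) (by positivity)
  · rw [hess_scale hf.1 hf.2.1, hax, smul_apply, map_smul, map_smul, map_smul, ← smul_sub,
      ← smul_sub, smul_smul, norm_smul, Real.norm_of_nonneg (by positivity)]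
    calc _ ≤ c * a ^ 2 * a⁻¹ * (M * C * (2 * a) ^ 2) := by gcongr
      _ = (c * a ^ 3 * M) * (4 * C) := by field_simp; ring
      _ = _ := by rw [hac, one_mul]

end Scaling

/-! ### The least eigenvalue of the projected Hessian. -/

section Eigenvalue

variable {d : ℕ}

/-- The infimum of the Rayleigh quotient. -/
def rayleighInf (K : Param d →L[ℝ] Param d) : ℝ :=
  ⨅ x : {x : Param d // x ≠ 0}, ⟪K x, x⟫ / ‖(x : Param d)‖ ^ 2

theorem le_rayleighInf (hd : 0 < d) {K : Param d →L[ℝ] Param d} {m : ℝ}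
    (h : ∀ x, m * ‖x‖ ^ 2 ≤ ⟪K x, x⟫) : m ≤ rayleighInf K := by
  have : Nonempty {x : Param d // x ≠ 0} :=
    ⟨⟨EuclideanSpace.single ⟨0, hd⟩ 1, by simp⟩⟩
  refine le_ciInf fun x => ?_
  have : 0 < ‖(x : Param d)‖ := norm_pos_iff.2 x.2
  rw [le_div_iff₀ (by positivity)]
  exact h x

theorem bddBelow_rayleigh (K : Param d →L[ℝ] Param d) :
    BddBelow (Set.range fun x : {x : Param d // x ≠ 0} => ⟪K x, x⟫ / ‖(x : Param d)‖ ^ 2) := by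
  refine ⟨-‖K‖, ?_⟩
  rintro _ ⟨x, rfl⟩
  have : 0 < ‖(x : Param d)‖ := norm_pos_iff.2 x.2
  simp only
  rw [le_div_iff₀ (by positivity)]
  have h1 := neg_le_of_abs_le (abs_real_inner_le_norm (K x) x)
  have h2 := mul_le_mul_of_nonneg_right (K.le_opNorm x) (norm_nonneg (x : Param d))
  nlinarith

theorem rayleighInf_mul_le (K : Param d →L[ℝ] Param d) (x : Param d) :
    rayleighInf K * ‖x‖ ^ 2 ≤ ⟪K x, x⟫ := by
  rcases eq_or_ne x 0 with rfl | hx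
  · simp
  · have : 0 < ‖x‖ := norm_pos_iff.2 hx
    rw [← le_div_iff₀ (by positivity)]
    exact ciInf_le (bddBelow_rayleigh K) ⟨x, hx⟩

/-- The infimum moves by at most the operator norm of the perturbation. Continuity gives
measurability of the least eigenvalue along a run, which its definition by eigenvalues does not
show. -/
theorem continuous_rayleighInf (hd : 0 < d) :
    Continuous (rayleighInf : (Param d →L[ℝ] Param d) → ℝ) := by
  have h : ∀ K K' : Param d →L[ℝ] Param d, rayleighInf K - ‖K - K'‖ ≤ rayleighInf K' := by
    intro K K'
    refine le_rayleighInf hd fun x => ?_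
    have h1 := rayleighInf_mul_le K x
    have h2 := le_of_abs_le (abs_real_inner_le_norm ((K - K') x) x)
    have h3 := mul_le_mul_of_nonneg_right ((K - K').le_opNorm x) (norm_nonneg x)
    have h4 : ⟪(K - K') x, x⟫ = ⟪K x, x⟫ - ⟪K' x, x⟫ := by rw [sub_apply, inner_sub_left]
    linarith [sq ‖x‖, mul_assoc ‖K - K'‖ ‖x‖ ‖x‖, sub_mul (rayleighInf K) ‖K - K'‖ (‖x‖ ^ 2),
      congrArg (‖K - K'‖ * ·) (sq ‖x‖)]
  refine (LipschitzWith.of_dist_le_mul (K := 1) fun K K' => ?_).continuous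
  rw [Real.dist_eq, dist_eq_norm, NNReal.coe_one, one_mul, abs_le]
  have h1 := h K K'
  have h2 := h K' K
  rw [norm_sub_rev] at h2
  constructor <;> linarith

theorem lambdaMin_eq_rayleighInf (hd : 0 < d) {K : Param d →L[ℝ] Param d}
    (hK : ∀ x y, ⟪K x, y⟫ = ⟪x, K y⟫) : lambdaMin K = rayleighInf K := by
  have : Nontrivial (Param d) := ⟨⟨EuclideanSpace.single ⟨0, hd⟩ 1, 0, by simp⟩⟩
  have hsymm : (K : Param d →ₗ[ℝ] Param d).IsSymmetric := hK
  have h1 := hsymm.hasEigenvalue_iInf_of_finiteDimensional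
  refine (show IsLeast {x : ℝ | Module.End.HasEigenvalue (K : Param d →ₗ[ℝ] Param d) x}
    (rayleighInf K) from ⟨h1, fun x hx => ?_⟩).csInf_eq
  obtain ⟨v, hv⟩ := hx.exists_hasEigenvector
  have h2 := rayleighInf_mul_le K v
  have h3 : K v = x • v := hv.apply_eq_smul
  have h4 : 0 < ‖v‖ := norm_pos_iff.2 hv.2
  rw [h3, inner_smul_left, conj_trivial, real_inner_self_eq_norm_sq] at h2
  exact le_of_mul_le_mul_right h2 (by positivity)

theorem inner_projected (g v : Param d) (K : Param d →L[ℝ] Param d) (x y : Param d) :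
    ⟪projected g v K x, y⟫ = ⟪K ((Submodule.span ℝ {g, v}).starProjection x),
      (Submodule.span ℝ {g, v}).starProjection y⟫ := by
  simp only [projected, ContinuousLinearMap.comp_apply]
  rw [Submodule.inner_starProjection_left_eq_right]

theorem inner_projected_comm {g v : Param d} {K : Param d →L[ℝ] Param d}
    (hK : ∀ x y, ⟪K x, y⟫ = ⟪x, K y⟫) (x y : Param d) :
    ⟪projected g v K x, y⟫ = ⟪x, projected g v K y⟫ := by
  rw [inner_projected, hK, real_inner_comm, ← inner_projected, real_inner_comm]

/-- The condition m ≤ 0 cannot be dropped: the compression acts as zero on the orthogonal complement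
of the plane, and the form at x only sees the shorter vector obtained by projection. -/
theorem le_lambdaMin_projected (hd : 0 < d) {g v : Param d} {K : Param d →L[ℝ] Param d}
    (hK : ∀ x y, ⟪K x, y⟫ = ⟪x, K y⟫) {m : ℝ} (hm : m ≤ 0)
    (h : ∀ x ∈ Submodule.span ℝ {g, v}, m * ‖x‖ ^ 2 ≤ ⟪x, K x⟫) :
    m ≤ lambdaMin (projected g v K) := by
  rw [lambdaMin_eq_rayleighInf hd (inner_projected_comm hK)]
  refine le_rayleighInf hd fun x => ?_
  rw [inner_projected, real_inner_comm]
  refine le_trans ?_ (h _ (Submodule.starProjection_apply_mem _ x))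
  exact mul_le_mul_of_nonpos_left
    (pow_le_pow_left₀ (norm_nonneg _) (Submodule.norm_starProjection_apply_le _ x) 2) hm

theorem abs_lambdaMin_projected_le (hd : 0 < d) {g v : Param d} {K : Param d →L[ℝ] Param d}
    (hK : ∀ x y, ⟪K x, y⟫ = ⟪x, K y⟫) {B : ℝ} (hB : 0 ≤ B)
    (h : ∀ x, |⟪x, K x⟫| ≤ B * ‖x‖ ^ 2) : |lambdaMin (projected g v K)| ≤ B := by
  refine abs_le.2 ⟨le_lambdaMin_projected hd hK (by linarith) fun x _ => ?_, ?_⟩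
  · have := neg_le_of_abs_le (h x)
    linarith
  · rw [lambdaMin_eq_rayleighInf hd (inner_projected_comm hK)]
    have h1 := rayleighInf_mul_le (projected g v K) (EuclideanSpace.single ⟨0, hd⟩ 1)
    rw [inner_projected, real_inner_comm] at h1
    have h2 := le_of_abs_le (h ((Submodule.span ℝ {g, v}).starProjection
      (EuclideanSpace.single ⟨0, hd⟩ 1)))
    have h3 := Submodule.norm_starProjection_apply_le (Submodule.span ℝ {g, v})
      (EuclideanSpace.single ⟨0, hd⟩ (1 : ℝ))
    have h4 : ‖(EuclideanSpace.single ⟨0, hd⟩ (1 : ℝ) : Param d)‖ = 1 := by simp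
    rw [h4] at h1 h3
    have h5 := pow_le_one₀ (n := 2) (norm_nonneg _) h3
    nlinarith

end Eigenvalue

/-! ### Uniform bounds on the objective and its derivatives. -/

section ObjectiveBounds

variable {d : ℕ} {S A : Type*} [MeasurableSpace S] [MeasurableSpace A] {ν : Measure A} [SFinite ν]
  {mdp : MDP S A} {pol : PolicyClass S A ν d} {H : ℕ} {G L R : ℝ}

theorem abs_objective_le (hR : 0 ≤ R) (hbdd : BoundedRegret mdp R) (θ : Param d) :
    |objective mdp pol H θ| ≤ R / (1 - mdp.γ) := by
  have h : ∀ τ : Traj S A H, ‖regret mdp H τ‖ ≤ R / (1 - mdp.γ) := by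
    intro τ
    calc _ ≤ ∑ h : Fin H, mdp.γ ^ (h : ℕ) * R := by
          refine (norm_sum_le _ _).trans (Finset.sum_le_sum fun h _ => ?_)
          rw [norm_mul, Real.norm_of_nonneg (pow_nonneg mdp.γ_nonneg _), Real.norm_eq_abs]
          exact mul_le_mul_of_nonneg_left (hbdd _ _) (pow_nonneg mdp.γ_nonneg _)
      _ = (∑ h : Fin H, mdp.γ ^ (h : ℕ)) * R := by rw [Finset.sum_mul]
      _ ≤ 1 / (1 - mdp.γ) * R := by
          gcongr
          exact sum_pow_fin_le mdp.γ_nonneg mdp.γ_lt_one H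
      _ = _ := by ring
  have := norm_integral_le_of_norm_le_const (μ := trajLaw mdp pol H θ)
    (Filter.Eventually.of_forall h)
  simpa [objective] using this

theorem iInf_objective_le (hR : 0 ≤ R) (hbdd : BoundedRegret mdp R) (θ : Param d) :
    ⨅ x, objective mdp pol H x ≤ objective mdp pol H θ := by
  refine ciInf_le ⟨-(R / (1 - mdp.γ)), ?_⟩ θ
  rintro _ ⟨x, rfl⟩
  exact neg_le_of_abs_le (abs_objective_le hR hbdd x)

/-- Unbiasedness is tested in the direction of the gradient itself; Young's inequality absorbs half
of the left side. -/
theorem norm_gradient_objective_sq_le (hR : 0 ≤ R) (hbdd : BoundedRegret mdp R)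
    (hreg : ExpectedLipschitzSmooth mdp pol H G L)
    (hJ : Differentiable ℝ (objective mdp pol H)) (θ : Param d) :
    ‖gradient (objective mdp pol H) θ‖ ^ 2 ≤ gradVar mdp R G := by
  set u := gradient (objective mdp pol H) θ with hu
  have h1 := inner_gradient_objective hbdd hreg hJ θ u
  rw [← hu, real_inner_self_eq_norm_sq] at h1
  have hm := memLp_stochGrad hR hbdd hreg θ
  have hi := MemLp.integrable_norm_sq hm
  have h2 : ∫ τ : Traj S A H, ⟪stochGrad mdp pol H τ θ, u⟫ ∂(trajLaw mdp pol H θ) ≤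
      ∫ τ : Traj S A H, (1 / 2 * ‖stochGrad mdp pol H τ θ‖ ^ 2 + 1 / 2 * ‖u‖ ^ 2)
        ∂(trajLaw mdp pol H θ) := by
    refine integral_mono ((hm.inner_const u).integrable (by norm_num))
      ((hi.const_mul _).add (integrable_const _)) fun τ => ?_
    have := real_inner_le_norm (stochGrad mdp pol H τ θ) u
    simp only
    nlinarith [sq_nonneg (‖stochGrad mdp pol H τ θ‖ - ‖u‖)]
  rw [integral_add (hi.const_mul _) (integrable_const _), integral_const_mul] at h2
  simp only [integral_const, probReal_univ, smul_eq_mul, one_mul] at h2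
  have h3 := integral_norm_stochGrad_sq_le hR hbdd hreg θ
  linarith

/-- A crude bound whose role is to make the least eigenvalue integrable. The unit vector along x is
taken from the frame of x and 0, so that the moment bound on planes can be reused. -/
theorem abs_inner_hess_objective_le (hR : 0 ≤ R) (hbdd : BoundedRegret mdp R)
    (hreg : ExpectedLipschitzSmooth mdp pol H G L)
    (hJ : Differentiable ℝ (objective mdp pol H))
    (hJ' : Differentiable ℝ (gradient (objective mdp pol H))) (θ x : Param d) :
    |⟪x, hess (objective mdp pol H) θ x⟫| ≤ (1 + 3 * hessVar mdp H R G L) * ‖x‖ ^ 2 := by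
  set u := frame x 0 0 with hu
  have hxu : x = ‖x‖ • u := eq_smul_frame_left x 0
  have hs : ∀ τ : Traj S A H, symForm mdp pol τ θ u u = ⟪stochHess mdp pol H τ θ u, u⟫ := by
    intro τ
    rw [symForm, real_inner_comm]
    ring
  have hm := memLp_symForm hR hbdd hreg θ u u
  have h1 : ⟪hess (objective mdp pol H) θ u, u⟫ =
      ∫ τ : Traj S A H, symForm mdp pol τ θ u u ∂(trajLaw mdp pol H θ) := by
    simp_rw [hs]
    exact inner_hess_objective hR hbdd hreg hJ hJ' θ u u
  have h2 : ∫ τ : Traj S A H, symForm mdp pol τ θ u u ^ 2 ∂(trajLaw mdp pol H θ) ≤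
      3 * hessVar mdp H R G L := by
    refine le_trans ?_ (sum_integral_symForm_sq_le hR hbdd hreg θ x 0)
    have hnn : ∀ a b, 0 ≤ ∫ τ : Traj S A H, symForm mdp pol τ θ (frame x 0 a) (frame x 0 b) ^ 2
      ∂(trajLaw mdp pol H θ) := fun a b => integral_nonneg fun τ => sq_nonneg _
    simp only [Fin.sum_univ_two]
    linarith [hnn 0 1, hnn 1 0, hnn 1 1]
  have h3 : |⟪hess (objective mdp pol H) θ u, u⟫| ≤ 1 + 3 * hessVar mdp H R G L := by
    rw [h1]
    calc _ ≤ ∫ τ : Traj S A H, |symForm mdp pol τ θ u u| ∂(trajLaw mdp pol H θ) :=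
          abs_integral_le_integral_abs
      _ ≤ ∫ τ : Traj S A H, (1 + symForm mdp pol τ θ u u ^ 2) ∂(trajLaw mdp pol H θ) := by
          refine integral_mono (hm.integrable (by norm_num)).abs
            ((integrable_const _).add hm.integrable_sq) fun τ => ?_
          simp only
          nlinarith [sq_abs (symForm mdp pol τ θ u u), sq_nonneg (|symForm mdp pol τ θ u u| - 1),
            abs_nonneg (symForm mdp pol τ θ u u)]
      _ ≤ _ := by
          rw [integral_add (integrable_const _) hm.integrable_sq]
          simp only [integral_const, probReal_univ, smul_eq_mul, one_mul]
          linarith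
  have e : ⟪x, hess (objective mdp pol H) θ x⟫ = ‖x‖ ^ 2 *
      ⟪hess (objective mdp pol H) θ u, u⟫ := by
    rw [real_inner_comm]
    conv_lhs => rw [hxu]
    rw [map_smul, inner_smul_left, inner_smul_right, conj_trivial]
    ring
  rw [e, abs_mul, abs_of_nonneg (sq_nonneg _), mul_comm]
  gcongr

end ObjectiveBounds

/-! ### Telescoping the potential along a path. -/

section Path

variable {d : ℕ}

/-- A sequence of noisy steps, in normalized units, whose search spaces contain the previous
steps. -/
structure NoisyPath (f : Param d → ℝ) (x : ℕ → Param d) (E : ℕ → Submodule ℝ (Param d))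
    (g : ℕ → Param d) (K : ℕ → Param d →L[ℝ] Param d) (l a b : ℕ → ℝ) (C : ℝ) (T : ℕ) : Prop where
  noisyStep : ∀ t < T, NoisyStep f (E t) (g t) (K t) (x t) (x (t + 1) - x t) (l t) (a t) (b t) C
  isStep : ∀ t < T, IsStep (E t) (g t) (K t) 2 (x (t + 1) - x t)
  mem_next : ∀ t, t + 1 < T → x (t + 1) - x t ∈ E (t + 1)

/-- What the model at the iterate `t` can undo of the increase of `f` along the previous step. -/
def carry (f : Param d → ℝ) (x : ℕ → Param d) : ℕ → ℝ
  | 0 => 0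
  | t + 1 => recoverable f (x t) (x (t + 1) - x t)

theorem carry_le_one (f : Param d → ℝ) (x : ℕ → Param d) (t : ℕ) : carry f x t ≤ 1 := by
  cases t with
  | zero => exact zero_le_one
  | succ t => exact recoverable_le_one _ _ _

namespace NoisyPath

variable {f : Param d → ℝ} {x : ℕ → Param d} {E : ℕ → Submodule ℝ (Param d)}
  {g : ℕ → Param d} {K : ℕ → Param d →L[ℝ] Param d} {l a b : ℕ → ℝ} {C : ℝ} {T : ℕ}

/-- The initial direction is arbitrary, so nothing is carried at t = 0 and a nonnegative model drop
suffices. Later the previous step lies in the current search space. -/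
theorem carry_le (hf : LipschitzHessian f 1) (h : NoisyPath f x E g K l a b C T) {t : ℕ}
    (ht : t < T) :
    carry f x t ≤ modelDrop (g t) (K t) (x (t + 1) - x t) + a t + b t / 2 := by
  have hs := h.noisyStep t ht
  cases t with
  | zero =>
    have h1 := hs.modelDrop_nonneg
    have h2 := (norm_nonneg _).trans hs.grad_noise
    have h3 := hs.noise_nonneg
    rw [carry]
    linarith
  | succ t =>
    have hx : x t + (x (t + 1) - x t) = x (t + 1) := by abel
    refine recoverable_le_modelDrop (E := E (t + 1)) hf (h.mem_next t ht)
      (h.noisyStep t (by omega)).norm_le (h.isStep (t + 1) ht).le ?_ hs.noise_nonneg ?_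
    · rw [hx]
      exact hs.grad_noise
    · rw [hx]
      exact hs.hess_noise

theorem potential_step (hd : 0 < d) (hf : LipschitzHessian f 1)
    (h : NoisyPath f x E g K l a b C T) {t : ℕ} (ht : t < T) :
    ‖gradient f (x (t + 1))‖ - 4 * C ≤ (f (x t) - 3 / 5 * carry f x t) -
      (f (x (t + 1)) - 3 / 5 * carry f x (t + 1)) + 41 / 15 + 18 / 5 * a t + 43 / 10 * b t ∧
    2 ≤ (f (x t) - 3 / 5 * carry f x t) - (f (x (t + 1)) - 3 / 5 * carry f x (t + 1))
      + 14 / 5 + 18 / 5 * a t + 43 / 10 * b t := by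
  have := (h.noisyStep t ht).potential_step hd hf (carry_le_one f x t) (h.carry_le hf ht)
  rwa [add_sub_cancel] at this

theorem potential_last (hd : 0 < d) (hf : LipschitzHessian f 1)
    (h : NoisyPath f x E g K l a b C T) {t : ℕ} (ht : t < T) {m : ℝ} (hm : ∀ y, m ≤ f y) :
    ‖gradient f (x (t + 1))‖ - 4 * C ≤ (f (x t) - 3 / 5 * carry f x t) - m + 14 / 5 + 3 * a t
      + 4 * b t ∧
    2 ≤ (f (x t) - 3 / 5 * carry f x t) - m + 14 / 5 + 3 * a t + 4 * b t := by
  have := (h.noisyStep t ht).potential_last hd hf (carry_le_one f x t) (h.carry_le hf ht) hm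
  rwa [add_sub_cancel] at this

/-- The gradients along a noisy path are small on average. -/
theorem sum_norm_gradient_le (hd : 0 < d) (hf : LipschitzHessian f 1) {n : ℕ}
    (h : NoisyPath f x E g K l a b C (n + 1)) {m : ℝ} (hm : ∀ y, m ≤ f y) :
    ∑ t ∈ Finset.range (n + 1), (‖gradient f (x (t + 1))‖ - 4 * C) ≤ f (x 0) - m +
      ∑ t ∈ Finset.range n, (41 / 15 + 18 / 5 * a t + 43 / 10 * b t) +
      (14 / 5 + 3 * a n + 4 * b n) := by
  -- The sum telescopes only up to the last step: the potential subtracts the carry and need not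
  -- stay above the lower bound `m` of f. The final step is therefore estimated directly against `m`
  -- by `potential_last`.
  have key : ∀ k ≤ n, ∑ t ∈ Finset.range k, (‖gradient f (x (t + 1))‖ - 4 * C) ≤
      f (x 0) - (f (x k) - 3 / 5 * carry f x k) +
        ∑ t ∈ Finset.range k, (41 / 15 + 18 / 5 * a t + 43 / 10 * b t) := by
    intro k hk
    induction k with
    | zero => simp [carry]
    | succ k ih =>
      rw [Finset.sum_range_succ, Finset.sum_range_succ]
      have h1 := ih (by omega)
      have h2 := (h.potential_step hd hf (t := k) (by omega)).1
      linarith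
  rw [Finset.sum_range_succ]
  have h1 := key n le_rfl
  have h2 := (h.potential_last hd hf (t := n) (by omega) hm).1
  linarith

/-- Both estimates of a potential step hold with the larger constant 14/5, so the maximum with 2
telescopes too. The floor 2 is what later sharpens Markov's inequality. -/
theorem sum_max_norm_gradient_le (hd : 0 < d) (hf : LipschitzHessian f 1) {n : ℕ}
    (h : NoisyPath f x E g K l a b C (n + 1)) {m : ℝ} (hm : ∀ y, m ≤ f y) :
    ∑ t ∈ Finset.range (n + 1), max (‖gradient f (x (t + 1))‖ - 4 * C) 2 ≤ f (x 0) - m +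
      ∑ t ∈ Finset.range (n + 1), (14 / 5 + 18 / 5 * a t + 43 / 10 * b t) := by
  have key : ∀ k ≤ n, ∑ t ∈ Finset.range k, max (‖gradient f (x (t + 1))‖ - 4 * C) 2 ≤
      f (x 0) - (f (x k) - 3 / 5 * carry f x k) +
        ∑ t ∈ Finset.range k, (14 / 5 + 18 / 5 * a t + 43 / 10 * b t) := by
    intro k hk
    induction k with
    | zero => simp [carry]
    | succ k ih =>
      rw [Finset.sum_range_succ, Finset.sum_range_succ]
      have h1 := ih (by omega)
      obtain ⟨h2, h3⟩ := h.potential_step hd hf (t := k) (by omega)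
      have h4 := max_le (h2.trans (by linarith)) h3
      linarith
  rw [Finset.sum_range_succ, Finset.sum_range_succ _ n]
  have h1 := key n le_rfl
  obtain ⟨h2, h3⟩ := h.potential_last hd hf (t := n) (by omega) hm
  have h4 := max_le h2 h3
  have h5 := (norm_nonneg _).trans (h.noisyStep n (by omega)).grad_noise
  have h6 := (h.noisyStep n (by omega)).noise_nonneg
  linarith

end NoisyPath

end Path

/-! ### A run, seen path by path in normalized units. -/

section Pathwise

variable {d : ℕ} {S A Ω : Type*} [MeasurableSpace S] [MeasurableSpace A] [mΩ : MeasurableSpace Ω]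
  {ν : Measure A} {mdp : MDP S A} {pol : PolicyClass S A ν d} {H Ng NH T : ℕ}
  {G L R M C a c Δ m : ℝ} {θ₀ d₀ : Param d} {μ : Measure Ω} {𝓕 : Filtration ℕ mΩ}
  {θ : ℕ → Ω → Param d} {Bg : ℕ → Ω → Fin Ng → Traj S A H}
  {BH : ℕ → Ω → Fin NH → Traj S A H} {α : ℕ → Ω → Fin 2 → ℝ}

/-- The error of the gradient in iteration `t`. -/
def gradNoise (mdp : MDP S A) (pol : PolicyClass S A ν d) (θ : ℕ → Ω → Param d)
    (Bg : ℕ → Ω → Fin Ng → Traj S A H) (t : ℕ) (ω : Ω) : ℝ :=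
  ‖gradient (objective mdp pol H) (θ t ω) - batchGrad mdp pol H (Bg t ω) (θ t ω)‖

/-- The error of the Hessian on the search space of iteration `t`. -/
def hessNoise (mdp : MDP S A) (pol : PolicyClass S A ν d) (d₀ : Param d) (θ : ℕ → Ω → Param d)
    (Bg : ℕ → Ω → Fin Ng → Traj S A H) (BH : ℕ → Ω → Fin NH → Traj S A H) (t : ℕ) (ω : Ω) : ℝ :=
  frameNorm (batchGrad mdp pol H (Bg t ω) (θ t ω)) (direction d₀ θ t ω)
    (hess (objective mdp pol H) (θ t ω) - batchHess mdp pol H (BH t ω) (θ t ω))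

namespace IsRun

theorem ae_isStep (h : IsRun mdp pol H Ng NH T Δ θ₀ d₀ μ 𝓕 θ Bg BH α) {t : ℕ} (ht : t ≤ T) :
    ∀ᵐ ω ∂μ, IsStep (Submodule.span ℝ {batchGrad mdp pol H (Bg t ω) (θ t ω), direction d₀ θ t ω})
      (batchGrad mdp pol H (Bg t ω) (θ t ω)) (batchHess mdp pol H (BH t ω) (θ t ω)) Δ
      (θ (t + 1) ω - θ t ω) := by
  filter_upwards [h.solve t ht, h.update t ht] with ω h1 h2
  have h3 := h1.isStep (inner_batchHess_comm (BH t ω) (θ t ω))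
  convert h3 using 1
  rw [h2]
  module

/-- A step of the run, in normalized units. -/
theorem ae_noisyStep (h : IsRun mdp pol H Ng NH T (2 * a) θ₀ d₀ μ 𝓕 θ Bg BH α)
    (hlip : LipschitzHessian (objective mdp pol H) M) (ha : 0 < a) (hc : 0 < c)
    (hac : c * a ^ 3 * M = 1) {t : ℕ} (ht : t ≤ T) : ∀ᵐ ω ∂μ, ∀ C : ℝ,
      ‖(hess (objective mdp pol H) (θ t ω) - projHess mdp pol H d₀ θ Bg t ω)
        (θ (t + 1) ω - θ t ω)‖ ≤ M * C * (2 * a) ^ 2 →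
      ∃ l : ℝ, NoisyStep (fun y => c * objective mdp pol H (a • y))
        (Submodule.span ℝ {batchGrad mdp pol H (Bg t ω) (θ t ω), direction d₀ θ t ω})
        ((c * a) • batchGrad mdp pol H (Bg t ω) (θ t ω))
        ((c * a ^ 2) • batchHess mdp pol H (BH t ω) (θ t ω)) (a⁻¹ • θ t ω)
        (a⁻¹ • θ (t + 1) ω - a⁻¹ • θ t ω) l (c * a * gradNoise mdp pol θ Bg t ω)
        (c * a ^ 2 * hessNoise mdp pol d₀ θ Bg BH t ω) C ∧
      ∀ z ∈ Submodule.span ℝ {batchGrad mdp pol H (Bg t ω) (θ t ω), direction d₀ θ t ω},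
        0 ≤ ⟪z, ((c * a ^ 2) • batchHess mdp pol H (BH t ω) (θ t ω)) z⟫ + l * ‖z‖ ^ 2 := by
  filter_upwards [h.ae_isStep ht] with ω hs C hC
  rw [← smul_sub]
  refine exists_noisyStep hlip ha hc hac (inner_batchHess_comm (BH t ω) (θ t ω))
    (Submodule.subset_span (by simp)) hs (frameNorm_nonneg _ _ _)
    (fun y hy z hz => abs_inner_le_frameNorm _ _ _ hy hz) ?_
  refine le_trans (le_of_eq ?_) hC
  -- The step lies in the search plane, so the inner projection fixes it and the leak is the
  -- component of its Hessian image outside the plane.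
  rw [sub_apply, projHess, projected, ContinuousLinearMap.comp_apply,
    ContinuousLinearMap.comp_apply, Submodule.starProjection_eq_self_iff.2 hs.mem]

theorem ae_noisyPath (h : IsRun mdp pol H Ng NH T (2 * a) θ₀ d₀ μ 𝓕 θ Bg BH α)
    (hlip : LipschitzHessian (objective mdp pol H) M) (ha : 0 < a) (hc : 0 < c)
    (hac : c * a ^ 3 * M = 1) (hM : 0 ≤ M) (hC : 0 ≤ C)
    (hcons : ∀ t < T, ∀ᵐ ω ∂μ,
      ‖(hess (objective mdp pol H) (θ t ω) - projHess mdp pol H d₀ θ Bg t ω)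
        (θ (t + 1) ω - θ t ω)‖ ≤ M * C * ‖θ (t + 1) ω - θ t ω‖ ^ 2) :
    ∀ᵐ ω ∂μ, ∃ E g K l, NoisyPath (fun y => c * objective mdp pol H (a • y))
      (fun t => a⁻¹ • θ t ω) E g K l (fun t => c * a * gradNoise mdp pol θ Bg t ω)
      (fun t => c * a ^ 2 * hessNoise mdp pol d₀ θ Bg BH t ω) C T := by
  have h1 := ae_all_iff.2 fun t => ae_all_iff.2 fun ht : t ≤ T => h.ae_isStep ht
  have h2 := ae_all_iff.2 fun t => ae_all_iff.2 fun ht : t ≤ T =>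
    h.ae_noisyStep hlip ha hc hac ht
  have h3 := ae_all_iff.2 fun t => ae_all_iff.2 fun ht : t < T => hcons t ht
  filter_upwards [h1, h2, h3] with ω i1 i2 i3
  have i4 : ∀ t, ∃ l : ℝ, t < T → NoisyStep (fun y => c * objective mdp pol H (a • y))
        (Submodule.span ℝ {batchGrad mdp pol H (Bg t ω) (θ t ω), direction d₀ θ t ω})
        ((c * a) • batchGrad mdp pol H (Bg t ω) (θ t ω))
        ((c * a ^ 2) • batchHess mdp pol H (BH t ω) (θ t ω)) (a⁻¹ • θ t ω)
        (a⁻¹ • θ (t + 1) ω - a⁻¹ • θ t ω) l (c * a * gradNoise mdp pol θ Bg t ω)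
        (c * a ^ 2 * hessNoise mdp pol d₀ θ Bg BH t ω) C := by
    intro t
    by_cases ht : t < T
    · obtain ⟨l, hl, -⟩ := i2 t ht.le C ((i3 t ht).trans (by
        have := (i1 t ht.le).norm_le
        gcongr))
      exact ⟨l, fun _ => hl⟩
    -- Beyond the horizon any value serves; the multipliers only have to form a sequence.
    · exact ⟨0, fun h => absurd h ht⟩
  choose l hl using i4
  refine ⟨fun t => Submodule.span ℝ {batchGrad mdp pol H (Bg t ω) (θ t ω), direction d₀ θ t ω},
    fun t => (c * a) • batchGrad mdp pol H (Bg t ω) (θ t ω),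
    fun t => (c * a ^ 2) • batchHess mdp pol H (BH t ω) (θ t ω), l, hl, fun t ht => ?_,
    fun t ht => ?_⟩
  · rw [← smul_sub]
    exact (i1 t ht.le).scale ha hc
  · rw [← smul_sub]
    -- The second generator of the next search plane is the previous step by definition.
    exact Submodule.smul_mem _ _ (Submodule.subset_span (by simp [direction]))

end IsRun

end Pathwise

/-! ### Averaging over the random index. -/

section RandomIndex

/-- The mean of a process at an independent uniform random index. -/
theorem integral_uniform_index {Ω : Type*} {m : MeasurableSpace Ω} [mΩ : MeasurableSpace Ω]
    {μ : Measure Ω} [IsProbabilityMeasure μ] {T : ℕ} {i : Ω → ℕ}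
    (hi : Measurable i) (hunif : μ.map i = uniformOn (Set.Icc 1 T))
    (hindep : Indep (MeasurableSpace.comap i ⊤) m μ) {f : ℕ → Ω → ℝ}
    (hfm : ∀ t, 1 ≤ t → t ≤ T → Measurable[m] (f t))
    (hf : ∀ t, 1 ≤ t → t ≤ T → Integrable (f t) μ) :
    Integrable (fun ω => f (i ω) ω) μ ∧
      ∫ ω, f (i ω) ω ∂μ = (T : ℝ)⁻¹ * ∑ t ∈ Finset.range T, ∫ ω, f (t + 1) ω ∂μ := by
  have hprob : ∀ t, 1 ≤ t → t ≤ T → μ.real (i ⁻¹' {t}) = (T : ℝ)⁻¹ := by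
    intro t h1 h2
    rw [measureReal_def, ← Measure.map_apply hi (measurableSet_singleton t), hunif, uniformOn,
      cond_apply measurableSet_Icc, Set.inter_singleton_of_mem (Set.mem_Icc.2 ⟨h1, h2⟩)]
    simp [Measure.count_apply_finite _ (Set.finite_Icc 1 T)]
  have hmem : ∀ᵐ ω ∂μ, i ω ∈ Set.Icc 1 T := by
    have h1 : ∀ᵐ t ∂(μ.map i), t ∈ Set.Icc 1 T := by
      rw [hunif, uniformOn]
      exact ae_cond_mem measurableSet_Icc
    exact ae_of_ae_map hi.aemeasurable h1
  -- Almost surely the index lies in {1, …, T}, so the process at the index is a finite sum of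
  -- indicators times its values; the shift by one comes from summing over a range that starts at 0.
  have heq : (fun ω => f (i ω) ω) =ᵐ[μ] fun ω =>
      ∑ t ∈ Finset.range T, (i ⁻¹' {t + 1}).indicator 1 ω * f (t + 1) ω := by
    filter_upwards [hmem] with ω hω
    rw [Finset.sum_eq_single_of_mem (i ω - 1) (by
      rw [Finset.mem_range]
      have := hω.1
      have := hω.2
      omega)]
    · have : i ω - 1 + 1 = i ω := Nat.sub_add_cancel hω.1
      simp [this]
    · intro t _ ht
      have : i ω ≠ t + 1 := by
        have := hω.1
        omega
      simp [this]
  have hfi : ∀ t ∈ Finset.range T,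
      Integrable (fun ω => (i ⁻¹' {t + 1}).indicator 1 ω * f (t + 1) ω) μ := by
    intro t ht
    have h1 := (hf (t + 1) (by omega) (Finset.mem_range.1 ht)).indicator
      (hi (measurableSet_singleton (t + 1)))
    refine h1.congr (Filter.Eventually.of_forall fun ω => ?_)
    by_cases h : ω ∈ i ⁻¹' {t + 1} <;> simp [h]
  refine ⟨(integrable_finsetSum _ hfi).congr heq.symm, ?_⟩
  rw [integral_congr_ae heq, integral_finsetSum _ hfi, Finset.mul_sum]
  refine Finset.sum_congr rfl fun t ht => ?_
  have h2 : t + 1 ≤ T := Finset.mem_range.1 ht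
  -- The indicator belongs to the σ-algebra of the index and the value to that of the run, so the
  -- mean factors into 1/T times the mean of the value.
  have hind : IndepFun ((i ⁻¹' {t + 1}).indicator (1 : Ω → ℝ)) (f (t + 1)) μ := by
    rw [IndepFun_iff_Indep]
    refine indep_of_indep_of_le_left (indep_of_indep_of_le_right hindep
      (hfm (t + 1) (by omega) h2).comap_le) ?_
    refine Measurable.comap_le ?_
    have hs : MeasurableSet[MeasurableSpace.comap i ⊤] (i ⁻¹' {t + 1}) := ⟨{t + 1}, trivial, rfl⟩
    exact Measurable.indicator (measurable_const (a := (1 : ℝ))) hs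
  rw [hind.integral_fun_mul_eq_mul_integral
    ((measurable_one.indicator (hi (measurableSet_singleton _))).aestronglyMeasurable)
    (hf (t + 1) (by omega) h2).aestronglyMeasurable,
    integral_indicator_one (hi (measurableSet_singleton _)), hprob (t + 1) (by omega) h2]

end RandomIndex

/-! ### Measurability along a run, and the curvature bound. -/

section Rates

variable {d : ℕ} {S A Ω : Type*} [MeasurableSpace S] [MeasurableSpace A] [mΩ : MeasurableSpace Ω]
  {ν : Measure A} {mdp : MDP S A} {pol : PolicyClass S A ν d} {H Ng NH T : ℕ}
  {G L R M C a c Δ m : ℝ} {θ₀ d₀ : Param d} {μ : Measure Ω} {𝓕 : Filtration ℕ mΩ}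
  {θ : ℕ → Ω → Param d} {Bg : ℕ → Ω → Fin Ng → Traj S A H}
  {BH : ℕ → Ω → Fin NH → Traj S A H} {α : ℕ → Ω → Fin 2 → ℝ}

namespace IsRun

theorem measurable_norm_gradient (h : IsRun mdp pol H Ng NH T Δ θ₀ d₀ μ 𝓕 θ Bg BH α)
    (hlip : LipschitzHessian (objective mdp pol H) M) {t : ℕ} (ht : t ≤ T + 1) :
    Measurable[𝓕 (T + 1)] fun ω => ‖gradient (objective mdp pol H) (θ t ω)‖ := by
  have h1 : Measurable[𝓕 (T + 1)] (θ t) := fun s hs =>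
    𝓕.mono ht _ (h.measurable_iterate t ht hs)
  have h2 : Measurable fun x => ‖gradient (objective mdp pol H) x‖ :=
    hlip.2.1.continuous.norm.measurable
  exact h2.comp h1

theorem measurable_lambdaMin (h : IsRun mdp pol H Ng NH T Δ θ₀ d₀ μ 𝓕 θ Bg BH α) (hd : 0 < d)
    (hlip : LipschitzHessian (objective mdp pol H) M) {t : ℕ} (ht : t ≤ T) :
    Measurable[𝓕 (T + 1)] fun ω => lambdaMin (projHess mdp pol H d₀ θ Bg t ω) := by
  have e : ∀ ω, lambdaMin (projHess mdp pol H d₀ θ Bg t ω) =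
      rayleighInf (projHess mdp pol H d₀ θ Bg t ω) := fun ω =>
    lambdaMin_eq_rayleighInf hd (inner_projected_comm (inner_hess_comm hlip.1 hlip.2.1 (θ t ω)))
  simp only [e]
  have h1 : Measurable[𝓕 (T + 1)] (θ t) := fun s hs =>
    𝓕.mono (by omega) _ (h.measurable_iterate t (by omega) hs)
  have h2 : Measurable[𝓕 (T + 1)] fun ω => batchGrad mdp pol H (Bg t ω) (θ t ω) := fun s hs =>
    𝓕.mono (by omega) _ (h.measurable_batchGrad_succ ht hs)
  have h3 : Measurable[𝓕 (T + 1)] (direction d₀ θ t) := fun s hs =>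
    𝓕.mono (by omega) _ (h.measurable_direction (by omega) hs)
  have h4 := measurable_projected h2 h3 (hlip.continuous_hess.measurable.comp h1)
  exact (continuous_rayleighInf hd).measurable.comp h4

theorem measurable_gradNoise (h : IsRun mdp pol H Ng NH T Δ θ₀ d₀ μ 𝓕 θ Bg BH α)
    (hlip : LipschitzHessian (objective mdp pol H) M) {t : ℕ} (ht : t ≤ T) :
    Measurable (gradNoise mdp pol θ Bg t) := by
  have h1 : Measurable (θ t) := fun s hs => 𝓕.le t _ (h.measurable_iterate t (by omega) hs)
  have h2 : Measurable fun ω => batchGrad mdp pol H (Bg t ω) (θ t ω) := fun s hs =>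
    𝓕.le (t + 1) _ (h.measurable_batchGrad_succ ht hs)
  exact ((hlip.2.1.continuous.measurable.comp h1).sub h2).norm

theorem measurable_hessNoise (h : IsRun mdp pol H Ng NH T Δ θ₀ d₀ μ 𝓕 θ Bg BH α)
    (hlip : LipschitzHessian (objective mdp pol H) M) {t : ℕ} (ht : t ≤ T) :
    Measurable (hessNoise mdp pol d₀ θ Bg BH t) := by
  have h1 : Measurable (θ t) := fun s hs => 𝓕.le t _ (h.measurable_iterate t (by omega) hs)
  have h2 : Measurable fun ω => batchGrad mdp pol H (Bg t ω) (θ t ω) := fun s hs =>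
    𝓕.le (t + 1) _ (h.measurable_batchGrad_succ ht hs)
  have h3 : Measurable (direction d₀ θ t) := fun s hs =>
    𝓕.le t _ (h.measurable_direction (by omega) hs)
  have h4 : Measurable (BH t) := fun s hs => 𝓕.le (t + 1) _ (h.measurable_BH t ht hs)
  exact measurable_frameNorm h2 h3 ((hlip.continuous_hess.measurable.comp h1).sub
    (measurable_batchHess mdp pol H h1 h4))

/-- The curvature along the search space is bounded below by the decrease of the objective. -/
theorem ae_neg_le_lambdaMin (h : IsRun mdp pol H Ng NH T (2 * a) θ₀ d₀ μ 𝓕 θ Bg BH α)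
    (hd : 0 < d) (hlip : LipschitzHessian (objective mdp pol H) M) (ha : 0 < a) (hc : 0 < c)
    (hM : 0 < M) (hac : c * a ^ 3 * M = 1) {t : ℕ} (ht : t ≤ T) : ∀ᵐ ω ∂μ,
      0 ≤ 1 / 2 * (c * objective mdp pol H (θ t ω) - c * objective mdp pol H (θ (t + 1) ω)) +
        2 / 3 + c * a * gradNoise mdp pol θ Bg t ω +
        2 * (c * a ^ 2 * hessNoise mdp pol d₀ θ Bg BH t ω) ∧
      -(1 / 2 * (c * objective mdp pol H (θ t ω) - c * objective mdp pol H (θ (t + 1) ω)) +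
        2 / 3 + c * a * gradNoise mdp pol θ Bg t ω +
        2 * (c * a ^ 2 * hessNoise mdp pol d₀ θ Bg BH t ω)) ≤
        c * a ^ 2 * lambdaMin (projHess mdp pol H d₀ θ Bg t ω) := by
  filter_upwards [h.ae_noisyStep hlip ha hc hac ht] with ω hω
  -- Consistency is not assumed in iteration T and the curvature bound does not involve the leak, so
  -- the constant is chosen to be whatever the leak happens to be.
  obtain ⟨l, h1, h2⟩ := hω (‖(hess (objective mdp pol H) (θ t ω) -
    projHess mdp pol H d₀ θ Bg t ω) (θ (t + 1) ω - θ t ω)‖ / (M * (2 * a) ^ 2))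
    (le_of_eq (by field_simp))
  have h3 := h1.multiplier_le (hlip.scale hc.le ha.le hac)
  have h4 := h1.nonneg
  have h5 := h1.noise_nonneg
  simp only [add_sub_cancel, smul_smul, mul_inv_cancel₀ ha.ne', one_smul] at h3
  have hca : 0 < c * a ^ 2 := by positivity
  set B := hessNoise mdp pol d₀ θ Bg BH t ω
  -- On the plane the batch Hessian is at least minus the rescaled multiplier, and the true Hessian
  -- differs from it there by at most `B`.
  have h6 : -(c * a ^ 2)⁻¹ * (l + c * a ^ 2 * B) ≤
      lambdaMin (projHess mdp pol H d₀ θ Bg t ω) := by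
    refine le_lambdaMin_projected hd (inner_hess_comm hlip.1 hlip.2.1 (θ t ω)) ?_ fun z hz => ?_
    · have : 0 ≤ (c * a ^ 2)⁻¹ * (l + c * a ^ 2 * B) := by positivity
      linarith
    · have h7 := h2 z hz
      have h8 : |⟪z, (hess (objective mdp pol H) (θ t ω) -
          batchHess mdp pol H (BH t ω) (θ t ω)) z⟫| ≤ B * ‖z‖ * ‖z‖ :=
        abs_inner_le_frameNorm _ _ _ hz hz
      have h9 := neg_le_of_abs_le h8
      rw [sub_apply, inner_sub_right] at h9
      rw [smul_apply, inner_smul_right] at h7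
      have h10 : -(c * a ^ 2)⁻¹ * (l * ‖z‖ ^ 2) ≤
          ⟪z, batchHess mdp pol H (BH t ω) (θ t ω) z⟫ := by
        rw [neg_mul, neg_le_iff_add_nonneg', ← div_eq_inv_mul, div_add' _ _ _ hca.ne']
        exact div_nonneg (by linarith) hca.le
      have h11 : -(c * a ^ 2)⁻¹ * (l + c * a ^ 2 * B) * ‖z‖ ^ 2 =
          -(c * a ^ 2)⁻¹ * (l * ‖z‖ ^ 2) - B * ‖z‖ * ‖z‖ := by
        field_simp
        ring
      linarith
  have h7 : -(l + c * a ^ 2 * B) ≤ c * a ^ 2 * lambdaMin (projHess mdp pol H d₀ θ Bg t ω) := by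
    have := mul_le_mul_of_nonneg_left h6 hca.le
    rwa [← mul_assoc, mul_neg, mul_inv_cancel₀ hca.ne', neg_one_mul] at this
  constructor <;> linarith

end IsRun

end Rates

/-! ### Expected sums over the run. -/

section Means

variable {d : ℕ} {S A Ω : Type*} [MeasurableSpace S] [MeasurableSpace A] [mΩ : MeasurableSpace Ω]
  {ν : Measure A} {mdp : MDP S A} {pol : PolicyClass S A ν d} {H Ng NH T : ℕ}
  {G L R M C a c Δ m : ℝ} {θ₀ d₀ : Param d} {μ : Measure Ω} {𝓕 : Filtration ℕ mΩ}
  {θ : ℕ → Ω → Param d} {Bg : ℕ → Ω → Fin Ng → Traj S A H}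
  {BH : ℕ → Ω → Fin NH → Traj S A H} {α : ℕ → Ω → Fin 2 → ℝ}

theorem integral_affine [IsProbabilityMeasure μ] {X Y : Ω → ℝ} (hX : Integrable X μ)
    (hY : Integrable Y μ) (k p q : ℝ) : Integrable (fun ω => k + p * X ω + q * Y ω) μ ∧
      ∫ ω, (k + p * X ω + q * Y ω) ∂μ = k + p * ∫ ω, X ω ∂μ + q * ∫ ω, Y ω ∂μ := by
  have h1 : Integrable (fun ω => k + p * X ω) μ := (integrable_const k).add (hX.const_mul p)
  refine ⟨h1.add (hY.const_mul q), ?_⟩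
  rw [integral_add h1 (hY.const_mul q), integral_add (integrable_const k) (hX.const_mul p),
    integral_const_mul, integral_const_mul]
  simp

namespace IsRun

theorem norm_gradient_scale (hlip : LipschitzHessian (objective mdp pol H) M) (ha : 0 < a)
    (hc : 0 < c) (x : Param d) :
    ‖gradient (fun y => c * objective mdp pol H (a • y)) (a⁻¹ • x)‖ =
      c * a * ‖gradient (objective mdp pol H) x‖ := by
  rw [gradient_scale hlip.1, smul_smul, mul_inv_cancel₀ ha.ne', one_smul, norm_smul,
    Real.norm_of_nonneg (by positivity)]

variable [IsProbabilityMeasure μ]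

theorem sum_integral_norm_gradient_le
    (h : IsRun mdp pol H Ng NH T (2 * a) θ₀ d₀ μ 𝓕 θ Bg BH α) (hd : 0 < d)
    (hlip : LipschitzHessian (objective mdp pol H) M) (ha : 0 < a) (hc : 0 < c) (hM : 0 < M)
    (hC : 0 ≤ C) (hac : c * a ^ 3 * M = 1)
    (hcons : ∀ t < T, ∀ᵐ ω ∂μ,
      ‖(hess (objective mdp pol H) (θ t ω) - projHess mdp pol H d₀ θ Bg t ω)
        (θ (t + 1) ω - θ t ω)‖ ≤ M * C * ‖θ (t + 1) ω - θ t ω‖ ^ 2)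
    (hA : ∀ t ≤ T, Integrable (gradNoise mdp pol θ Bg t) μ ∧
      c * a * ∫ ω, gradNoise mdp pol θ Bg t ω ∂μ ≤ 1 / 12)
    (hB : ∀ t ≤ T, Integrable (hessNoise mdp pol d₀ θ Bg BH t) μ ∧
      c * a ^ 2 * ∫ ω, hessNoise mdp pol d₀ θ Bg BH t ω ∂μ ≤ 37 / 2000)
    (hm : ∀ y, m ≤ objective mdp pol H y) (hD : c * (objective mdp pol H θ₀ - m) ≤ T / 24)
    (hT : 1 ≤ T)
    (hY : ∀ t ≤ T, Integrable (fun ω => ‖gradient (objective mdp pol H) (θ t ω)‖) μ) :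
    c * a * ∑ t ∈ Finset.range T, ∫ ω, ‖gradient (objective mdp pol H) (θ (t + 1) ω)‖ ∂μ ≤
      T * (19 / 6 + 4 * C) ∧
    ∑ t ∈ Finset.range T,
      ∫ ω, max (c * a * ‖gradient (objective mdp pol H) (θ (t + 1) ω)‖ - 4 * C) 2 ∂μ ≤
      T * (10 / 3) := by
  obtain ⟨n, rfl⟩ : ∃ n, T = n + 1 := ⟨T - 1, by omega⟩
  have hca : 0 < c * a := by positivity
  have hf := hlip.scale hc.le ha.le hac
  have hpath := h.ae_noisyPath hlip ha hc hac hM.le hC hcons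
  have hm' : ∀ y, c * m ≤ (fun y => c * objective mdp pol H (a • y)) y := fun y =>
    mul_le_mul_of_nonneg_left (hm _) hc.le
  have h0 : ∀ ω, objective mdp pol H (a • a⁻¹ • θ 0 ω) = objective mdp pol H θ₀ := fun ω => by
    rw [smul_smul, mul_inv_cancel₀ ha.ne', one_smul, h.init]
  have hAa : ∀ t ≤ n + 1, ∀ k p q : ℝ, Integrable (fun ω => k + p * (c * a * gradNoise mdp pol θ Bg t ω) +
      q * (c * a ^ 2 * hessNoise mdp pol d₀ θ Bg BH t ω)) μ ∧
      (0 ≤ p → 0 ≤ q → ∫ ω, (k + p * (c * a * gradNoise mdp pol θ Bg t ω) +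
      q * (c * a ^ 2 * hessNoise mdp pol d₀ θ Bg BH t ω)) ∂μ ≤ k + p * (1 / 12) +
        q * (37 / 2000)) := by
    intro t ht k p q
    obtain ⟨e1, e2⟩ := integral_affine ((hA t ht).1.const_mul (c * a))
      ((hB t ht).1.const_mul (c * a ^ 2)) k p q
    refine ⟨e1, fun hp hq => ?_⟩
    rw [e2, integral_const_mul, integral_const_mul]
    have := mul_le_mul_of_nonneg_left (hA t ht).2 hp
    have := mul_le_mul_of_nonneg_left (hB t ht).2 hq
    linarith
  constructor
  · have hi : ∀ t ∈ Finset.range (n + 1), Integrable (fun ω =>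
        c * a * ‖gradient (objective mdp pol H) (θ (t + 1) ω)‖ - 4 * C) μ := fun t ht =>
      ((hY (t + 1) (Finset.mem_range.1 ht)).const_mul _).sub (integrable_const _)
    have hr : ∀ t ∈ Finset.range n, Integrable (fun ω => 41 / 15 +
        18 / 5 * (c * a * gradNoise mdp pol θ Bg t ω) +
        43 / 10 * (c * a ^ 2 * hessNoise mdp pol d₀ θ Bg BH t ω)) μ := fun t ht =>
      (hAa t (by have := Finset.mem_range.1 ht; omega) _ _ _).1
    have hl := (hAa n (by omega) (14 / 5) 3 4)
    have hR : Integrable (fun ω => (c * objective mdp pol H θ₀ - c * m) +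
        ∑ t ∈ Finset.range n, (41 / 15 + 18 / 5 * (c * a * gradNoise mdp pol θ Bg t ω) +
        43 / 10 * (c * a ^ 2 * hessNoise mdp pol d₀ θ Bg BH t ω))) μ :=
      (integrable_const _).add (integrable_finsetSum _ hr)
    have hmono : ∫ ω, ∑ t ∈ Finset.range (n + 1),
        (c * a * ‖gradient (objective mdp pol H) (θ (t + 1) ω)‖ - 4 * C) ∂μ ≤
        ∫ ω, ((c * objective mdp pol H θ₀ - c * m) +
        ∑ t ∈ Finset.range n, (41 / 15 + 18 / 5 * (c * a * gradNoise mdp pol θ Bg t ω) +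
        43 / 10 * (c * a ^ 2 * hessNoise mdp pol d₀ θ Bg BH t ω)) +
        (14 / 5 + 3 * (c * a * gradNoise mdp pol θ Bg n ω) +
        4 * (c * a ^ 2 * hessNoise mdp pol d₀ θ Bg BH n ω))) ∂μ := by
      refine integral_mono_ae (integrable_finsetSum _ hi) (hR.add hl.1) ?_
      filter_upwards [hpath] with ω ⟨E, g, K, l, hp⟩
      have := hp.sum_norm_gradient_le hd hf hm'
      simp only [norm_gradient_scale hlip ha hc, h0] at this
      exact this
    rw [integral_add hR hl.1, integral_add (integrable_const _) (integrable_finsetSum _ hr),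
      integral_finsetSum _ hr, integral_finsetSum _ hi] at hmono
    have e1 : ∀ t ∈ Finset.range (n + 1),
        ∫ ω, (c * a * ‖gradient (objective mdp pol H) (θ (t + 1) ω)‖ - 4 * C) ∂μ =
        c * a * ∫ ω, ‖gradient (objective mdp pol H) (θ (t + 1) ω)‖ ∂μ - 4 * C := by
      intro t ht
      rw [integral_sub ((hY (t + 1) (Finset.mem_range.1 ht)).const_mul _) (integrable_const _),
        integral_const_mul]
      simp
    rw [Finset.sum_congr rfl e1, Finset.sum_sub_distrib, ← Finset.mul_sum] at hmono
    have e2 := Finset.sum_le_sum (s := Finset.range n) fun t ht =>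
      (hAa t (by have := Finset.mem_range.1 ht; omega) (41 / 15) (18 / 5) (43 / 10)).2
        (by norm_num) (by norm_num)
    have e3 := hl.2 (by norm_num) (by norm_num)
    have e4 := hmono.trans (add_le_add (add_le_add le_rfl e2) e3)
    simp only [integral_const, probReal_univ, smul_eq_mul, one_mul, Finset.sum_const,
      Finset.card_range, nsmul_eq_mul] at e4
    -- Per ordinary step the total is 41/15 + (18/5)/12 + (43/10)(37/2000), and for the last step
    -- 14/5 + 3/12 + 4(37/2000). With the share 1/24 of the initial gap, both remain below 19/6.
    push_cast at e4 hD ⊢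
    have hn : (0 : ℝ) ≤ n := Nat.cast_nonneg n
    linarith
  · have hi : ∀ t ∈ Finset.range (n + 1), Integrable (fun ω =>
        max (c * a * ‖gradient (objective mdp pol H) (θ (t + 1) ω)‖ - 4 * C) 2) μ := fun t ht =>
      (((hY (t + 1) (Finset.mem_range.1 ht)).const_mul _).sub (integrable_const _)).sup
        (integrable_const _)
    have hr : ∀ t ∈ Finset.range (n + 1), Integrable (fun ω => 14 / 5 +
        18 / 5 * (c * a * gradNoise mdp pol θ Bg t ω) +
        43 / 10 * (c * a ^ 2 * hessNoise mdp pol d₀ θ Bg BH t ω)) μ := fun t ht =>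
      (hAa t (Finset.mem_range.1 ht).le _ _ _).1
    have hmono : ∫ ω, ∑ t ∈ Finset.range (n + 1),
        max (c * a * ‖gradient (objective mdp pol H) (θ (t + 1) ω)‖ - 4 * C) 2 ∂μ ≤
        ∫ ω, ((c * objective mdp pol H θ₀ - c * m) + ∑ t ∈ Finset.range (n + 1),
        (14 / 5 + 18 / 5 * (c * a * gradNoise mdp pol θ Bg t ω) +
        43 / 10 * (c * a ^ 2 * hessNoise mdp pol d₀ θ Bg BH t ω))) ∂μ := by
      refine integral_mono_ae (integrable_finsetSum _ hi)
        ((integrable_const _).add (integrable_finsetSum _ hr)) ?_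
      filter_upwards [hpath] with ω ⟨E, g, K, l, hp⟩
      have := hp.sum_max_norm_gradient_le hd hf hm'
      simp only [norm_gradient_scale hlip ha hc, h0] at this
      exact this
    rw [integral_add (integrable_const _) (integrable_finsetSum _ hr),
      integral_finsetSum _ hr, integral_finsetSum _ hi] at hmono
    have e2 := Finset.sum_le_sum (s := Finset.range (n + 1)) fun t ht =>
      (hAa t (Finset.mem_range.1 ht).le (14 / 5) (18 / 5) (43 / 10)).2
        (by norm_num) (by norm_num)
    have e4 := hmono.trans (add_le_add le_rfl e2)
    simp only [integral_const, probReal_univ, smul_eq_mul, one_mul, Finset.sum_const,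
      Finset.card_range, nsmul_eq_mul] at e4
    -- Here 14/5 + (18/5)/12 + (43/10)(37/2000) + 1/24 is less than 10/3.
    push_cast at e4 hD ⊢
    have hn : (0 : ℝ) ≤ n := Nat.cast_nonneg n
    linarith

theorem sum_integral_lambdaMin_ge
    (h : IsRun mdp pol H Ng NH T (2 * a) θ₀ d₀ μ 𝓕 θ Bg BH α) (hd : 0 < d)
    (hlip : LipschitzHessian (objective mdp pol H) M) (ha : 0 < a) (hc : 0 < c) (hM : 0 < M)
    (hac : c * a ^ 3 * M = 1)
    (hA : ∀ t ≤ T, Integrable (gradNoise mdp pol θ Bg t) μ ∧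
      c * a * ∫ ω, gradNoise mdp pol θ Bg t ω ∂μ ≤ 1 / 12)
    (hB : ∀ t ≤ T, Integrable (hessNoise mdp pol d₀ θ Bg BH t) μ ∧
      c * a ^ 2 * ∫ ω, hessNoise mdp pol d₀ θ Bg BH t ω ∂μ ≤ 37 / 2000)
    (hm : ∀ y, m ≤ objective mdp pol H y) (hD : c * (objective mdp pol H θ₀ - m) ≤ T / 24)
    (hT : 1 ≤ T)
    (hΛ : ∀ t ≤ T, Integrable (fun ω => lambdaMin (projHess mdp pol H d₀ θ Bg t ω)) μ) :
    -(T * 2) ≤ c * a ^ 2 * ∑ t ∈ Finset.range T,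
      ∫ ω, lambdaMin (projHess mdp pol H d₀ θ Bg (t + 1) ω) ∂μ := by
  have hae := ae_all_iff.2 fun t => ae_all_iff.2 fun ht : t ≤ T =>
    h.ae_neg_le_lambdaMin hd hlip ha hc hM hac ht
  have hi : ∀ t ∈ Finset.range T, Integrable (fun ω =>
      lambdaMin (projHess mdp pol H d₀ θ Bg (t + 1) ω)) μ := fun t ht =>
    hΛ (t + 1) (Finset.mem_range.1 ht)
  have hr : ∀ t ∈ Finset.range (T + 1), Integrable (fun ω => 2 / 3 +
      1 * (c * a * gradNoise mdp pol θ Bg t ω) +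
      2 * (c * a ^ 2 * hessNoise mdp pol d₀ θ Bg BH t ω)) μ := fun t ht =>
    have ht' := Nat.lt_succ_iff.1 (Finset.mem_range.1 ht)
    (integral_affine ((hA t ht').1.const_mul _) ((hB t ht').1.const_mul _) _ _ _).1
  have hn : Integrable (fun ω => -∑ t ∈ Finset.range (T + 1),
      (2 / 3 + 1 * (c * a * gradNoise mdp pol θ Bg t ω) +
      2 * (c * a ^ 2 * hessNoise mdp pol d₀ θ Bg BH t ω))) μ := (integrable_finsetSum _ hr).neg
  have hR : Integrable (fun ω => -(1 / 2 * (c * objective mdp pol H θ₀ - c * m)) +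
      -∑ t ∈ Finset.range (T + 1), (2 / 3 + 1 * (c * a * gradNoise mdp pol θ Bg t ω) +
      2 * (c * a ^ 2 * hessNoise mdp pol d₀ θ Bg BH t ω))) μ :=
    (integrable_const _).add hn
  have hmono : ∫ ω, (-(1 / 2 * (c * objective mdp pol H θ₀ - c * m)) +
      -∑ t ∈ Finset.range (T + 1), (2 / 3 + 1 * (c * a * gradNoise mdp pol θ Bg t ω) +
      2 * (c * a ^ 2 * hessNoise mdp pol d₀ θ Bg BH t ω))) ∂μ ≤
      ∫ ω, c * a ^ 2 * ∑ t ∈ Finset.range T,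
        lambdaMin (projHess mdp pol H d₀ θ Bg (t + 1) ω) ∂μ := by
    refine integral_mono_ae hR ((integrable_finsetSum _ hi).const_mul _) ?_
    filter_upwards [hae] with ω hω
    have h1 : -∑ t ∈ Finset.range T,
        (1 / 2 * (c * objective mdp pol H (θ (t + 1) ω) - c * objective mdp pol H (θ (t + 1 + 1) ω))
        + 2 / 3 + c * a * gradNoise mdp pol θ Bg (t + 1) ω +
        2 * (c * a ^ 2 * hessNoise mdp pol d₀ θ Bg BH (t + 1) ω)) ≤ c * a ^ 2 *
        ∑ t ∈ Finset.range T, lambdaMin (projHess mdp pol H d₀ θ Bg (t + 1) ω) := by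
      rw [← Finset.sum_neg_distrib, Finset.mul_sum]
      exact Finset.sum_le_sum fun t ht => (hω (t + 1) (Finset.mem_range.1 ht)).2
    -- The eigenvalues are summed over t = 1, …, T, but the decrease should telescope from the
    -- deterministic θ₀. The bound for t = 0 is nonnegative, so it may be added, giving T + 1 terms.
    have h2 := (hω 0 (Nat.zero_le T)).1
    have h3 : ∑ t ∈ Finset.range (T + 1),
        (1 / 2 * (c * objective mdp pol H (θ t ω) - c * objective mdp pol H (θ (t + 1) ω))
        + 2 / 3 + c * a * gradNoise mdp pol θ Bg t ω +
        2 * (c * a ^ 2 * hessNoise mdp pol d₀ θ Bg BH t ω)) =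
        1 / 2 * (c * objective mdp pol H (θ 0 ω) - c * objective mdp pol H (θ (T + 1) ω)) +
        ∑ t ∈ Finset.range (T + 1), (2 / 3 + 1 * (c * a * gradNoise mdp pol θ Bg t ω) +
        2 * (c * a ^ 2 * hessNoise mdp pol d₀ θ Bg BH t ω)) := by
      rw [← Finset.sum_range_sub' (fun t => c * objective mdp pol H (θ t ω)), Finset.mul_sum,
        ← Finset.sum_add_distrib]
      exact Finset.sum_congr rfl fun t _ => by ring
    rw [Finset.sum_range_succ'] at h3
    rw [h.init] at h2 h3
    have h4 := mul_le_mul_of_nonneg_left (hm (θ (T + 1) ω)) hc.le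
    linarith
  rw [integral_const_mul, integral_finsetSum _ hi, integral_add (integrable_const _) hn,
    integral_neg, integral_neg, integral_finsetSum _ hr] at hmono
  have e2 : ∑ t ∈ Finset.range (T + 1), ∫ ω, (2 / 3 + 1 * (c * a * gradNoise mdp pol θ Bg t ω) +
      2 * (c * a ^ 2 * hessNoise mdp pol d₀ θ Bg BH t ω)) ∂μ ≤
      ∑ _t ∈ Finset.range (T + 1), (4 / 5 : ℝ) := by
    refine Finset.sum_le_sum fun t ht => ?_
    have ht' := Nat.lt_succ_iff.1 (Finset.mem_range.1 ht)
    rw [(integral_affine ((hA t ht').1.const_mul _) ((hB t ht').1.const_mul _) _ _ _).2,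
      integral_const_mul, integral_const_mul]
    linarith [(hA t ht').2, (hB t ht').2]
  simp only [integral_const, probReal_univ, smul_eq_mul, one_mul, Finset.sum_const,
    Finset.card_range, nsmul_eq_mul] at hmono e2
  push_cast at e2
  have hT' : (1 : ℝ) ≤ T := by exact_mod_cast hT
  -- Each of the T + 1 terms is at most 2/3 + 1/12 + 2(37/2000), below 4/5, and T + 1 ≤ 2T; with
  -- half the initial gap the sum stays under 2T.
  linarith

end IsRun

end Means

/-! ### Batch sizes, integrability and the probability bound. -/

section Rates

variable {d : ℕ} {S A Ω : Type*} [MeasurableSpace S] [MeasurableSpace A] [mΩ : MeasurableSpace Ω]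
  {ν : Measure A} [SFinite ν] {mdp : MDP S A} {pol : PolicyClass S A ν d} {H Ng NH T : ℕ}
  {G L R M ε Δ : ℝ} {θ₀ d₀ : Param d} {μ : Measure Ω} [IsProbabilityMeasure μ]
  {𝓕 : Filtration ℕ mΩ}
  {θ : ℕ → Ω → Param d} {Bg : ℕ → Ω → Fin Ng → Traj S A H}
  {BH : ℕ → Ω → Fin NH → Traj S A H} {α : ℕ → Ω → Fin 2 → ℝ}

theorem gradVar_pos (mdp : MDP S A) (hR : 0 < R) (hG : 0 < G) : 0 < gradVar mdp R G := by
  have := sub_pos.2 mdp.γ_lt_one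
  unfold gradVar
  positivity

theorem hessVar_pos (mdp : MDP S A) (H : ℕ) (hR : 0 < R) (hL : 0 < L) :
    0 < hessVar mdp H R G L := by
  have := sub_pos.2 mdp.γ_lt_one
  unfold hessVar
  positivity

namespace IsRun

theorem integral_gradNoise_le (h : IsRun mdp pol H Ng NH T Δ θ₀ d₀ μ 𝓕 θ Bg BH α)
    (hR : 0 < R) (hG : 0 < G) (hM : 0 < M) (hε : 0 < ε) (hbdd : BoundedRegret mdp R)
    (hreg : ExpectedLipschitzSmooth mdp pol H G L)
    (hlip : LipschitzHessian (objective mdp pol H) M)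
    (hNg : 144 * M ^ 2 * gradVar mdp R G / ε ^ 2 ≤ Ng) {t : ℕ} (ht : t ≤ T) :
    Integrable (gradNoise mdp pol θ Bg t) μ ∧
      ∫ ω, gradNoise mdp pol θ Bg t ω ∂μ ≤ ε / (12 * M) := by
  have hv := gradVar_pos mdp hR hG
  have hN : (0 : ℝ) < Ng := lt_of_lt_of_le (by positivity) hNg
  refine integrable_of_lintegral_sq_le (h.measurable_gradNoise hlip ht) (by positivity)
    ((h.lintegral_grad_noise hR.le hbdd hreg hlip (by exact_mod_cast hN) ht).trans
      (ENNReal.ofReal_le_ofReal ?_))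
  rw [div_le_iff₀ (by positivity)] at hNg
  rw [div_pow, div_le_div_iff₀ hN (by positivity)]
  linarith

/-- The logarithm enters only through log d ≥ log 2; the constant 37/2000 is chosen so that 3 / (22
* 24² * log 2) is at most its square. -/
theorem integral_hessNoise_le (h : IsRun mdp pol H Ng NH T Δ θ₀ d₀ μ 𝓕 θ Bg BH α)
    (hd : 2 ≤ d) (hR : 0 < R) (hL : 0 < L) (hε : 0 < ε) (hbdd : BoundedRegret mdp R)
    (hreg : ExpectedLipschitzSmooth mdp pol H G L)
    (hlip : LipschitzHessian (objective mdp pol H) M)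
    (hNH : 22 * 24 ^ 2 * hessVar mdp H R G L * Real.log d / ε ≤ NH) {t : ℕ} (ht : t ≤ T) :
    Integrable (hessNoise mdp pol d₀ θ Bg BH t) μ ∧
      ∫ ω, hessNoise mdp pol d₀ θ Bg BH t ω ∂μ ≤ 37 / 2000 * Real.sqrt ε := by
  have hv : 0 < hessVar mdp H R G L := hessVar_pos mdp H hR hL
  have hlog : 0.6931471803 < Real.log d := Real.log_two_gt_d9.trans_le
    (Real.log_le_log (by norm_num) (by exact_mod_cast hd))
  have hlog' : 0 < Real.log d := by linarith
  have hN : (0 : ℝ) < NH := lt_of_lt_of_le (by positivity) hNH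
  refine integrable_of_lintegral_sq_le (h.measurable_hessNoise hlip ht) (by positivity)
    ((h.lintegral_hess_noise hR.le hbdd hreg hlip hlip.continuous_hess (by exact_mod_cast hN)
      ht).trans (ENNReal.ofReal_le_ofReal ?_))
  rw [div_le_iff₀ (by positivity)] at hNH
  rw [mul_pow, Real.sq_sqrt hε.le, div_le_iff₀ hN]
  have := mul_lt_mul_of_pos_left hlog hv
  linarith

theorem integrable_norm_gradient (h : IsRun mdp pol H Ng NH T Δ θ₀ d₀ μ 𝓕 θ Bg BH α)
    (hR : 0 ≤ R) (hbdd : BoundedRegret mdp R) (hreg : ExpectedLipschitzSmooth mdp pol H G L)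
    (hlip : LipschitzHessian (objective mdp pol H) M) {t : ℕ} (ht : t ≤ T) :
    Integrable (fun ω => ‖gradient (objective mdp pol H) (θ t ω)‖) μ := by
  have hm : Measurable fun ω => ‖gradient (objective mdp pol H) (θ t ω)‖ := fun s hs =>
    𝓕.le (T + 1) _ (h.measurable_norm_gradient hlip (by omega) hs)
  refine Integrable.of_bound hm.aestronglyMeasurable (Real.sqrt (gradVar mdp R G))
    (Filter.Eventually.of_forall fun ω => ?_)
  rw [norm_norm]
  exact Real.le_sqrt_of_sq_le (norm_gradient_objective_sq_le hR hbdd hreg hlip.1 _)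

theorem integrable_lambdaMin (h : IsRun mdp pol H Ng NH T Δ θ₀ d₀ μ 𝓕 θ Bg BH α)
    (hd : 0 < d) (hR : 0 < R) (hL : 0 < L) (hbdd : BoundedRegret mdp R)
    (hreg : ExpectedLipschitzSmooth mdp pol H G L)
    (hlip : LipschitzHessian (objective mdp pol H) M) {t : ℕ} (ht : t ≤ T) :
    Integrable (fun ω => lambdaMin (projHess mdp pol H d₀ θ Bg t ω)) μ := by
  have hv : 0 < hessVar mdp H R G L := hessVar_pos mdp H hR hL
  have hm : Measurable fun ω => lambdaMin (projHess mdp pol H d₀ θ Bg t ω) := fun s hs =>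
    𝓕.le (T + 1) _ (h.measurable_lambdaMin hd hlip ht hs)
  exact Integrable.of_bound hm.aestronglyMeasurable (1 + 3 * hessVar mdp H R G L)
    (Filter.Eventually.of_forall fun ω =>
      abs_lambdaMin_projected_le hd (inner_hess_comm hlip.1 hlip.2.1 (θ t ω)) (by positivity)
        (abs_inner_hess_objective_le hR.le hbdd hreg hlip.1 hlip.2.1 (θ t ω)))

end IsRun

/-- Markov's inequality for a variable bounded below by `2`, in complementary form. -/
theorem seven_eighths_le_measure_of_integral_max_le {X : Ω → ℝ} {k b : ℝ}
    (hX : Integrable (fun ω => max (X ω - k) 2) μ)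
    (h : ∫ ω, max (X ω - k) 2 ∂μ ≤ 10 / 3) (hb : k + 38 / 3 ≤ b) :
    7 / 8 ≤ μ {ω | X ω ≤ b} := by
  have hi : Integrable (fun ω => max (X ω - k) 2 - 2) μ := hX.sub (integrable_const _)
  have h0 : ∀ ω, 0 ≤ max (X ω - k) 2 - 2 := fun ω => sub_nonneg.2 (le_max_right _ _)
  -- After subtracting the floor 2 the mean is at most 4/3 and the threshold 38/3 becomes 32/3, so
  -- the quotient is 1/8.
  have h1 := mul_meas_ge_le_integral_of_nonneg (Filter.Eventually.of_forall h0) hi (32 / 3)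
  rw [integral_sub hX (integrable_const _)] at h1
  simp only [integral_const, probReal_univ, smul_eq_mul, one_mul] at h1
  set Z := {ω | 32 / 3 ≤ max (X ω - k) 2 - 2} with hZ
  have h2 : μ.real Z ≤ 1 / 8 := by linarith
  have h3 : μ Z ≤ 1 / 8 := by
    rw [← ofReal_measureReal]
    refine (ENNReal.ofReal_le_ofReal h2).trans_eq ?_
    rw [ENNReal.ofReal_div_of_pos (by norm_num)]
    norm_num
  have h4 : (Set.univ : Set Ω) ⊆ {ω | X ω ≤ b} ∪ Z := by
    intro ω _
    by_cases hω : X ω ≤ b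
    · exact Or.inl hω
    · refine Or.inr ?_
      have := le_max_left (X ω - k) 2
      simp only [hZ, Set.mem_ofPred_eq]
      linarith
  have h5 : 1 ≤ μ {ω | X ω ≤ b} + 1 / 8 := by
    calc (1 : ℝ≥0∞) = μ Set.univ := measure_univ.symm
      _ ≤ μ ({ω | X ω ≤ b} ∪ Z) := measure_mono h4
      _ ≤ _ := (measure_union_le _ _).trans (add_le_add le_rfl h3)
  have h6 : (7 / 8 : ℝ≥0∞) + 1 / 8 = 1 := by
    rw [ENNReal.div_add_div_same, show (7 : ℝ≥0∞) + 1 = 8 by norm_num]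
    exact ENNReal.div_self (by norm_num) (by norm_num)
  exact (ENNReal.add_le_add_iff_right (by simp : (1 / 8 : ℝ≥0∞) ≠ ∞)).1 (h6.le.trans h5)

end Rates

end DRSOPO

end

theorem theorem3p6 {S A Ω : Type*} [MeasurableSpace S] [MeasurableSpace A]
    [mΩ : MeasurableSpace Ω] {ν : Measure A} [SigmaFinite ν] {d : ℕ} (hd : 2 ≤ d)
    (mdp : DRSOPO.MDP S A) (pol : DRSOPO.PolicyClass S A ν d) (H : ℕ)
    (R G L M C ε ΔJ : ℝ) (hR : 0 < R) (hG : 0 < G) (hL : 0 < L) (hM : 0 < M) (hC : 0 < C)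
    (hε : 0 < ε)
    -- the first three assumptions
    (hbdd : DRSOPO.BoundedRegret mdp R)
    (hreg : DRSOPO.ExpectedLipschitzSmooth mdp pol H G L)
    (hlip : DRSOPO.LipschitzHessian (DRSOPO.objective mdp pol H) M)
    -- parameters
    (θ₀ d₀ : DRSOPO.Param d)
    (hΔJ : DRSOPO.objective mdp pol H θ₀ - ⨅ x, DRSOPO.objective mdp pol H x ≤ ΔJ)
    (Ng NH T : ℕ)
    (hNg : 144 * M ^ 2 * DRSOPO.gradVar mdp R G / ε ^ 2 ≤ Ng)
    (hNH : 22 * 24 ^ 2 * DRSOPO.hessVar mdp H R G L * Real.log d / ε ≤ NH)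
    (hT : 24 * M ^ 2 * ΔJ / ε ^ (3 / 2 : ℝ) ≤ T) (hT1 : 1 ≤ T)
    -- a run of the algorithm
    (μ : Measure Ω) [IsProbabilityMeasure μ] (𝓕 : Filtration ℕ mΩ)
    (θ : ℕ → Ω → DRSOPO.Param d) (Bg : ℕ → Ω → Fin Ng → DRSOPO.Traj S A H)
    (BH : ℕ → Ω → Fin NH → DRSOPO.Traj S A H) (α : ℕ → Ω → Fin 2 → ℝ)
    (hrun : DRSOPO.IsRun mdp pol H Ng NH T (2 * Real.sqrt ε / M) θ₀ d₀ μ 𝓕 θ Bg BH α)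
    -- consistency of the Hessian with its projection along the steps
    (hcons : ∀ t < T, ∀ᵐ ω ∂μ,
      ‖(DRSOPO.hess (DRSOPO.objective mdp pol H) (θ t ω)
          - DRSOPO.projHess mdp pol H d₀ θ Bg t ω) (θ (t + 1) ω - θ t ω)‖
        ≤ M * C * ‖θ (t + 1) ω - θ t ω‖ ^ 2)
    -- a uniformly random index in `{1, …, T}`, independent of the run
    (tbar : Ω → ℕ) (htbar : Measurable tbar)
    (hunif : μ.map tbar = uniformOn (Set.Icc 1 T))
    (hindep : Indep (MeasurableSpace.comap tbar ⊤) (𝓕 (T + 1)) μ) :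
    (Integrable (fun ω => ‖gradient (DRSOPO.objective mdp pol H) (θ (tbar ω) ω)‖) μ ∧
      ∫ ω, ‖gradient (DRSOPO.objective mdp pol H) (θ (tbar ω) ω)‖ ∂μ
        ≤ (3 + 4 * (C + 1 / 24)) / M * ε) ∧
    (Integrable (fun ω =>
        DRSOPO.lambdaMin (DRSOPO.projHess mdp pol H d₀ θ Bg (tbar ω) ω)) μ ∧
      -3 * Real.sqrt ε ≤
        ∫ ω, DRSOPO.lambdaMin (DRSOPO.projHess mdp pol H d₀ θ Bg (tbar ω) ω) ∂μ) ∧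
    7 / 8 ≤ μ {ω | ‖gradient (DRSOPO.objective mdp pol H) (θ (tbar ω) ω)‖
        ≤ (12 + 16 * (C + 1 / 24)) / M * ε} := by
  set σ := Real.sqrt ε with hσ
  have hσ0 : 0 < σ := Real.sqrt_pos.2 hε
  have hσ2 : σ ^ 2 = ε := Real.sq_sqrt hε.le
  have hpow : ε ^ (3 / 2 : ℝ) = σ ^ 3 := by
    rw [hσ, Real.sqrt_eq_rpow, ← Real.rpow_natCast, ← Real.rpow_mul hε.le]
    norm_num
  -- These are the units in which the Lipschitz constant of the Hessian is 1 and the radius 2σ/M is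
  -- 2.
  set a := σ / M with ha_def
  set c := M ^ 2 / σ ^ 3 with hc_def
  have ha : 0 < a := by positivity
  have hc : 0 < c := by positivity
  have hac : c * a ^ 3 * M = 1 := by rw [ha_def, hc_def]; field_simp
  have hca : c * a = M / ε := by rw [ha_def, hc_def, ← hσ2]; field_simp
  have hca2 : c * a ^ 2 = 1 / σ := by rw [ha_def, hc_def]; field_simp
  have hca0 : 0 < c * a := by positivity
  have hd0 : 0 < d := by omega
  have hT0 : (0 : ℝ) < T := by exact_mod_cast hT1
  rw [mul_div_assoc] at hrun
  have hA : ∀ t ≤ T, Integrable (DRSOPO.gradNoise mdp pol θ Bg t) μ ∧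
      c * a * ∫ ω, DRSOPO.gradNoise mdp pol θ Bg t ω ∂μ ≤ 1 / 12 := by
    intro t ht
    obtain ⟨h1, h2⟩ := hrun.integral_gradNoise_le hR hG hM hε hbdd hreg hlip hNg ht
    refine ⟨h1, (mul_le_mul_of_nonneg_left h2 hca0.le).trans_eq ?_⟩
    rw [hca]
    field_simp
  have hB : ∀ t ≤ T, Integrable (DRSOPO.hessNoise mdp pol d₀ θ Bg BH t) μ ∧
      c * a ^ 2 * ∫ ω, DRSOPO.hessNoise mdp pol d₀ θ Bg BH t ω ∂μ ≤ 37 / 2000 := by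
    intro t ht
    obtain ⟨h1, h2⟩ := hrun.integral_hessNoise_le hd hR hL hε hbdd hreg hlip hNH ht
    refine ⟨h1, (mul_le_mul_of_nonneg_left h2 (by positivity)).trans_eq ?_⟩
    rw [hca2, ← hσ]
    field_simp
  have hm := DRSOPO.iInf_objective_le (pol := pol) (H := H) hR.le hbdd
  have hD : c * (DRSOPO.objective mdp pol H θ₀ - ⨅ x, DRSOPO.objective mdp pol H x) ≤
      T / 24 := by
    refine (mul_le_mul_of_nonneg_left hΔJ hc.le).trans ?_
    rw [hpow] at hT
    have e : 24 * M ^ 2 * ΔJ / σ ^ 3 = 24 * (c * ΔJ) := by rw [hc_def]; ring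
    linarith
  have hY : ∀ t ≤ T,
      Integrable (fun ω => ‖gradient (DRSOPO.objective mdp pol H) (θ t ω)‖) μ := fun t ht =>
    hrun.integrable_norm_gradient hR.le hbdd hreg hlip ht
  have hΛ : ∀ t ≤ T, Integrable (fun ω =>
      DRSOPO.lambdaMin (DRSOPO.projHess mdp pol H d₀ θ Bg t ω)) μ := fun t ht =>
    hrun.integrable_lambdaMin hd0 hR hL hbdd hreg hlip ht
  obtain ⟨hsum, hmax⟩ := hrun.sum_integral_norm_gradient_le hd0 hlip ha hc hM hC.le hac hcons
    hA hB hm hD hT1 hY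
  have hlam := hrun.sum_integral_lambdaMin_ge hd0 hlip ha hc hM hac hA hB hm hD hT1 hΛ
  obtain ⟨i1, e1⟩ := DRSOPO.integral_uniform_index htbar hunif hindep
    (f := fun t ω => ‖gradient (DRSOPO.objective mdp pol H) (θ t ω)‖)
    (fun t _ ht => hrun.measurable_norm_gradient hlip (by omega)) (fun t _ ht => hY t ht)
  obtain ⟨i2, e2⟩ := DRSOPO.integral_uniform_index htbar hunif hindep
    (f := fun t ω => DRSOPO.lambdaMin (DRSOPO.projHess mdp pol H d₀ θ Bg t ω))
    (fun t _ ht => hrun.measurable_lambdaMin hd0 hlip ht) (fun t _ ht => hΛ t ht)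
  obtain ⟨i3, e3⟩ := DRSOPO.integral_uniform_index htbar hunif hindep
    (f := fun t ω => max (c * a * ‖gradient (DRSOPO.objective mdp pol H) (θ t ω)‖ - 4 * C) 2)
    (fun t _ ht => (((hrun.measurable_norm_gradient hlip (by omega)).const_mul
      (c * a)).sub_const (4 * C)).max measurable_const)
    (fun t _ ht => (((hY t ht).const_mul (c * a)).sub (integrable_const (4 * C))).sup
      (integrable_const 2))
  refine ⟨⟨i1, ?_⟩, ⟨i2, ?_⟩, ?_⟩
  · rw [e1, inv_mul_le_iff₀ hT0]
    rw [hca] at hsum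
    refine le_of_mul_le_mul_left (hsum.trans_eq ?_) (by positivity : 0 < M / ε)
    field_simp
    ring
  · rw [e2, ← div_eq_inv_mul, le_div_iff₀ hT0]
    rw [hca2, one_div, ← div_eq_inv_mul, le_div_iff₀ hσ0] at hlam
    have := mul_pos hσ0 hT0
    -- The mean eigenvalue is in fact at least -2√ε.
    linarith
  -- Plain Markov on the norm, with mean 19/6 + 4C and threshold 38/3 + 16C, would leave a failure
  -- probability of 1/4; the floored variable brings it to 1/8.
  · have hX : ∫ ω, max (c * a * ‖gradient (DRSOPO.objective mdp pol H) (θ (tbar ω) ω)‖ -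
        4 * C) 2 ∂μ ≤ 10 / 3 := by
      rw [e3, inv_mul_le_iff₀ hT0]
      exact hmax
    refine (DRSOPO.seven_eighths_le_measure_of_integral_max_le
      (b := 12 + 16 * (C + 1 / 24)) i3 hX (by linarith)).trans (measure_mono fun ω hω => ?_)
    simp only [Set.mem_ofPred_eq, hca] at hω ⊢
    refine le_of_mul_le_mul_left (hω.trans_eq ?_) (by positivity : 0 < M / ε)
    field_simp
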